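/- **Theorem (convergence of the $\pi$ method).** Let $X\neq\{0\}$ be a complex Banach space, let $E:=\ell^2(\mathbb Z,X)$ with norm $\|x\|=(\sum_{j\in\mathbb Z}\|x_j\|_X^2)^{1/2}$, and let $A$ be a bounded linear operator on $E$ with matrix representation $[a_{i,j}]_{i,j\in\mathbb Z}$, $a_{i,j}\in L(X)$, that is tridiagonal, i.e. $a_{i,j}=0$ for $|i-j|>1$. Write $\alpha_j:=a_{j+1,j}$, $\gamma_j:=a_{j-1,j}$, $\|\alpha\|_\infty:=\sup_j\|\alpha_j\|$, $\|\gamma\|_\infty:=\sup_j\|\gamma_j\|$. For a bounded operator $B$ on a complex Banach space $Y\ne\{0\}$ let $\operatorname{spec}_\varepsilon B:=\{\lambda\in\mathbb C: 1/\|(B-\lambda I)^{-1}\|<\varepsilon\}$ for $\varepsilon>0$, and $\operatorname{Spec}_\varepsilon B:=\{\lambda\in\mathbb C: 1/\|(B-\lambda I)^{-1}\|\le\varepsilon\}$ for $\varepsilon\ge0$, where $1/\|(B-\lambda I)^{-1}\|:=0$ if $B-\lambda I$ is not invertible; thus $\operatorname{Spec}_0B$ is the spectrum $\operatorname{Spec}B$.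 Let $t\in\mathbb C$ with $|t|=1$. For $n\in\mathbb N=\{1,2,\dots\}$ and $k\in\mathbb Z$ let $A^{\mathrm{per},t}_{n,k}$ be the operator on $X^n$, with the norm $(\sum_{j=1}^n\|\xi_j\|_X^2)^{1/2}$, given by the $n\times n$ matrix whose entry in row $i$ and column $j$ is $a_{k+i,k+j}+\delta_{i,1}\delta_{j,n}\,t\,\alpha_k+\delta_{i,n}\delta_{j,1}\,\bar t\,\gamma_{k+n+1}$. Set $$\pi^{n,t}_\varepsilon(A):=\bigcup_{k\in\mathbb Z}\operatorname{spec}_\varepsilon A^{\mathrm{per},t}_{n,k}\ (\varepsilon>0),\qquad \Pi^{n,t}_\varepsilon(A):=\overline{\bigcup_{k\in\mathbb Z}\operatorname{Spec}_\varepsilon A^{\mathrm{per},t}_{n,k}}\ (\varepsilon\ge0),\qquad \varepsilon_n':=2(\|\alpha\|_\infty+\|\gamma\|_\infty)\sin\frac{\pi}{2n}.$$ Suppose that: * $X$ has Globevnik's property: $X$ is finite-dimensional, or $X$ or its dual $X^*$ is complex uniformly convex, where a complex normed space $Y$ is *complex uniformly convex* if for every $\varepsilon>0$ there is $\delta>0$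 such that $\|x\|\le1-\delta$ for all $x,y\in Y$ with $\|y\|\ge\varepsilon$ and $\|x+\zeta y\|\le1$ for all $\zeta\in\mathbb C$ with $|\zeta|\le1$; * the $\pi$ method with parameter $t$ does not suffer from spectral pollution for $A$: there is a sequence of positive numbers $\eta_n\to0$ such that, for every $\varepsilon>0$, $\operatorname{spec}_\varepsilon A^{\mathrm{per},t}_{n,k}\subset\operatorname{spec}_{\varepsilon+\eta_n}A$ for all $n\in\mathbb N$ and $k\in\mathbb Z$. Then, as $n\to\infty$, $\Pi^{n,t}_{\varepsilon+\varepsilon_n'}(A)\to\operatorname{Spec}_\varepsilon A$ for every $\varepsilon\ge0$ (in particular $\Pi^{n,t}_{\varepsilon_n'}(A)\to\operatorname{Spec}A$), where in the case $\varepsilon=0$ it is assumed in addition that $X$ is finite-dimensional or that $\alpha_j\neq0$ or $\gamma_j\ne0$ for some $j\in\mathbb Z$; and $\pi^{n,t}_{\varepsilon+\varepsilon_n'}(A)\to\operatorname{spec}_\varepsilon A$ for every $\varepsilon>0$. Here $S_n\to S$ means that $S$ and all $S_n$, $n\in\mathbb N$, are bounded non-empty subsets of $\mathbb C$ and that the Hausdorff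 distance of $S_n$ and $S$ tends to $0$. -/

import Mathlib

open Filter Topology

noncomputable section

/-! ### Spectral quantities of a bounded operator on a complex Banach space -/

open scoped Classical in
/-- `1 / ‖B⁻¹‖`, with the conventions `‖B⁻¹‖ = ∞` if `B` is not invertible, and `1 / ∞ = 0`. -/
def recipNormInv {Y : Type*} [NormedAddCommGroup Y] [NormedSpace ℂ Y] (B : Y →L[ℂ] Y) : ℝ :=
  if IsUnit B then 1 / ‖Ring.inverse B‖ else 0

/-- The open `ε`-pseudospectrum `{lam : 1 / ‖(B - lam I)⁻¹‖ < ε}`. -/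
def openPseudospectrum {Y : Type*} [NormedAddCommGroup Y] [NormedSpace ℂ Y]
    (ε : ℝ) (B : Y →L[ℂ] Y) : Set ℂ :=
  {lam | recipNormInv (B - lam • ContinuousLinearMap.id ℂ Y) < ε}

/-- The closed `ε`-pseudospectrum `{lam : 1 / ‖(B - lam I)⁻¹‖ ≤ ε}`. For `ε = 0` (and `Y ≠ 0`) this
is the spectrum of `B`, see `closedPseudospectrum_zero`. -/
def closedPseudospectrum {Y : Type*} [NormedAddCommGroup Y] [NormedSpace ℂ Y]
    (ε : ℝ) (B : Y →L[ℂ] Y) : Set ℂ :=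
  {lam | recipNormInv (B - lam • ContinuousLinearMap.id ℂ Y) ≤ ε}

theorem recipNormInv_le_zero_iff {Y : Type*} [NormedAddCommGroup Y] [NormedSpace ℂ Y]
    [Nontrivial Y] (B : Y →L[ℂ] Y) : recipNormInv B ≤ 0 ↔ ¬ IsUnit B := by
  unfold recipNormInv
  split_ifs with h
  · have : Ring.inverse B ≠ 0 := by
      intro h0
      have h1 := Ring.mul_inverse_cancel B h
      rw [h0, mul_zero] at h1
      exact zero_ne_one h1
    have h2 : 0 < ‖Ring.inverse B‖ := norm_pos_iff.mpr this
    have h3 : 0 < 1 / ‖Ring.inverse B‖ := by positivity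
    simp only [h, not_true_eq_false, iff_false, not_le]
    exact h3
  · simp [h]

theorem closedPseudospectrum_zero {Y : Type*} [NormedAddCommGroup Y] [NormedSpace ℂ Y]
    [Nontrivial Y] (B : Y →L[ℂ] Y) : closedPseudospectrum 0 B = spectrum ℂ B := by
  ext lam
  have h : algebraMap ℂ (Y →L[ℂ] Y) lam - B = -(B - lam • ContinuousLinearMap.id ℂ Y) := by
    rw [neg_sub]
    rfl
  rw [closedPseudospectrum, Set.mem_ofPred_eq, recipNormInv_le_zero_iff, spectrum.mem_iff, h,
    IsUnit.neg_iff]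

/-! ### Globevnik's property -/

/-- Complex uniform convexity (uniform `c`-convexity) of a complex normed space. -/
def ComplexUniformlyConvex (Y : Type*) [NormedAddCommGroup Y] [NormedSpace ℂ Y] : Prop :=
  ∀ ε : ℝ, 0 < ε → ∃ δ : ℝ, 0 < δ ∧ ∀ x y : Y, ε ≤ ‖y‖ →
    (∀ ζ : ℂ, ‖ζ‖ ≤ 1 → ‖x + ζ • y‖ ≤ 1) → ‖x‖ ≤ 1 - δ

/-- Globevnik's property: `Y` is finite-dimensional, or `Y` or its dual is complex uniformly
convex. -/
def GlobevnikProperty (Y : Type*) [NormedAddCommGroup Y] [NormedSpace ℂ Y] : Prop :=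
  FiniteDimensional ℂ Y ∨ ComplexUniformlyConvex Y ∨ ComplexUniformlyConvex (StrongDual ℂ Y)

/-! ### Hausdorff convergence -/

/-- `S n → T` in the Hausdorff (pseudo)metric, for a sequence `S 1, S 2, …` of non-empty bounded
subsets of `ℂ` and a non-empty bounded set `T ⊆ ℂ`; the value `S 0` plays no role. -/
def HausdorffConverges (S : ℕ → Set ℂ) (T : Set ℂ) : Prop :=
  (∀ n : ℕ, 1 ≤ n → (S n).Nonempty ∧ Bornology.IsBounded (S n)) ∧
  T.Nonempty ∧ Bornology.IsBounded T ∧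
  Tendsto (fun n => Metric.hausdorffDist (S n) T) atTop (𝓝 0)

/-! ### Operators on `E = ℓ²(ℤ, X)` and their matrix representations -/

/-- The space `E = ℓ²(ℤ, X)`. -/
abbrev EllTwo (X : Type*) [NormedAddCommGroup X] : Type _ := lp (fun _ : ℤ => X) 2

/-- The entry `a_{i,j} ∈ L(X)` of the matrix representation of `A ∈ L(E)`. -/
def matrixEntry {X : Type*} [NormedAddCommGroup X] [NormedSpace ℂ X]
    (A : EllTwo X →L[ℂ] EllTwo X) (i j : ℤ) : X →L[ℂ] X :=
  (lp.evalCLM ℂ (fun _ : ℤ => X) 2 i).comp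
    (A.comp (lp.singleContinuousLinearMap ℂ (fun _ : ℤ => X) 2 j))

theorem norm_matrixEntry_le {X : Type*} [NormedAddCommGroup X] [NormedSpace ℂ X]
    (A : EllTwo X →L[ℂ] EllTwo X) (i j : ℤ) : ‖matrixEntry A i j‖ ≤ ‖A‖ := by
  refine ContinuousLinearMap.opNorm_le_bound _ (norm_nonneg _) fun x => ?_
  calc ‖matrixEntry A i j x‖ = ‖(A (lp.single 2 j x) : EllTwo X) i‖ := rfl
    _ ≤ ‖A (lp.single 2 j x)‖ := lp.norm_apply_le_norm (by simp) _ _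
    _ ≤ ‖A‖ * ‖(lp.single 2 j x : EllTwo X)‖ := A.le_opNorm _
    _ = ‖A‖ * ‖x‖ := by rw [lp.norm_single (by simp)]

/-- The matrix representation of `A` is tridiagonal. -/
def IsTridiagonal {X : Type*} [NormedAddCommGroup X] [NormedSpace ℂ X]
    (A : EllTwo X →L[ℂ] EllTwo X) : Prop :=
  ∀ i j : ℤ, 1 < |i - j| → matrixEntry A i j = 0

/-- The subdiagonal `α_j = a_{j+1,j}`. -/
def subdiag {X : Type*} [NormedAddCommGroup X] [NormedSpace ℂ X]
    (A : EllTwo X →L[ℂ] EllTwo X) (j : ℤ) : X →L[ℂ] X :=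
  matrixEntry A (j + 1) j

/-- The superdiagonal `γ_j = a_{j-1,j}`. -/
def superdiag {X : Type*} [NormedAddCommGroup X] [NormedSpace ℂ X]
    (A : EllTwo X →L[ℂ] EllTwo X) (j : ℤ) : X →L[ℂ] X :=
  matrixEntry A (j - 1) j

/-- The norm `‖x‖_∞ = sup_j ‖x_j‖` of a (bounded) sequence in `L(X)`. -/
def supNorm {X : Type*} [NormedAddCommGroup X] [NormedSpace ℂ X] (x : ℤ → X →L[ℂ] X) : ℝ :=
  ⨆ j : ℤ, ‖x j‖

theorem bddAbove_subdiag {X : Type*} [NormedAddCommGroup X] [NormedSpace ℂ X]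
    (A : EllTwo X →L[ℂ] EllTwo X) : BddAbove (Set.range fun j => ‖subdiag A j‖) :=
  ⟨‖A‖, by rintro _ ⟨j, rfl⟩; exact norm_matrixEntry_le A _ _⟩

theorem bddAbove_superdiag {X : Type*} [NormedAddCommGroup X] [NormedSpace ℂ X]
    (A : EllTwo X →L[ℂ] EllTwo X) : BddAbove (Set.range fun j => ‖superdiag A j‖) :=
  ⟨‖A‖, by rintro _ ⟨j, rfl⟩; exact norm_matrixEntry_le A _ _⟩

/-- The operator on `X^n`, with the norm `(∑ ‖x_j‖²)^{1/2}`, of multiplication by an `n × n` matrix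
with entries in `L(X)`. -/
def blockOperator {X : Type*} [NormedAddCommGroup X] [NormedSpace ℂ X] {n : ℕ}
    (M : Fin n → Fin n → X →L[ℂ] X) :
    PiLp 2 (fun _ : Fin n => X) →L[ℂ] PiLp 2 (fun _ : Fin n => X) :=
  ((PiLp.continuousLinearEquiv 2 ℂ (fun _ : Fin n => X)).symm :
      (Fin n → X) →L[ℂ] PiLp 2 (fun _ : Fin n => X)).comp
    (ContinuousLinearMap.pi fun i =>
      ∑ j, (M i j).comp (PiLp.proj (𝕜 := ℂ) 2 (fun _ : Fin n => X) j))

theorem blockOperator_apply {X : Type*} [NormedAddCommGroup X] [NormedSpace ℂ X] {n : ℕ}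
    (M : Fin n → Fin n → X →L[ℂ] X) (x : PiLp 2 (fun _ : Fin n => X)) (i : Fin n) :
    blockOperator M x i = ∑ j, M i j (x j) := by
  simp [blockOperator]

/-! ### The `π` method -/

/-- The periodised finite section `A_{n,k}^{per,t} = A_{n,k} + B_{n,k}^t`, where `A_{n,k}` consists
of rows and columns `k+1, …, k+n` of `A`, and `B_{n,k}^t` has the entry `t α_k` added in the top
right corner and the entry `t̄ γ_{k+n+1}` in the bottom left corner (`Fin n` counts from `0`). -/
def periodisedSection {X : Type*} [NormedAddCommGroup X] [NormedSpace ℂ X]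
    (A : EllTwo X →L[ℂ] EllTwo X) (t : ℂ) (n : ℕ) (k : ℤ) :
    PiLp 2 (fun _ : Fin n => X) →L[ℂ] PiLp 2 (fun _ : Fin n => X) :=
  blockOperator fun i j : Fin n =>
    matrixEntry A (k + 1 + (i : ℕ)) (k + 1 + (j : ℕ))
      + (if (i : ℕ) = 0 ∧ (j : ℕ) + 1 = n then t • subdiag A k else 0)
      + (if (i : ℕ) + 1 = n ∧ (j : ℕ) = 0 then star t • superdiag A (k + n + 1) else 0)

/-- `π^{n,t}_ε(A)`, the union over `k` of the open `ε`-pseudospectra of `A_{n,k}^{per,t}`. -/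
def piOpen {X : Type*} [NormedAddCommGroup X] [NormedSpace ℂ X]
    (A : EllTwo X →L[ℂ] EllTwo X) (t : ℂ) (n : ℕ) (ε : ℝ) : Set ℂ :=
  ⋃ k : ℤ, openPseudospectrum ε (periodisedSection A t n k)

/-- `Π^{n,t}_ε(A)`, the closure of the union over `k` of the closed `ε`-pseudospectra of
`A_{n,k}^{per,t}`. -/
def piClosed {X : Type*} [NormedAddCommGroup X] [NormedSpace ℂ X]
    (A : EllTwo X →L[ℂ] EllTwo X) (t : ℂ) (n : ℕ) (ε : ℝ) : Set ℂ :=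
  closure (⋃ k : ℤ, closedPseudospectrum ε (periodisedSection A t n k))

/-- The penalty term `ε'_n = 2 (‖α‖_∞ + ‖γ‖_∞) sin (π / (2n))`. -/
def piPenalty {X : Type*} [NormedAddCommGroup X] [NormedSpace ℂ X]
    (A : EllTwo X →L[ℂ] EllTwo X) (n : ℕ) : ℝ :=
  2 * (supNorm (subdiag A) + supNorm (superdiag A)) * Real.sin (Real.pi / (2 * n))

/-- The `π` method with parameter `t` does not suffer from spectral pollution for `A`: for some
positive null sequence `η_1, η_2, …`, the open `ε`-pseudospectrum of every `A_{n,k}^{per,t}` is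
contained in the open `(ε + η_n)`-pseudospectrum of `A`, for every `ε > 0`. -/
def PiNoSpectralPollution {X : Type*} [NormedAddCommGroup X] [NormedSpace ℂ X]
    (A : EllTwo X →L[ℂ] EllTwo X) (t : ℂ) : Prop :=
  ∃ η : ℕ → ℝ, (∀ n : ℕ, 1 ≤ n → 0 < η n) ∧ Tendsto η atTop (𝓝 0) ∧
    ∀ ε : ℝ, 0 < ε → ∀ n : ℕ, 1 ≤ n → ∀ k : ℤ,
      openPseudospectrum ε (periodisedSection A t n k) ⊆ openPseudospectrum (ε + η n) A

end

/-! ### The reciprocal resolvent norm: lower bounds, witnesses, Lipschitz continuity -/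

section RecipNormInv

variable {Y : Type*} [NormedAddCommGroup Y] [NormedSpace ℂ Y]

/-! Write ν for `recipNormInv`. Both limits come from a two-sided comparison. From above, the
absence of pollution puts the approximating sets into closed pseudospectra of A whose level exceeds
ε by a null sequence, and by compactness these shrink to the one at level ε
(`exists_closedPseudospectrum_near`). From below, for n ≥ 2 the approximating set contains the
target.

For the lower half, suppose ν(A − λ) < ε. Then there is an x with ‖(A − λ)x‖ < ε‖x‖, or else a
nonzero functional annihilates the range of A − λ. Cut this object into windows of length n weighted
by sin(πi/n). Summed over all window positions k, the error made by the cutting is governed by the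
discrete Dirichlet energy of a half sine wave, whose eigenvalue is (2 sin(π/(2n)))². Hence some k
satisfies ν(A_{n,k} − λ) < ε + ε'_n, with A_{n,k} the periodised section
(`exists_weightedWindow_lt`). One corner entry meets a zero weight; the other costs exactly what the
missing neighbour would.

Closed sets need more: a positive lower bound for ν on a disc must improve at its centre. This makes
the closed pseudospectrum the closure of the open one (`GlobevnikProperty.lt_recipNormInv`). For ε =
0 the improvement must also be uniform in k (`GlobevnikProperty.exists_le_recipNormInv`); if the
penalty is zero, a determinant bound in finite dimensions takes its place
(`exists_le_recipNormInv_of_isUnit`).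

The improvement is a quantitative maximum principle. Let B invert A and let y be nearly minimal for
A. The truncation of (1 − wB)⁻¹y is a polynomial in w with mean y whose norm on a circle hardly
exceeds ‖y‖. So in the ℓ²-sum there is near equality in the mean value inequality, coordinate by
coordinate. Complex uniform convexity then makes the linear coefficient By too small, contradicting
‖y‖ ≤ ‖A‖‖By‖. A finite-dimensional X may carry a norm that is not complex uniformly convex. There
compactness yields an exactly extremal orbit, norming functionals annihilate its later terms, and
tridiagonality produces sequence spaces of bounded dimension that are locally shift-invariant, which
a dimension count excludes (`not_shift_invariant_int`). -/

theorem recipNormInv_nonneg (B : Y →L[ℂ] Y) : 0 ≤ recipNormInv B := by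
  unfold recipNormInv
  split_ifs <;> positivity

theorem inverse_apply_self {B : Y →L[ℂ] Y} (hB : IsUnit B) (y : Y) : Ring.inverse B (B y) = y := by
  have := congrArg (fun C : Y →L[ℂ] Y => C y) (Ring.inverse_mul_cancel B hB)
  simpa using this

theorem apply_inverse_self {B : Y →L[ℂ] Y} (hB : IsUnit B) (y : Y) : B (Ring.inverse B y) = y := by
  have := congrArg (fun C : Y →L[ℂ] Y => C y) (Ring.mul_inverse_cancel B hB)
  simpa using this

/-- Trades the norm of the inverse for a lower bound on B, the form in which ν is estimated
throughout. -/
theorem le_recipNormInv_iff [Nontrivial Y] {s : ℝ} (hs : 0 < s) (B : Y →L[ℂ] Y) :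
    s ≤ recipNormInv B ↔ IsUnit B ∧ ∀ y, s * ‖y‖ ≤ ‖B y‖ := by
  unfold recipNormInv
  split_ifs with h
  · have h0 : Ring.inverse B ≠ 0 := by
      intro h0
      have h1 := Ring.mul_inverse_cancel B h
      rw [h0, mul_zero] at h1
      exact zero_ne_one h1
    have h2 : 0 < ‖Ring.inverse B‖ := norm_pos_iff.mpr h0
    rw [le_div_iff₀ h2]
    constructor
    · refine fun h3 => ⟨h, fun y => ?_⟩
      have h4 := (Ring.inverse B).le_opNorm (B y)
      rw [inverse_apply_self h] at h4
      calc s * ‖y‖ ≤ s * (‖Ring.inverse B‖ * ‖B y‖) := by gcongr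
        _ = (s * ‖Ring.inverse B‖) * ‖B y‖ := by ring
        _ ≤ 1 * ‖B y‖ := by gcongr
        _ = ‖B y‖ := one_mul _
    · rintro ⟨-, h3⟩
      have : ‖Ring.inverse B‖ ≤ 1 / s := by
        refine ContinuousLinearMap.opNorm_le_bound _ (by positivity) fun y => ?_
        have h4 := h3 (Ring.inverse B y)
        rw [apply_inverse_self h] at h4
        rw [div_mul_eq_mul_div, one_mul, le_div_iff₀ hs]
        linarith
      rw [le_div_iff₀ hs] at this
      linarith
  · simp only [h, false_and, iff_false, not_le]
    exact hs

theorem recipNormInv_lt_of_apply [Nontrivial Y] {s : ℝ} (hs : 0 < s) (B : Y →L[ℂ] Y) {y : Y}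
    (h : ‖B y‖ < s * ‖y‖) : recipNormInv B < s := by
  by_contra! h'
  exact absurd (((le_recipNormInv_iff hs B).1 h').2 y) (not_le.2 h)

theorem mul_norm_le_norm_comp [Nontrivial Y] {s : ℝ} (hs : 0 < s) {B : Y →L[ℂ] Y}
    (h : s ≤ recipNormInv B) (φ : StrongDual ℂ Y) : s * ‖φ‖ ≤ ‖φ.comp B‖ := by
  obtain ⟨hu, hb⟩ := (le_recipNormInv_iff hs B).1 h
  have : ‖φ‖ ≤ ‖φ.comp B‖ / s := by
    refine ContinuousLinearMap.opNorm_le_bound _ (by positivity) fun y => ?_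
    have h4 := hb (Ring.inverse B y)
    rw [apply_inverse_self hu] at h4
    have h5 := (φ.comp B).le_opNorm (Ring.inverse B y)
    simp only [ContinuousLinearMap.comp_apply, apply_inverse_self hu] at h5
    calc ‖φ y‖ ≤ ‖φ.comp B‖ * ‖Ring.inverse B y‖ := h5
      _ ≤ ‖φ.comp B‖ * (‖y‖ / s) := by
        gcongr
        rw [le_div_iff₀ hs]
        linarith
      _ = _ := by ring
  rw [le_div_iff₀ hs] at this
  linarith

theorem recipNormInv_lt_of_dual [Nontrivial Y] {s : ℝ} (hs : 0 < s) (B : Y →L[ℂ] Y)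
    {φ : StrongDual ℂ Y} (h : ‖φ.comp B‖ < s * ‖φ‖) : recipNormInv B < s := by
  by_contra! h'
  exact absurd (mul_norm_le_norm_comp hs h' φ) (not_le.2 h)

theorem exists_apply_lt_of_isUnit [Nontrivial Y] {s : ℝ} {B : Y →L[ℂ] Y} (hB : IsUnit B)
    (h : recipNormInv B < s) : ∃ y, ‖B y‖ < s * ‖y‖ := by
  by_contra! h'
  exact absurd ((le_recipNormInv_iff ((recipNormInv_nonneg B).trans_lt h) B).2 ⟨hB, h'⟩)
    (not_le.2 h)

theorem exists_dual_lt_of_isUnit [Nontrivial Y] {s : ℝ} {B : Y →L[ℂ] Y} (hB : IsUnit B)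
    (h : recipNormInv B < s) : ∃ φ : StrongDual ℂ Y, ‖φ.comp B‖ < s * ‖φ‖ := by
  have hs := (recipNormInv_nonneg B).trans_lt h
  obtain ⟨y, hy⟩ := exists_apply_lt_of_isUnit hB h
  have hy0 : y ≠ 0 := by
    rintro rfl
    simp at hy
  obtain ⟨φ, hφ, hφy⟩ := exists_dual_vector ℂ y (norm_ne_zero_iff.2 hy0)
  -- The witness is a norming functional of y transported by the transpose of B⁻¹; composing with B
  -- recovers the norming functional, of norm one.
  refine ⟨φ.comp (Ring.inverse B), ?_⟩
  have h1 : (φ.comp (Ring.inverse B)).comp B = φ := by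
    ext z
    simp [inverse_apply_self hB]
  rw [h1, hφ]
  have h2 := (φ.comp (Ring.inverse B)).le_opNorm (B y)
  simp only [ContinuousLinearMap.comp_apply, inverse_apply_self hB, hφy] at h2
  simp only [Complex.coe_algebraMap, Complex.norm_real, norm_norm] at h2
  have hp : 0 < ‖φ.comp (Ring.inverse B)‖ := by
    by_contra! h3
    have : ‖φ.comp (Ring.inverse B)‖ = 0 := le_antisymm h3 (norm_nonneg _)
    rw [this, zero_mul] at h2
    exact hy0 (norm_le_zero_iff.1 h2)
  have h3 : ‖φ.comp (Ring.inverse B)‖ * ‖B y‖ < ‖φ.comp (Ring.inverse B)‖ * (s * ‖y‖) := by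
    gcongr
  have h4 : 1 * ‖y‖ < (s * ‖φ.comp (Ring.inverse B)‖) * ‖y‖ := by
    calc 1 * ‖y‖ = ‖y‖ := one_mul _
      _ ≤ _ := h2
      _ < _ := h3
      _ = _ := by ring
  exact lt_of_mul_lt_mul_right h4 (norm_nonneg _)

theorem exists_dual_ne_zero_of_isClosed {p : Submodule ℂ Y} (hp : IsClosed (p : Set Y))
    (h : p ≠ ⊤) : ∃ φ : StrongDual ℂ Y, φ ≠ 0 ∧ ∀ y ∈ p, φ y = 0 := by
  obtain ⟨x, hx⟩ : ∃ x, x ∉ p := by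
    by_contra! h'
    exact h (eq_top_iff.2 fun y _ => h' y)
  have : IsClosed (p : Set Y) := hp
  have hx' : ‖p.mkQ x‖ ≠ 0 := by
    rw [norm_ne_zero_iff]
    simpa using hx
  obtain ⟨φ, hφ, hφx⟩ := exists_dual_vector ℂ (p.mkQ x) hx'
  refine ⟨φ.comp p.mkQL, ?_, fun y hy => ?_⟩
  · intro h0
    have h1 := congrArg (fun ψ : StrongDual ℂ Y => ψ x) h0
    have h2 : φ (p.mkQ x) = 0 := h1
    rw [hφx] at h2
    simp at h2
    exact hx h2
  · have : p.mkQL y = 0 := by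
      simpa using hy
    simp [this]

/-- Without a vector witness B is bounded below by s, so its range is closed. If the range is
proper, Hahn–Banach supplies the functional; if it is everything, B is invertible and the lower
bound contradicts `h`. -/
theorem exists_apply_lt_or_dual [CompleteSpace Y] [Nontrivial Y] {s : ℝ} {B : Y →L[ℂ] Y}
    (h : recipNormInv B < s) :
    (∃ y, ‖B y‖ < s * ‖y‖) ∨ ∃ φ : StrongDual ℂ Y, φ ≠ 0 ∧ φ.comp B = 0 := by
  by_contra! h'
  obtain ⟨h1, h2⟩ := h'
  have hs := (recipNormInv_nonneg B).trans_lt h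
  have hanti : AntilipschitzWith (Real.toNNReal (1 / s)) B := by
    refine B.antilipschitz_of_bound fun x => ?_
    rw [Real.coe_toNNReal _ (by positivity), div_mul_eq_mul_div, one_mul, le_div_iff₀ hs]
    linarith [h1 x]
  have hcl : IsClosed (B.range : Set Y) := by
    have := hanti.isClosed_range B.uniformContinuous
    rwa [LinearMap.coe_range]
  have htop : B.range = ⊤ := by
    by_contra htop
    obtain ⟨φ, hφ, hφ'⟩ := exists_dual_ne_zero_of_isClosed hcl htop
    refine h2 φ hφ ?_
    ext y
    exact hφ' _ ⟨y, rfl⟩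
  have hu : IsUnit B := by
    rw [ContinuousLinearMap.isUnit_iff_bijective]
    exact ⟨hanti.injective, LinearMap.range_eq_top.1 htop⟩
  obtain ⟨y, hy⟩ := exists_apply_lt_of_isUnit hu h
  exact absurd (h1 y) (not_le.2 hy)

theorem isUnit_of_recipNormInv_pos {B : Y →L[ℂ] Y} (h : 0 < recipNormInv B) : IsUnit B := by
  by_contra h'
  simp [recipNormInv, h'] at h

/-- Lower bounds for B and for its transpose both survive a perturbation smaller than ν(B), so
neither alternative of `exists_apply_lt_or_dual` is open to C. -/
theorem recipNormInv_le_add [CompleteSpace Y] [Nontrivial Y] (B C : Y →L[ℂ] Y) :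
    recipNormInv B ≤ recipNormInv C + ‖B - C‖ := by
  by_contra! h
  set s := recipNormInv B
  have hs : 0 < s := by
    have := recipNormInv_nonneg C
    have := norm_nonneg (B - C)
    linarith
  obtain ⟨hu, hb⟩ := (le_recipNormInv_iff hs B).1 le_rfl
  have hd : 0 < s - ‖B - C‖ := by linarith [recipNormInv_nonneg C]
  have hlow : ∀ y, (s - ‖B - C‖) * ‖y‖ ≤ ‖C y‖ := fun y => by
    have h1 := hb y
    have h2 := (B - C).le_opNorm y
    have h3 : B y = C y + (B - C) y := by simp
    have h4 : ‖B y‖ ≤ ‖C y‖ + ‖(B - C) y‖ := by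
      rw [h3]
      exact norm_add_le _ _
    linarith
  have hdual : ∀ φ : StrongDual ℂ Y, φ.comp C = 0 → φ = 0 := fun φ hφ => by
    have h1 := mul_norm_le_norm_comp hs le_rfl φ
    have h2 : φ.comp B = φ.comp (B - C) := by
      ext y
      have := congrArg (fun ψ : StrongDual ℂ Y => ψ y) hφ
      simp only [ContinuousLinearMap.comp_apply, _root_.zero_apply] at this
      simp [this]
    rw [h2] at h1
    have h3 := φ.opNorm_comp_le (B - C)
    have h4 : (s - ‖B - C‖) * ‖φ‖ ≤ 0 := by linarith
    have h5 : ‖φ‖ ≤ 0 := by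
      by_contra! h6
      have := mul_pos hd h6
      linarith
    exact norm_le_zero_iff.1 h5
  rcases exists_apply_lt_or_dual (s := s - ‖B - C‖) (B := C) (by linarith) with ⟨y, hy⟩ | ⟨φ, h0, h1⟩
  · exact absurd (hlow y) (not_le.2 hy)
  · exact h0 (hdual φ h1)

theorem recipNormInv_sub_smul_le [CompleteSpace Y] [Nontrivial Y] (B : Y →L[ℂ] Y) (lam mu : ℂ) :
    recipNormInv (B - lam • ContinuousLinearMap.id ℂ Y) ≤
      recipNormInv (B - mu • ContinuousLinearMap.id ℂ Y) + ‖lam - mu‖ := by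
  refine (recipNormInv_le_add _ (B - mu • ContinuousLinearMap.id ℂ Y)).trans ?_
  gcongr
  have : B - lam • ContinuousLinearMap.id ℂ Y - (B - mu • ContinuousLinearMap.id ℂ Y)
      = (mu - lam) • ContinuousLinearMap.id ℂ Y := by
    rw [sub_smul]
    abel
  rw [this, norm_smul, ContinuousLinearMap.norm_id, mul_one, norm_sub_rev]

theorem continuous_recipNormInv_sub_smul [CompleteSpace Y] [Nontrivial Y] (B : Y →L[ℂ] Y) :
    Continuous fun lam : ℂ => recipNormInv (B - lam • ContinuousLinearMap.id ℂ Y) := by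
  refine (LipschitzWith.of_le_add_mul 1 fun lam mu => ?_).continuous
  simpa [dist_eq_norm] using recipNormInv_sub_smul_le B lam mu

theorem continuous_recipNormInv [CompleteSpace Y] [Nontrivial Y] :
    Continuous fun B : Y →L[ℂ] Y => recipNormInv B := by
  refine (LipschitzWith.of_le_add_mul 1 fun B C => ?_).continuous
  simpa [dist_eq_norm] using recipNormInv_le_add B C

theorem isClosed_closedPseudospectrum [CompleteSpace Y] [Nontrivial Y] (ε : ℝ) (B : Y →L[ℂ] Y) :
    IsClosed (closedPseudospectrum ε B) :=
  isClosed_le (continuous_recipNormInv_sub_smul B) continuous_const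

theorem norm_sub_norm_le_recipNormInv [CompleteSpace Y] [Nontrivial Y] (B : Y →L[ℂ] Y) (lam : ℂ) :
    ‖lam‖ - ‖B‖ ≤ recipNormInv (B - lam • ContinuousLinearMap.id ℂ Y) := by
  by_cases h : 0 < ‖lam‖
  · have h1 : ‖lam‖ ≤ recipNormInv (-(lam • ContinuousLinearMap.id ℂ Y)) := by
      rw [le_recipNormInv_iff h]
      constructor
      · rw [IsUnit.neg_iff]
        have : lam • ContinuousLinearMap.id ℂ Y = algebraMap ℂ (Y →L[ℂ] Y) lam := rfl
        rw [this]
        exact (isUnit_iff_ne_zero.2 (norm_pos_iff.1 h)).map _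
      · intro y
        simp [norm_smul]
    have h2 := recipNormInv_le_add (-(lam • ContinuousLinearMap.id ℂ Y))
      (B - lam • ContinuousLinearMap.id ℂ Y)
    have h3 : -(lam • ContinuousLinearMap.id ℂ Y) - (B - lam • ContinuousLinearMap.id ℂ Y) = -B := by
      abel
    rw [h3, norm_neg] at h2
    linarith
  · have := recipNormInv_nonneg (B - lam • ContinuousLinearMap.id ℂ Y)
    have := norm_nonneg B
    linarith

theorem isBounded_closedPseudospectrum [CompleteSpace Y] [Nontrivial Y] (ε : ℝ) (B : Y →L[ℂ] Y) :
    Bornology.IsBounded (closedPseudospectrum ε B) := by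
  refine (Metric.isBounded_closedBall (x := (0 : ℂ)) (r := ‖B‖ + ε)).subset fun lam h => ?_
  rw [mem_closedBall_zero_iff]
  have h1 : recipNormInv (B - lam • ContinuousLinearMap.id ℂ Y) ≤ ε := h
  linarith [norm_sub_norm_le_recipNormInv B lam]

theorem exists_recipNormInv_eq_zero [CompleteSpace Y] [Nontrivial Y] (B : Y →L[ℂ] Y) :
    ∃ lam : ℂ, recipNormInv (B - lam • ContinuousLinearMap.id ℂ Y) = 0 := by
  obtain ⟨lam, h⟩ := spectrum.nonempty B
  rw [← closedPseudospectrum_zero] at h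
  exact ⟨lam, le_antisymm h (recipNormInv_nonneg _)⟩

theorem openPseudospectrum_subset_closed (ε : ℝ) (B : Y →L[ℂ] Y) :
    openPseudospectrum ε B ⊆ closedPseudospectrum ε B := fun lam h => by
  have h' : recipNormInv (B - lam • ContinuousLinearMap.id ℂ Y) < ε := h
  exact h'.le

end RecipNormInv

/-! ### ℓ²-sums and their duals -/

section SquareSummableCoordinates

/-- The norm of `Y` is the `ℓ²`-norm of the family of coordinates `T j y`. -/
def IsL2Coord {J Y Z : Type*} [NormedAddCommGroup Y] [NormedSpace ℂ Y] [NormedAddCommGroup Z]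
    [NormedSpace ℂ Z] (T : J → Y →L[ℂ] Z) : Prop :=
  ∀ y, HasSum (fun j => ‖T j y‖ ^ 2) (‖y‖ ^ 2)

/-- `Y` is the `ℓ²`-sum of copies of `Z`, with coordinate maps `T j` and embeddings `ι j`. -/
structure IsL2Decomposition {J Y Z : Type*} [NormedAddCommGroup Y] [NormedSpace ℂ Y]
    [NormedAddCommGroup Z] [NormedSpace ℂ Z] (T : J → Y →L[ℂ] Z) (ι : J → Z →L[ℂ] Y) : Prop where
  coord : IsL2Coord T
  apply_self : ∀ j z, T j (ι j z) = z
  apply_ne : ∀ i j z, i ≠ j → T i (ι j z) = 0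
  hasSum : ∀ y, HasSum (fun j => ι j (T j y)) y

variable {J Y Z : Type*} [NormedAddCommGroup Y] [NormedSpace ℂ Y] [NormedAddCommGroup Z]
    [NormedSpace ℂ Z]

/-- The coordinates on the dual space that are induced by the embeddings `ι j`. -/
noncomputable def dualCoord (ι : J → Z →L[ℂ] Y) (j : J) : StrongDual ℂ Y →L[ℂ] StrongDual ℂ Z :=
  (ContinuousLinearMap.compL ℂ Z Y ℂ).flip (ι j)

/-- An almost norming vector, rotated so that its value is real; the factor η is there because the
norm of φ need not be attained. -/
theorem exists_apply_eq_mul_norm (φ : StrongDual ℂ Z) {η : ℝ} (hη : η < 1) (c : ℝ) (hc : 0 ≤ c) :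
    ∃ z : Z, ‖z‖ ≤ c ∧ ∃ a : ℝ, φ z = a ∧ η * ‖φ‖ * c ≤ a := by
  by_cases h0 : φ = 0
  · exact ⟨0, by simpa using hc, 0, by simp, by simp [h0]⟩
  have hpos : 0 < ‖φ‖ := norm_pos_iff.2 h0
  obtain ⟨x, hx1, hx⟩ := φ.exists_lt_apply_of_lt_opNorm (r := η * ‖φ‖) (by nlinarith)
  obtain ⟨u, hu, hux⟩ : ∃ u : ℂ, ‖u‖ = 1 ∧ u * φ x = ‖φ x‖ := by
    by_cases h : φ x = 0
    · exact ⟨1, by simp, by simp [h]⟩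
    · refine ⟨(‖φ x‖ : ℂ) / φ x, ?_, by field_simp⟩
      rw [norm_div]
      simp [h]
  refine ⟨(c * u : ℂ) • x, ?_, c * ‖φ x‖, ?_, ?_⟩
  · rw [norm_smul, norm_mul, hu, mul_one, Complex.norm_real, Real.norm_of_nonneg hc]
    nlinarith [norm_nonneg x]
  · rw [map_smul, smul_eq_mul, mul_assoc, hux]
    push_cast
    ring
  · rw [mul_comm]
    exact mul_le_mul_of_nonneg_left hx.le hc

theorem IsL2Coord.sum_le {T : J → Y →L[ℂ] Z} (hT : IsL2Coord T) (s : Finset J) (y : Y) :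
    ∑ j ∈ s, ‖T j y‖ ^ 2 ≤ ‖y‖ ^ 2 :=
  sum_le_hasSum s (fun _ _ => by positivity) (hT y)

theorem IsL2Decomposition.norm_sum_sq {T : J → Y →L[ℂ] Z} {ι : J → Z →L[ℂ] Y}
    (h : IsL2Decomposition T ι) (s : Finset J) (z : J → Z) :
    ‖∑ j ∈ s, ι j (z j)‖ ^ 2 = ∑ j ∈ s, ‖z j‖ ^ 2 := by
  classical
  have h1 : ∀ i, T i (∑ j ∈ s, ι j (z j)) = if i ∈ s then z i else 0 := fun i => by
    rw [map_sum]
    split_ifs with hi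
    · rw [Finset.sum_eq_single_of_mem i hi fun j _ hj => h.apply_ne i j _ hj.symm, h.apply_self]
    · exact Finset.sum_eq_zero fun j hj => h.apply_ne i j _ (by rintro rfl; exact hi hj)
  have h2 := h.coord (∑ j ∈ s, ι j (z j))
  refine h2.unique ?_
  have h3 : HasSum (fun j => ‖T j (∑ j ∈ s, ι j (z j))‖ ^ 2)
      (∑ j ∈ s, ‖T j (∑ j ∈ s, ι j (z j))‖ ^ 2) := by
    refine hasSum_sum_of_ne_finset_zero fun j hj => ?_
    simp [h1, hj]
  convert h3 using 1
  exact Finset.sum_congr rfl fun j hj => by rw [h1, if_pos hj]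

/-- Test φ on a finite sum of almost norming vectors whose lengths are the norms ‖φ ∘ ι_j‖
themselves, then let η tend to 1. -/
theorem IsL2Decomposition.sum_dual_le {T : J → Y →L[ℂ] Z} {ι : J → Z →L[ℂ] Y}
    (h : IsL2Decomposition T ι) (φ : StrongDual ℂ Y) (s : Finset J) :
    ∑ j ∈ s, ‖φ.comp (ι j)‖ ^ 2 ≤ ‖φ‖ ^ 2 := by
  set Q := ∑ j ∈ s, ‖φ.comp (ι j)‖ ^ 2 with hQ
  have hQ0 : 0 ≤ Q := Finset.sum_nonneg fun _ _ => by positivity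
  have key : ∀ η : ℝ, η < 1 → η * Q ≤ ‖φ‖ * √Q := fun η hη => by
    choose z hz a ha haz using fun j =>
      exists_apply_eq_mul_norm (φ.comp (ι j)) hη ‖φ.comp (ι j)‖ (norm_nonneg _)
    have h1 : ‖∑ j ∈ s, ι j (z j)‖ ≤ √Q := by
      refine Real.le_sqrt_of_sq_le ?_
      rw [h.norm_sum_sq]
      exact Finset.sum_le_sum fun j _ => by gcongr; exact hz j
    have h2 : φ (∑ j ∈ s, ι j (z j)) = ((∑ j ∈ s, a j : ℝ) : ℂ) := by
      rw [map_sum]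
      push_cast
      exact Finset.sum_congr rfl fun j _ => ha j
    calc η * Q = ∑ j ∈ s, η * ‖φ.comp (ι j)‖ * ‖φ.comp (ι j)‖ := by
          rw [hQ, Finset.mul_sum]
          exact Finset.sum_congr rfl fun j _ => by ring
      _ ≤ ∑ j ∈ s, a j := Finset.sum_le_sum fun j _ => haz j
      _ ≤ |∑ j ∈ s, a j| := le_abs_self _
      _ = ‖φ (∑ j ∈ s, ι j (z j))‖ := by rw [h2, Complex.norm_real, Real.norm_eq_abs]
      _ ≤ ‖φ‖ * ‖∑ j ∈ s, ι j (z j)‖ := φ.le_opNorm _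
      _ ≤ ‖φ‖ * √Q := by gcongr
  have key' : Q ≤ ‖φ‖ * √Q := by
    have h1 : Tendsto (fun η : ℝ => η * Q) (𝓝[<] 1) (𝓝 (1 * Q)) :=
      (tendsto_id.mul_const Q).mono_left nhdsWithin_le_nhds
    rw [one_mul] at h1
    exact le_of_tendsto h1 (eventually_nhdsWithin_of_forall fun η hη => key η hη)
  by_cases hq : Q = 0
  · rw [hq]
    positivity
  have hq' : 0 < √Q := Real.sqrt_pos.2 (lt_of_le_of_ne hQ0 (Ne.symm hq))
  have h5 : √Q * √Q = Q := Real.mul_self_sqrt hQ0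
  have h6 : √Q ≤ ‖φ‖ := by
    refine le_of_mul_le_mul_right ?_ hq'
    rw [h5]
    exact key'
  calc Q = √Q * √Q := h5.symm
    _ ≤ ‖φ‖ * ‖φ‖ := by gcongr
    _ = _ := by ring

/-- The dual of an ℓ²-sum is the ℓ²-sum of the duals: one inequality is `sum_dual_le`, the other
Cauchy–Schwarz. This lets every estimate for `IsL2Coord` be applied to transposes. -/
theorem IsL2Decomposition.dual_coord {T : J → Y →L[ℂ] Z} {ι : J → Z →L[ℂ] Y}
    (h : IsL2Decomposition T ι) : IsL2Coord (dualCoord ι) := by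
  intro φ
  have hs : Summable fun j => ‖φ.comp (ι j)‖ ^ 2 :=
    summable_of_sum_le (fun _ => by positivity) (h.sum_dual_le φ)
  have hle : ∑' j, ‖φ.comp (ι j)‖ ^ 2 ≤ ‖φ‖ ^ 2 := hs.tsum_le_of_sum_le (h.sum_dual_le φ)
  have hge : ‖φ‖ ≤ √(∑' j, ‖φ.comp (ι j)‖ ^ 2) := by
    refine φ.opNorm_le_bound (Real.sqrt_nonneg _) fun y => ?_
    have h1 : HasSum (fun j => φ (ι j (T j y))) (φ y) := (h.hasSum y).mapL φ
    have h2 : Tendsto (fun s : Finset J => ‖∑ j ∈ s, φ (ι j (T j y))‖) atTop (𝓝 ‖φ y‖) :=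
      (continuous_norm.tendsto _).comp h1
    refine le_of_tendsto' h2 fun s => ?_
    calc ‖∑ j ∈ s, φ (ι j (T j y))‖ ≤ ∑ j ∈ s, ‖φ (ι j (T j y))‖ := norm_sum_le _ _
      _ ≤ ∑ j ∈ s, ‖φ.comp (ι j)‖ * ‖T j y‖ :=
        Finset.sum_le_sum fun j _ => (φ.comp (ι j)).le_opNorm _
      _ ≤ √(∑ j ∈ s, ‖φ.comp (ι j)‖ ^ 2) * √(∑ j ∈ s, ‖T j y‖ ^ 2) :=
        Real.sum_mul_le_sqrt_mul_sqrt _ _ _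
      _ ≤ √(∑' j, ‖φ.comp (ι j)‖ ^ 2) * √(‖y‖ ^ 2) := by
        gcongr
        · exact hs.sum_le_tsum s fun _ _ => by positivity
        · exact h.coord.sum_le s y
      _ = _ := by rw [Real.sqrt_sq (norm_nonneg _)]
  have heq : ∑' j, ‖φ.comp (ι j)‖ ^ 2 = ‖φ‖ ^ 2 := by
    refine le_antisymm hle ?_
    calc ‖φ‖ ^ 2 ≤ √(∑' j, ‖φ.comp (ι j)‖ ^ 2) ^ 2 := by gcongr
      _ = _ := Real.sq_sqrt (tsum_nonneg fun _ => by positivity)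
  rw [← heq]
  exact hs.hasSum

variable {X : Type*} [NormedAddCommGroup X] [NormedSpace ℂ X]

theorem isL2Decomposition_ellTwo :
    IsL2Decomposition (fun j : ℤ => lp.evalCLM ℂ (fun _ : ℤ => X) 2 j)
      (fun j : ℤ => lp.singleContinuousLinearMap ℂ (fun _ : ℤ => X) 2 j) where
  coord y := by
    have : HasSum (fun j => ‖y j‖ ^ (2 : ENNReal).toReal) (‖y‖ ^ (2 : ENNReal).toReal) :=
      lp.hasSum_norm (by simp) y
    simp only [ENNReal.toReal_ofNat, Real.rpow_ofNat] at this
    exact this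
  apply_self j z := lp.single_apply_self (E := fun _ : ℤ => X) 2 j z
  apply_ne i j z h := lp.single_apply_ne (E := fun _ : ℤ => X) 2 j z h
  hasSum y := lp.hasSum_single (by simp) y

/-- The embedding of the `j`-th coordinate into `X^n`. -/
noncomputable def piLpSingle (X : Type*) [NormedAddCommGroup X] [NormedSpace ℂ X] {n : ℕ}
    (j : Fin n) : X →L[ℂ] PiLp 2 (fun _ : Fin n => X) :=
  ((PiLp.continuousLinearEquiv 2 ℂ (fun _ : Fin n => X)).symm :
      (Fin n → X) →L[ℂ] PiLp 2 (fun _ : Fin n => X)).comp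
    (ContinuousLinearMap.single ℂ (fun _ : Fin n => X) j)

theorem piLpSingle_apply {n : ℕ} (i j : Fin n) (z : X) :
    piLpSingle X j z i = if i = j then z else 0 := by
  simp [piLpSingle]

theorem isL2Decomposition_piLp {n : ℕ} :
    IsL2Decomposition (fun j : Fin n => PiLp.proj (𝕜 := ℂ) 2 (fun _ : Fin n => X) j)
      (fun j : Fin n => piLpSingle X j) where
  coord y := by
    rw [PiLp.norm_sq_eq_of_L2]
    exact hasSum_fintype _
  apply_self j z := by simp [piLpSingle_apply]
  apply_ne i j z h := by simp [piLpSingle_apply, h]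
  hasSum y := by
    have : y = ∑ j, piLpSingle X j (y j) := by
      ext i
      simp [piLpSingle_apply]
    conv => arg 2; rw [this]
    exact hasSum_fintype _

end SquareSummableCoordinates

/-! ### Vector-valued polynomials on roots of unity -/

section RootsOfUnity

variable {Z : Type*} [NormedAddCommGroup Z] [NormedSpace ℂ Z]

theorem sum_pow_mul_root {N : ℕ} {ω : ℂ} (hω : IsPrimitiveRoot ω N) (k : ℕ) :
    ∑ i ∈ Finset.range N, (ω ^ i) ^ k = if N ∣ k then (N : ℂ) else 0 := by
  have h1 : ∀ i, (ω ^ i) ^ k = (ω ^ k) ^ i := fun i => by rw [← pow_mul, ← pow_mul, mul_comm]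
  simp_rw [h1]
  split_ifs with h
  · rw [(hω.pow_eq_one_iff_dvd k).2 h]
    simp
  · have h2 : ω ^ k ≠ 1 := fun h' => h ((hω.pow_eq_one_iff_dvd k).1 h')
    rw [geom_sum_eq h2, ← pow_mul, mul_comm, pow_mul, hω.pow_eq_one]
    simp

/-- Orthogonality of characters of ℤ/N. Any exponent m congruent to −k serves, so N − k can replace
a negative power. -/
theorem sum_root_smul_polynomial {N : ℕ} {ω : ℂ} (hω : IsPrimitiveRoot ω N) (a : ℕ → Z) {k m : ℕ}
    (hk : k < N) (hm : N ∣ m + k) :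
    ∑ i ∈ Finset.range N, (ω ^ i) ^ m • ∑ l ∈ Finset.range N, (ω ^ i) ^ l • a l = (N : ℂ) • a k := by
  simp_rw [Finset.smul_sum, smul_smul, ← pow_add]
  rw [Finset.sum_comm]
  simp_rw [← Finset.sum_smul, sum_pow_mul_root hω]
  rw [Finset.sum_eq_single_of_mem k (Finset.mem_range.2 hk)]
  · rw [if_pos hm]
  · intro l hl hlk
    rw [if_neg, zero_smul]
    intro hd
    rw [Finset.mem_range] at hl
    apply hlk
    have h1 : m + l ≡ m + k [MOD N] :=
      ((Nat.modEq_zero_iff_dvd.2 hd).trans (Nat.modEq_zero_iff_dvd.2 hm).symm)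
    have h2 := Nat.ModEq.add_left_cancel' m h1
    rw [Nat.ModEq, Nat.mod_eq_of_lt hl, Nat.mod_eq_of_lt hk] at h2
    exact h2

/-- A discrete Cauchy estimate: a coefficient is a twisted average of the values, and Cauchy–Schwarz
passes to the mean square. -/
theorem sq_norm_coeff_le {N : ℕ} {ω : ℂ} (hω : IsPrimitiveRoot ω N) (a : ℕ → Z) {k : ℕ}
    (hk : k < N) :
    ‖a k‖ ^ 2 ≤ (∑ i ∈ Finset.range N, ‖∑ l ∈ Finset.range N, (ω ^ i) ^ l • a l‖ ^ 2) / N := by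
  have hN : (0 : ℝ) < N := by exact_mod_cast (by omega : 0 < N)
  have hω1 : ‖ω‖ = 1 := hω.norm'_eq_one (by omega)
  have h1 := sum_root_smul_polynomial hω a hk (m := N - k) (by rw [Nat.sub_add_cancel hk.le])
  have h2 : N * ‖a k‖ ≤ ∑ i ∈ Finset.range N, ‖∑ l ∈ Finset.range N, (ω ^ i) ^ l • a l‖ := by
    have := norm_sum_le (Finset.range N)
      fun i => (ω ^ i) ^ (N - k) • ∑ l ∈ Finset.range N, (ω ^ i) ^ l • a l
    rw [h1, norm_smul] at this
    simpa [norm_smul, hω1] using this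
  have h3 := sq_sum_le_card_mul_sum_sq (s := Finset.range N)
    (f := fun i => ‖∑ l ∈ Finset.range N, (ω ^ i) ^ l • a l‖)
  rw [Finset.card_range] at h3
  rw [le_div_iff₀ hN]
  have h4 : (N * ‖a k‖) ^ 2 ≤
      N * ∑ i ∈ Finset.range N, ‖∑ l ∈ Finset.range N, (ω ^ i) ^ l • a l‖ ^ 2 :=
    (by gcongr : (N * ‖a k‖) ^ 2 ≤ _).trans h3
  refine le_of_mul_le_mul_left ?_ hN
  linarith

theorem parseval_roots {N : ℕ} (hN : 0 < N) {ω : ℂ} (hω : IsPrimitiveRoot ω N) (a : ℕ → ℂ) :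
    (∑ i ∈ Finset.range N, ‖∑ l ∈ Finset.range N, (ω ^ i) ^ l • a l‖ ^ 2) / N
      = ∑ k ∈ Finset.range N, ‖a k‖ ^ 2 := by
  have hN' : (N : ℝ) ≠ 0 := by positivity
  have hω1 : ‖ω‖ = 1 := hω.norm'_eq_one hN.ne'
  rw [div_eq_iff hN']
  apply Complex.ofReal_injective
  push_cast
  simp_rw [← Complex.conj_mul']
  have h1 : ∀ i, (starRingEnd ℂ) (∑ l ∈ Finset.range N, (ω ^ i) ^ l • a l)
      = ∑ k ∈ Finset.range N, (starRingEnd ℂ) (a k) * (ω ^ i) ^ (N - k) := fun i => by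
    rw [map_sum]
    refine Finset.sum_congr rfl fun k hk => ?_
    rw [Finset.mem_range] at hk
    rw [smul_eq_mul, map_mul, mul_comm]
    congr 1
    have h2 : ω ^ i * (starRingEnd ℂ) (ω ^ i) = 1 := by
      rw [Complex.mul_conj']
      simp [hω1]
    have h3 : (ω ^ i) ^ N = 1 := by rw [← pow_mul, mul_comm, pow_mul, hω.pow_eq_one, one_pow]
    have h4 : (ω ^ i) ^ (N - k) * (ω ^ i) ^ k = 1 := by
      rw [← pow_add, Nat.sub_add_cancel hk.le, h3]
    rw [map_pow]
    calc (starRingEnd ℂ) (ω ^ i) ^ k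
        = ((ω ^ i) ^ (N - k) * (ω ^ i) ^ k) * (starRingEnd ℂ) (ω ^ i) ^ k := by rw [h4, one_mul]
      _ = (ω ^ i) ^ (N - k) * (ω ^ i * (starRingEnd ℂ) (ω ^ i)) ^ k := by rw [mul_pow]; ring
      _ = _ := by rw [h2, one_pow, mul_one]
  simp_rw [h1, Finset.sum_mul]
  rw [Finset.sum_comm]
  refine Finset.sum_congr rfl fun k hk => ?_
  rw [Finset.mem_range] at hk
  have h5 := sum_root_smul_polynomial hω a hk (m := N - k) (by rw [Nat.sub_add_cancel hk.le])
  simp only [smul_eq_mul] at h5 ⊢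
  simp_rw [mul_assoc]
  rw [← Finset.mul_sum, h5]
  ring

/-- Average the polynomial against the kernel 1 + Re(ζ ω^{-i}), which lies between 0 and 2 and has
mean 1. The average is the vector on the left. The norms of the values deviate from ‖a 0‖ by at most
√(s − ‖a 0‖²) in quadratic mean, and the kernel at most doubles this. -/
theorem norm_add_coeff_le {N : ℕ} (hN : 3 ≤ N) {ω : ℂ} (hω : IsPrimitiveRoot ω N) (a : ℕ → Z)
    {s : ℝ} (hs : (∑ i ∈ Finset.range N, ‖∑ l ∈ Finset.range N, (ω ^ i) ^ l • a l‖ ^ 2) / N = s)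
    (ζ : ℂ) (hζ : ‖ζ‖ ≤ 1) :
    ‖a 0 + (ζ / 2) • a 1 + ((starRingEnd ℂ) ζ / 2) • a (N - 1)‖
      ≤ ‖a 0‖ + 2 * √(s - ‖a 0‖ ^ 2) := by
  have hN0 : (0 : ℝ) < N := by exact_mod_cast (by omega : 0 < N)
  have hω1 : ‖ω‖ = 1 := hω.norm'_eq_one (by omega)
  set P : ℕ → Z := fun i => ∑ l ∈ Finset.range N, (ω ^ i) ^ l • a l with hP
  set c := ‖a 0‖
  set K : ℕ → ℝ := fun i => 1 + (ζ * (ω ^ i) ^ (N - 1)).re with hK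
  have hre : ∀ i, |(ζ * (ω ^ i) ^ (N - 1)).re| ≤ 1 := fun i => by
    refine (Complex.abs_re_le_norm _).trans ?_
    simpa [hω1] using hζ
  have hK0 : ∀ i, 0 ≤ K i := fun i => by
    have := (abs_le.1 (hre i)).1
    simp only [hK]
    linarith
  have hK2 : ∀ i, K i ≤ 2 := fun i => by
    have := (abs_le.1 (hre i)).2
    simp only [hK]
    linarith
  have hKc : ∀ i, (K i : ℂ) = 1 + ζ / 2 * (ω ^ i) ^ (N - 1) + (starRingEnd ℂ) ζ / 2 * ω ^ i := by
    intro i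
    have h2 : ω ^ i * (starRingEnd ℂ) (ω ^ i) = 1 := by
      rw [Complex.mul_conj']
      simp [hω1]
    have h3 : (ω ^ i) ^ N = 1 := by rw [← pow_mul, mul_comm, pow_mul, hω.pow_eq_one, one_pow]
    have h4 : (ω ^ i) ^ (N - 1) = (starRingEnd ℂ) (ω ^ i) := by
      have h5 : (ω ^ i) ^ (N - 1) * ω ^ i = 1 := by
        rw [← pow_succ, Nat.sub_add_cancel (by omega), h3]
      calc (ω ^ i) ^ (N - 1) = (ω ^ i) ^ (N - 1) * (ω ^ i * (starRingEnd ℂ) (ω ^ i)) := by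
            rw [h2, mul_one]
        _ = ((ω ^ i) ^ (N - 1) * ω ^ i) * (starRingEnd ℂ) (ω ^ i) := by ring
        _ = _ := by rw [h5, one_mul]
    simp only [hK]
    rw [h4]
    push_cast
    rw [Complex.re_eq_add_conj]
    simp only [map_mul, Complex.conj_conj]
    ring
  have hsum : ∑ i ∈ Finset.range N, (K i : ℂ) • P i
      = (N : ℂ) • (a 0 + (ζ / 2) • a 1 + ((starRingEnd ℂ) ζ / 2) • a (N - 1)) := by
    have e0 := sum_root_smul_polynomial hω a (k := 0) (m := 0) (by omega) (by simp)
    have e1 := sum_root_smul_polynomial hω a (k := 1) (m := N - 1) (by omega)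
      (by rw [Nat.sub_add_cancel (by omega)])
    have e2 := sum_root_smul_polynomial hω a (k := N - 1) (m := 1) (by omega)
      (by rw [Nat.add_sub_cancel' (by omega)])
    simp only [pow_zero, one_smul, pow_one] at e0 e1 e2
    simp_rw [hKc, add_smul, Finset.sum_add_distrib, mul_smul, one_smul, ← Finset.smul_sum]
    rw [smul_add, smul_add, smul_comm (N : ℂ) (ζ / 2), smul_comm (N : ℂ) ((starRingEnd ℂ) ζ / 2),
      ← e0, ← e1, ← e2]
  have hsumK : ∑ i ∈ Finset.range N, K i = N := by
    apply Complex.ofReal_injective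
    push_cast
    simp_rw [hKc, Finset.sum_add_distrib, ← Finset.mul_sum]
    rw [sum_pow_mul_root hω, if_neg (fun h => by have := Nat.le_of_dvd (by omega) h; omega)]
    have := sum_pow_mul_root hω 1
    simp only [pow_one] at this
    rw [this, if_neg (fun h => by have := Nat.le_of_dvd (by omega) h; omega)]
    simp
  have hPc : N * c ≤ ∑ i ∈ Finset.range N, ‖P i‖ := by
    have e0 := sum_root_smul_polynomial hω a (k := 0) (m := 0) (by omega) (by simp)
    simp only [pow_zero, one_smul] at e0
    have := norm_sum_le (Finset.range N) P
    rw [e0, norm_smul] at this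
    simpa using this
  -- Expanding the square, the cross term is controlled because the mean of ‖P i‖ is at least c.
  have hvar : ∑ i ∈ Finset.range N, (‖P i‖ - c) ^ 2 ≤ N * (s - c ^ 2) := by
    have hs' : ∑ i ∈ Finset.range N, ‖P i‖ ^ 2 = s * N := by
      rw [div_eq_iff hN0.ne'] at hs
      exact hs
    simp_rw [sub_sq, Finset.sum_add_distrib, Finset.sum_sub_distrib]
    rw [hs', ← Finset.sum_mul, ← Finset.mul_sum]
    simp only [Finset.sum_const, Finset.card_range, nsmul_eq_mul]
    nlinarith [norm_nonneg (a 0)]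
  have habs : ∑ i ∈ Finset.range N, |‖P i‖ - c| ≤ N * √(s - c ^ 2) := by
    have h3 := sq_sum_le_card_mul_sum_sq (s := Finset.range N) (f := fun i => |‖P i‖ - c|)
    rw [Finset.card_range] at h3
    simp only [sq_abs] at h3
    have h4 : (∑ i ∈ Finset.range N, |‖P i‖ - c|) ^ 2 ≤ N ^ 2 * (s - c ^ 2) := by
      calc _ ≤ _ := h3
        _ ≤ N * (N * (s - c ^ 2)) := by gcongr
        _ = _ := by ring
    have h5 := Real.sqrt_le_sqrt h4
    rwa [Real.sqrt_sq (Finset.sum_nonneg fun _ _ => abs_nonneg _), Real.sqrt_mul (by positivity),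
      Real.sqrt_sq hN0.le] at h5
  have hfin : N * ‖a 0 + (ζ / 2) • a 1 + ((starRingEnd ℂ) ζ / 2) • a (N - 1)‖
      ≤ N * (c + 2 * √(s - c ^ 2)) := by
    calc N * ‖a 0 + (ζ / 2) • a 1 + ((starRingEnd ℂ) ζ / 2) • a (N - 1)‖
        = ‖∑ i ∈ Finset.range N, (K i : ℂ) • P i‖ := by rw [hsum, norm_smul]; simp
      _ ≤ ∑ i ∈ Finset.range N, ‖(K i : ℂ) • P i‖ := norm_sum_le _ _
      _ = ∑ i ∈ Finset.range N, (K i * c + K i * (‖P i‖ - c)) := by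
        refine Finset.sum_congr rfl fun i _ => ?_
        rw [norm_smul, Complex.norm_real, Real.norm_of_nonneg (hK0 i)]
        ring
      _ ≤ ∑ i ∈ Finset.range N, (K i * c + 2 * |‖P i‖ - c|) := by
        refine Finset.sum_le_sum fun i _ => add_le_add le_rfl ?_
        calc K i * (‖P i‖ - c) ≤ K i * |‖P i‖ - c| := by
              gcongr
              · exact hK0 i
              · exact le_abs_self _
          _ ≤ 2 * |‖P i‖ - c| := by
              gcongr
              exact hK2 i
      _ = N * c + 2 * ∑ i ∈ Finset.range N, |‖P i‖ - c| := by
        rw [Finset.sum_add_distrib, ← Finset.sum_mul, hsumK, Finset.mul_sum]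
      _ ≤ N * c + 2 * (N * √(s - c ^ 2)) := by gcongr
      _ = _ := by ring
  exact le_of_mul_le_mul_left hfin hN0

end RootsOfUnity

/-! ### Truncated resolvent series of a nearly minimal vector -/

section OrbitAverages

variable {J Y Z : Type*} [NormedAddCommGroup Y] [NormedSpace ℂ Y] [NormedAddCommGroup Z]
    [NormedSpace ℂ Z]

/-- The mean of `‖∑ ω^l a_l‖²`, `l < N`, over the `N`-th roots of unity `ω`. -/
noncomputable def rootMean (N : ℕ) (a : ℕ → Z) : ℝ :=
  (∑ i ∈ Finset.range N, ‖∑ l ∈ Finset.range N,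
    (Complex.exp (2 * Real.pi * Complex.I / N) ^ i) ^ l • a l‖ ^ 2) / N

theorem norm_pow_apply_le {A B : Y →L[ℂ] Y} (hAB : ∀ y, A (B y) = y) {σ : ℝ} (hσ : 0 < σ)
    (hlow : ∀ y, σ * ‖y‖ ≤ ‖A y‖) (k : ℕ) (y : Y) : σ ^ k * ‖(B ^ k) y‖ ≤ ‖y‖ := by
  induction k with
  | zero => simp
  | succ k ih =>
    have h1 := hlow ((B ^ (k + 1)) y)
    rw [pow_succ' B, mul_apply_eq_comp, hAB] at h1
    rw [pow_succ' B, mul_apply_eq_comp, pow_succ, mul_assoc]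
    exact (mul_le_mul_of_nonneg_left h1 (by positivity)).trans ih

/-- Telescoping: the sum truncates the Neumann series of (1 − wB)⁻¹y, so A − w sends it to Ay up to
one tail term. -/
theorem apply_orbit_sum {A B : Y →L[ℂ] Y} (hAB : ∀ y, A (B y) = y) (w : ℂ) (y : Y) (N : ℕ) :
    A (∑ l ∈ Finset.range (N + 1), w ^ l • (B ^ l) y)
      - w • ∑ l ∈ Finset.range (N + 1), w ^ l • (B ^ l) y = A y - w ^ (N + 1) • (B ^ N) y := by
  induction N with
  | zero => simp
  | succ N ih =>
    rw [Finset.sum_range_succ, map_add, smul_add]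
    have h1 : A (w ^ (N + 1) • (B ^ (N + 1)) y) = w ^ (N + 1) • (B ^ N) y := by
      rw [map_smul, pow_succ' B, mul_apply_eq_comp, hAB]
    rw [h1, smul_smul, ← pow_succ', add_sub_add_comm, ih]
    abel

/-- Apply the lower bound for A − w to the truncated series. Its image is almost Ay, which is almost
as short as σ allows; the condition 2r ≤ σ makes the tail decay like powers of 1/2. -/
theorem norm_orbit_sum_le {A B : Y →L[ℂ] Y} (hAB : ∀ y, A (B y) = y) {σ r κ : ℝ} (hσ : 0 < σ)
    (hr : 0 ≤ r) (hrσ : 2 * r ≤ σ)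
    (hlow : ∀ μ : ℂ, ‖μ‖ ≤ r → ∀ y, σ * ‖y‖ ≤ ‖A y - μ • y‖) {y : Y}
    (hy : ‖A y‖ ≤ σ * (1 + κ) * ‖y‖) {w : ℂ} (hw : ‖w‖ = r) {N : ℕ} (hN : 0 < N) :
    ‖∑ l ∈ Finset.range N, w ^ l • (B ^ l) y‖ ≤ (1 + κ + (1 / 2) ^ N) * ‖y‖ := by
  obtain ⟨N, rfl⟩ : ∃ M, N = M + 1 := ⟨N - 1, by omega⟩
  have h1 := hlow w hw.le (∑ l ∈ Finset.range (N + 1), w ^ l • (B ^ l) y)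
  rw [apply_orbit_sum hAB] at h1
  have h0 : ∀ y, σ * ‖y‖ ≤ ‖A y‖ := fun y => by simpa using hlow 0 (by simpa using hr) y
  have h2 := norm_pow_apply_le hAB hσ h0 N y
  have h3 : ‖w ^ (N + 1) • (B ^ N) y‖ ≤ σ * (1 / 2) ^ (N + 1) * ‖y‖ := by
    rw [norm_smul, norm_pow, hw]
    calc r ^ (N + 1) * ‖(B ^ N) y‖ ≤ (σ / 2) ^ (N + 1) * ‖(B ^ N) y‖ := by
          gcongr
          linarith
      _ = σ * (1 / 2) ^ (N + 1) * (σ ^ N * ‖(B ^ N) y‖) := by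
          rw [div_pow, one_div, inv_pow]
          field_simp
          ring
      _ ≤ _ := by gcongr
  have h4 := norm_sub_le (A y) (w ^ (N + 1) • (B ^ N) y)
  refine le_of_mul_le_mul_left ?_ hσ
  nlinarith

/-- Mean squares on the circle add up over the coordinates. As each coordinate mean dominates ‖T j
y‖², with total ‖y‖², the nonnegative excesses have a small sum. -/
theorem exists_hasSum_rootMean {T : J → Y →L[ℂ] Z} (hT : IsL2Coord T) {A B : Y →L[ℂ] Y}
    (hAB : ∀ y, A (B y) = y) {σ r κ : ℝ} (hσ : 0 < σ) (hr : 0 ≤ r) (hrσ : 2 * r ≤ σ)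
    (hlow : ∀ μ : ℂ, ‖μ‖ ≤ r → ∀ y, σ * ‖y‖ ≤ ‖A y - μ • y‖) {y : Y}
    (hy : ‖A y‖ ≤ σ * (1 + κ) * ‖y‖) {N : ℕ} (hN : 0 < N) :
    ∃ S ≤ (1 + κ + (1 / 2) ^ N) ^ 2 * ‖y‖ ^ 2,
      HasSum (fun j => rootMean N fun l => T j ((r : ℂ) ^ l • (B ^ l) y)) S := by
  have hN' : (0 : ℝ) < N := by exact_mod_cast hN
  set ω := Complex.exp (2 * Real.pi * Complex.I / N) with hωdef
  have hω : IsPrimitiveRoot ω N := Complex.isPrimitiveRoot_exp N hN.ne'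
  have hω1 : ‖ω‖ = 1 := hω.norm'_eq_one hN.ne'
  set P : ℕ → Y := fun i => ∑ l ∈ Finset.range N, (ω ^ i) ^ l • ((r : ℂ) ^ l • (B ^ l) y)
  have hP : ∀ i, ‖P i‖ ≤ (1 + κ + (1 / 2) ^ N) * ‖y‖ := fun i => by
    have h1 : P i = ∑ l ∈ Finset.range N, (ω ^ i * r) ^ l • (B ^ l) y :=
      Finset.sum_congr rfl fun l _ => by rw [smul_smul, mul_pow]
    rw [h1]
    refine norm_orbit_sum_le hAB hσ hr hrσ hlow hy ?_ hN
    simp [hω1, abs_of_nonneg hr]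
  refine ⟨(∑ i ∈ Finset.range N, ‖P i‖ ^ 2) / N, ?_, ?_⟩
  · rw [div_le_iff₀ hN']
    calc ∑ i ∈ Finset.range N, ‖P i‖ ^ 2
        ≤ ∑ i ∈ Finset.range N, ((1 + κ + (1 / 2) ^ N) * ‖y‖) ^ 2 := by
          gcongr with i _
          exact hP i
      _ = _ := by simp [mul_pow, mul_comm]
  · have h1 : HasSum (fun j => ∑ i ∈ Finset.range N, ‖T j (P i)‖ ^ 2)
        (∑ i ∈ Finset.range N, ‖P i‖ ^ 2) := hasSum_sum fun i _ => hT (P i)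
    have h2 := h1.div_const (N : ℝ)
    have h3 : (fun j => rootMean N fun l => T j ((r : ℂ) ^ l • (B ^ l) y))
        = fun j => (∑ i ∈ Finset.range N, ‖T j (P i)‖ ^ 2) / N := funext fun j => ?_
    · rw [h3]
      exact h2
    unfold rootMean
    refine congrArg (· / (N : ℝ)) (Finset.sum_congr rfl fun i _ => ?_)
    simp only [P, map_sum, map_smul]
    rfl

theorem sq_norm_le_rootMean {N : ℕ} (a : ℕ → Z) {k : ℕ} (hk : k < N) :
    ‖a k‖ ^ 2 ≤ rootMean N a :=
  sq_norm_coeff_le (Complex.isPrimitiveRoot_exp N (by omega)) a hk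

theorem norm_orbit_le {A B : Y →L[ℂ] Y} (hAB : ∀ y, A (B y) = y) {σ r : ℝ} (hσ : 0 < σ)
    (hr : 0 ≤ r) (hrσ : 2 * r ≤ σ) (hlow : ∀ y, σ * ‖y‖ ≤ ‖A y‖) (k : ℕ) (y : Y) :
    ‖(r : ℂ) ^ k • (B ^ k) y‖ ≤ (1 / 2) ^ k * ‖y‖ := by
  rw [norm_smul, norm_pow, Complex.norm_real, Real.norm_of_nonneg hr]
  calc r ^ k * ‖(B ^ k) y‖ ≤ (σ / 2) ^ k * ‖(B ^ k) y‖ := by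
        gcongr
        linarith
    _ = (1 / 2) ^ k * (σ ^ k * ‖(B ^ k) y‖) := by
        rw [div_pow, one_div, inv_pow]
        ring
    _ ≤ _ := by
        gcongr
        exact norm_pow_apply_le hAB hσ hlow k y

end OrbitAverages

/-! ### Improved lower bounds from complex uniform convexity -/

section ComplexUniformConvexity

variable {J Y Z : Type*} [NormedAddCommGroup Y] [NormedSpace ℂ Y] [NormedAddCommGroup Z]
    [NormedSpace ℂ Z]

/-- Let e be the excess of the mean square, f = ‖a (N − 1)‖ and ρ = ‖a 0‖ + 2√e + f, which bounds a
0 + ζ(a 1)/2. Either a 1 is small relative to ηρ (first term), or convexity forces δ‖a 0‖ ≤ 2√e + f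
and ‖a 1‖² ≤ ‖a 0‖² + e finishes. Adding the alternatives gives an inequality that can be summed
over coordinates. -/
theorem sq_norm_coeff_one_le {η δ : ℝ} (hη : 0 < η) (hδ : 0 < δ)
    (h : ∀ x y : Z, η ≤ ‖y‖ → (∀ ζ : ℂ, ‖ζ‖ ≤ 1 → ‖x + ζ • y‖ ≤ 1) → ‖x‖ ≤ 1 - δ)
    {N : ℕ} (hN : 3 ≤ N) (a : ℕ → Z) :
    ‖a 1‖ ^ 2 ≤ 12 * η ^ 2 * (‖a 0‖ ^ 2 + 4 * (rootMean N a - ‖a 0‖ ^ 2) + ‖a (N - 1)‖ ^ 2)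
      + (8 * (rootMean N a - ‖a 0‖ ^ 2) + 2 * ‖a (N - 1)‖ ^ 2) / δ ^ 2
      + (rootMean N a - ‖a 0‖ ^ 2) := by
  set e := rootMean N a - ‖a 0‖ ^ 2 with he
  set c := ‖a 0‖ with hc
  set f := ‖a (N - 1)‖ with hf
  have he0 : 0 ≤ e := sub_nonneg.2 (sq_norm_le_rootMean a (by omega))
  have hc0 : 0 ≤ c := norm_nonneg _
  have hf0 : 0 ≤ f := norm_nonneg _
  have h1 : ‖a 1‖ ^ 2 ≤ c ^ 2 + e := by
    have := sq_norm_le_rootMean a (N := N) (k := 1) (by omega)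
    linarith
  have hsq : √e ^ 2 = e := Real.sq_sqrt he0
  have hse := Real.sqrt_nonneg e
  set ρ := c + 2 * √e + f with hρ
  have hbd : ∀ ζ : ℂ, ‖ζ‖ ≤ 1 → ‖a 0 + ζ • ((1 / 2 : ℂ) • a 1)‖ ≤ ρ := fun ζ hζ => by
    have h2 := norm_add_coeff_le hN (Complex.isPrimitiveRoot_exp N (by omega)) a
      (s := rootMean N a) rfl ζ hζ
    have h3 : ‖((starRingEnd ℂ) ζ / 2) • a (N - 1)‖ ≤ f := by
      rw [norm_smul, norm_div, RCLike.norm_conj]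
      have : ‖ζ‖ / ‖(2 : ℂ)‖ ≤ 1 := by
        rw [Complex.norm_ofNat]
        linarith
      exact mul_le_of_le_one_left (norm_nonneg _) this
    have h4 : a 0 + ζ • ((1 / 2 : ℂ) • a 1) = (a 0 + (ζ / 2) • a 1
        + ((starRingEnd ℂ) ζ / 2) • a (N - 1)) - ((starRingEnd ℂ) ζ / 2) • a (N - 1) := by
      rw [smul_smul, mul_one_div, add_sub_cancel_right]
    rw [h4]
    refine (norm_sub_le _ _).trans ?_
    linarith
  have hpos1 : 0 ≤ 12 * η ^ 2 * (c ^ 2 + 4 * e + f ^ 2) := by positivity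
  have hpos2 : 0 ≤ (8 * e + 2 * f ^ 2) / δ ^ 2 := by positivity
  rcases (by positivity : 0 ≤ ρ).eq_or_lt with h0 | h0
  · have hcz : c = 0 := by linarith
    rw [hcz] at h1
    nlinarith
  have hsm : ∀ x : Z, ‖(ρ⁻¹ : ℂ) • x‖ = ‖x‖ / ρ := fun x => by
    rw [norm_smul, norm_inv, Complex.norm_real, Real.norm_of_nonneg h0.le]
    ring
  by_cases hcase : η ≤ ‖(ρ⁻¹ : ℂ) • ((1 / 2 : ℂ) • a 1)‖
  · have h5 := h ((ρ⁻¹ : ℂ) • a 0) ((ρ⁻¹ : ℂ) • ((1 / 2 : ℂ) • a 1)) hcase fun ζ hζ => by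
      rw [smul_comm ζ, ← smul_add, hsm, div_le_one h0]
      exact hbd ζ hζ
    rw [hsm, div_le_iff₀ h0] at h5
    have h6 : δ * ρ ≤ 2 * √e + f := by linarith
    have h7 : δ * c ≤ 2 * √e + f := by nlinarith
    have h8 : c ^ 2 ≤ (8 * e + 2 * f ^ 2) / δ ^ 2 := by
      rw [le_div_iff₀ (by positivity)]
      have h9 : (δ * c) ^ 2 ≤ (2 * √e + f) ^ 2 := by gcongr
      nlinarith [sq_nonneg (2 * √e - f)]
    linarith
  · rw [hsm, not_le, div_lt_iff₀ h0, norm_smul] at hcase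
    norm_num at hcase
    have h5 : ‖a 1‖ ≤ 2 * η * ρ := by linarith
    have h6 : ‖a 1‖ ^ 2 ≤ (2 * η * ρ) ^ 2 := by gcongr
    have h7 : ρ ^ 2 ≤ 3 * (c ^ 2 + 4 * e + f ^ 2) := by
      rw [hρ]
      nlinarith [sq_nonneg (c - 2 * √e), sq_nonneg (c - f), sq_nonneg (2 * √e - f)]
    have h8 : (2 * η * ρ) ^ 2 ≤ 12 * η ^ 2 * (c ^ 2 + 4 * e + f ^ 2) := by
      have : (2 * η * ρ) ^ 2 = 4 * η ^ 2 * ρ ^ 2 := by ring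
      rw [this]
      nlinarith [mul_le_mul_of_nonneg_left h7 (by positivity : 0 ≤ 4 * η ^ 2)]
    linarith

/-- A quantitative form of Globevnik's theorem: for operators on an `ℓ²`-sum of copies of a complex
uniformly convex space, a lower bound for `A - μ` that holds uniformly for `μ` in a disc can be
improved at the centre of the disc. -/
theorem ComplexUniformlyConvex.exists_improved_lower_bound (hZ : ComplexUniformlyConvex Z)
    {T : J → Y →L[ℂ] Z} (hT : IsL2Coord T) {σ r : ℝ} (hσ : 0 < σ) (hr : 0 < r) (K : ℝ) :
    ∃ δ : ℝ, 0 < δ ∧ ∀ A B : Y →L[ℂ] Y, (∀ y, A (B y) = y) → ‖A‖ ≤ K →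
      (∀ μ : ℂ, ‖μ‖ ≤ r → ∀ y, σ * ‖y‖ ≤ ‖A y - μ • y‖) → ∀ y, (σ + δ) * ‖y‖ ≤ ‖A y‖ := by
  wlog hrσ : 2 * r ≤ σ generalizing r
  · obtain ⟨δ, hδ, h⟩ := this (r := σ / 2) (by positivity) (by linarith)
    exact ⟨δ, hδ, fun A B hAB hA hlow => h A B hAB hA fun μ hμ => hlow μ (by linarith)⟩
  wlog hK : 0 < K generalizing K
  · obtain ⟨δ, hδ, h⟩ := this (max K 1) (by positivity)
    exact ⟨δ, hδ, fun A B hAB hA => h A B hAB (hA.trans (le_max_left _ _))⟩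
  -- L bounds ‖rBy‖²/‖y‖² from below. With 12η² = L/4 the first term of `sq_norm_coeff_one_le` sums
  -- to at most (L/2)‖y‖², and τ is chosen so that the remaining terms stay strictly below
  -- (L/2)‖y‖².
  set L := (r / K) ^ 2 with hL
  have hL0 : 0 < L := by positivity
  have hη : 0 < √(L / 48) := Real.sqrt_pos.2 (by positivity)
  have hη2 : √(L / 48) ^ 2 = L / 48 := Real.sq_sqrt (by positivity)
  set η := √(L / 48)
  obtain ⟨δ₀, hδ₀, hcuc⟩ := hZ η hη
  obtain ⟨τ, hτ, hτ1, hτ2⟩ : ∃ τ : ℝ, 0 < τ ∧ τ ≤ 1 / 5 ∧ (10 / δ₀ ^ 2 + 1) * τ < L / 2 := by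
    refine ⟨min (1 / 5) (L / 4 / (10 / δ₀ ^ 2 + 1)), by positivity, min_le_left _ _, ?_⟩
    calc _ ≤ (10 / δ₀ ^ 2 + 1) * (L / 4 / (10 / δ₀ ^ 2 + 1)) := by
          gcongr
          exact min_le_right _ _
      _ = L / 4 := by field_simp
      _ < L / 2 := by linarith
  obtain ⟨N₀, hN₀⟩ := exists_pow_lt_of_lt_one (by positivity : 0 < τ / 8)
    (by norm_num : (1 / 2 : ℝ) < 1)
  set N := N₀ + 3 with hNdef
  have hN : (1 / 2 : ℝ) ^ (N - 1) ≤ τ / 8 :=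
    (pow_le_pow_of_le_one (by norm_num) (by norm_num) (by omega)).trans hN₀.le
  have hN' : (1 / 2 : ℝ) ^ N ≤ τ / 8 :=
    (pow_le_pow_of_le_one (by norm_num) (by norm_num) (by omega)).trans hN₀.le
  refine ⟨σ * (τ / 8), by positivity, fun A B hAB hA hlow y => ?_⟩
  by_contra! hcon
  have hlow0 : ∀ y, σ * ‖y‖ ≤ ‖A y‖ := fun y => by simpa using hlow 0 (by simpa using hr.le) y
  have hy0 : y ≠ 0 := by
    rintro rfl
    simp at hcon
  have hyn : 0 < ‖y‖ := norm_pos_iff.2 hy0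
  set m := ‖y‖ ^ 2 with hm
  have hm0 : 0 < m := by positivity
  obtain ⟨S, hS, hsum⟩ := exists_hasSum_rootMean hT hAB hσ hr.le hrσ (κ := τ / 8)
    hlow (y := y) (by rw [mul_one_add]; exact hcon.le) (N := N) (by omega)
  set a : J → ℕ → Z := fun j l => T j ((r : ℂ) ^ l • (B ^ l) y) with ha
  have hSτ : S - m ≤ τ * m := by
    have h1 : (1 + τ / 8 + (1 / 2) ^ N) ^ 2 ≤ (1 + τ / 4) ^ 2 := by
      refine pow_le_pow_left₀ (by positivity) ?_ 2
      linarith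
    have h2 : (1 + τ / 4) ^ 2 ≤ 1 + τ := by nlinarith
    have h3 := mul_le_mul_of_nonneg_right (h1.trans h2) hm0.le
    linarith
  have hc : HasSum (fun j => ‖a j 0‖ ^ 2) m := by simpa [ha] using hT y
  have hf : HasSum (fun j => ‖a j (N - 1)‖ ^ 2) (‖(r : ℂ) ^ (N - 1) • (B ^ (N - 1)) y‖ ^ 2) :=
    hT _
  have h1 : HasSum (fun j => ‖a j 1‖ ^ 2) (‖(r : ℂ) • B y‖ ^ 2) := by
    simpa [ha] using hT ((r : ℂ) • B y)
  set F := ‖(r : ℂ) ^ (N - 1) • (B ^ (N - 1)) y‖ ^ 2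
  have hF : F ≤ τ * m := by
    have h2 := norm_orbit_le hAB hσ hr.le hrσ hlow0 (N - 1) y
    have h3 : F ≤ ((1 / 2) ^ (N - 1) * ‖y‖) ^ 2 := pow_le_pow_left₀ (norm_nonneg _) h2 2
    have h4 : F ≤ (τ / 8 * ‖y‖) ^ 2 :=
      h3.trans (pow_le_pow_left₀ (by positivity) (mul_le_mul_of_nonneg_right hN hyn.le) 2)
    have h5 : (τ / 8 * ‖y‖) ^ 2 = (τ / 8) ^ 2 * m := by ring
    rw [h5] at h4
    refine h4.trans ?_
    refine mul_le_mul_of_nonneg_right ?_ hm0.le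
    nlinarith
  have he := hsum.sub hc
  have hle := hasSum_le (fun j => sq_norm_coeff_one_le hη hδ₀ hcuc (N := N) (by omega) (a j)) h1
    (((((hc.add (he.mul_left 4)).add hf).mul_left (12 * η ^ 2)).add
      (((he.mul_left 8).add (hf.mul_left 2)).div_const (δ₀ ^ 2))).add he)
  have hBy : L * m ≤ ‖(r : ℂ) • B y‖ ^ 2 := by
    have h2 : ‖y‖ ≤ K * ‖B y‖ := by
      calc ‖y‖ = ‖A (B y)‖ := by rw [hAB]
        _ ≤ ‖A‖ * ‖B y‖ := A.le_opNorm _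
        _ ≤ K * ‖B y‖ := by gcongr
    rw [norm_smul, Complex.norm_real, Real.norm_of_nonneg hr.le, hL, hm, ← mul_pow]
    refine pow_le_pow_left₀ (by positivity) ?_ 2
    rw [div_mul_eq_mul_div, div_le_iff₀ hK, mul_assoc, mul_comm _ K]
    exact mul_le_mul_of_nonneg_left h2 hr.le
  have h12 : 12 * η ^ 2 = L / 4 := by
    rw [hη2]
    ring
  rw [h12] at hle
  have h13 : L / 4 * (m + 4 * (S - m) + F) ≤ L / 4 * (2 * m) := by
    refine mul_le_mul_of_nonneg_left ?_ (by positivity)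
    have := mul_le_mul_of_nonneg_right hτ1 hm0.le
    linarith
  have h14 : (8 * (S - m) + 2 * F) / δ₀ ^ 2 ≤ 10 / δ₀ ^ 2 * (τ * m) := by
    rw [div_mul_eq_mul_div]
    gcongr
    linarith
  have h15 : (10 / δ₀ ^ 2 + 1) * τ * m < L / 2 * m := by gcongr
  linarith

end ComplexUniformConvexity

/-! ### Dimension count against local shift invariance -/

section ShiftInvariance

/-- The right shift on sequences. -/
def rightShift : (ℕ → ℂ) →ₗ[ℂ] (ℕ → ℂ) where
  toFun f k := if k = 0 then 0 else f (k - 1)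
  map_add' f g := by
    ext k
    by_cases h : k = 0 <;> simp [h]
  map_smul' c f := by
    ext k
    by_cases h : k = 0 <;> simp [h]

@[simp]
theorem rightShift_zero (f : ℕ → ℂ) : rightShift f 0 = 0 := rfl

@[simp]
theorem rightShift_succ (f : ℕ → ℂ) (k : ℕ) : rightShift f (k + 1) = f k := rfl

theorem rightShift_single (k : ℕ) :
    rightShift (Pi.single k 1) = (Pi.single (k + 1) 1 : ℕ → ℂ) := by
  ext i
  cases i with
  | zero => simp
  | succ i => simp [Pi.single_apply]

theorem le_finrank_of_single_mem {U : Submodule ℂ (ℕ → ℂ)} [FiniteDimensional ℂ U] {w : ℕ}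
    (h : ∀ k < w, (Pi.single k 1 : ℕ → ℂ) ∈ U) : w ≤ Module.finrank ℂ U := by
  have h1 : LinearIndependent ℂ (fun k : Fin w => (Pi.single (k : ℕ) 1 : ℕ → ℂ)) :=
    (Pi.linearIndependent_single_one ℕ ℂ).comp _ Fin.val_injective
  have h2 : LinearIndependent ℂ (fun k : Fin w => (⟨Pi.single (k : ℕ) 1, h k k.2⟩ : U)) :=
    LinearIndependent.of_comp U.subtype h1
  simpa using h2.fintype_card_le_finrank

theorem not_forall_single_mem (U : Submodule ℂ (ℕ → ℂ)) [FiniteDimensional ℂ U] :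
    ¬ ∀ k, (Pi.single k 1 : ℕ → ℂ) ∈ U := fun h => by
  have := le_finrank_of_single_mem (U := U) (w := Module.finrank ℂ U + 1) fun k _ => h k
  omega

/-- The sum of the spaces `G i`, `a ≤ i < b`. -/
def windowSum (G : ℕ → Submodule ℂ (ℕ → ℂ)) (a b : ℕ) : Submodule ℂ (ℕ → ℂ) :=
  (Finset.Ico a b).sup G

instance (G : ℕ → Submodule ℂ (ℕ → ℂ)) [∀ n, FiniteDimensional ℂ (G n)] (a b : ℕ) :
    FiniteDimensional ℂ (windowSum G a b) :=
  Submodule.finiteDimensional_finset_sup _ _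

theorem le_windowSum (G : ℕ → Submodule ℂ (ℕ → ℂ)) {a b i : ℕ} (ha : a ≤ i) (hb : i < b) :
    G i ≤ windowSum G a b :=
  Finset.le_sup (f := G) (Finset.mem_Ico.2 ⟨ha, hb⟩)

theorem windowSum_sup (G : ℕ → Submodule ℂ (ℕ → ℂ)) {a b c : ℕ} (hab : a ≤ b) (hbc : b ≤ c) :
    windowSum G a b ⊔ windowSum G b c = windowSum G a c := by
  unfold windowSum
  rw [← Finset.sup_union, Finset.Ico_union_Ico_eq_Ico hab hbc]

theorem windowSum_mono (G : ℕ → Submodule ℂ (ℕ → ℂ)) {a b a' b' : ℕ} (ha : a' ≤ a) (hb : b ≤ b') :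
    windowSum G a b ≤ windowSum G a' b' :=
  Finset.sup_mono (Finset.Ico_subset_Ico ha hb)

/-- The k-th unit sequence is the k-fold shift of the zeroth, and each shift widens the window
around c by one site on either side. -/
theorem single_mem_windowSum {G : ℕ → Submodule ℂ (ℕ → ℂ)}
    (h0 : ∀ n, (Pi.single 0 1 : ℕ → ℂ) ∈ G n)
    (hG : ∀ n, (G (n + 1)).map rightShift ≤ G n ⊔ G (n + 1) ⊔ G (n + 2)) (c k : ℕ) (hk : k ≤ c) :
    (Pi.single k 1 : ℕ → ℂ) ∈ windowSum G (c - k) (c + k + 1) := by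
  induction k with
  | zero => exact le_windowSum G (by omega) (by omega) (h0 c)
  | succ k ih =>
    rw [← rightShift_single]
    have h1 : (windowSum G (c - k) (c + k + 1)).map rightShift
        ≤ windowSum G (c - (k + 1)) (c + (k + 1) + 1) := by
      rw [Submodule.map_le_iff_le_comap]
      refine Finset.sup_le fun i hi => ?_
      rw [Finset.mem_Ico] at hi
      rw [← Submodule.map_le_iff_le_comap]
      obtain ⟨n, rfl⟩ : ∃ n, i = n + 1 := ⟨i - 1, by omega⟩
      refine (hG n).trans (sup_le (sup_le ?_ ?_) ?_) <;>
        exact le_windowSum G (by omega) (by omega)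
    exact h1 (Submodule.mem_map_of_mem (ih (by omega)))

/-- Adjacent windows of length 2^l share about 2^l/2 unit sequences, so joining them loses that many
dimensions. Every doubling lowers the dimension per site by at least 1/4. -/
theorem finrank_windowSum_le {G : ℕ → Submodule ℂ (ℕ → ℂ)} [∀ n, FiniteDimensional ℂ (G n)] {m : ℕ}
    (hm : ∀ n, Module.finrank ℂ (G n) ≤ m) (h0 : ∀ n, (Pi.single 0 1 : ℕ → ℂ) ∈ G n)
    (hG : ∀ n, (G (n + 1)).map rightShift ≤ G n ⊔ G (n + 1) ⊔ G (n + 2)) (l q : ℕ) :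
    4 * Module.finrank ℂ (windowSum G (q * 2 ^ l) ((q + 1) * 2 ^ l)) + l * 2 ^ l
      ≤ 4 * m * 2 ^ l := by
  induction l generalizing q with
  | zero =>
    have h1 : windowSum G (q * 2 ^ 0) ((q + 1) * 2 ^ 0) = G q := by
      simp [windowSum]
    rw [h1]
    have := hm q
    omega
  | succ l ih =>
    -- Natural division rounds down, so for l = 0 the bound is 1 and the zeroth unit sequence is
    -- still counted.
    have hmem : ∀ q : ℕ, ∀ k < 2 ^ l - 2 ^ l / 2,
        (Pi.single k 1 : ℕ → ℂ) ∈ windowSum G (q * 2 ^ l) ((q + 1) * 2 ^ l) := fun q k hk => by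
      have h1 : k ≤ 2 ^ l / 2 := by
        cases l with
        | zero =>
          simp at hk
          simp [hk]
        | succ l =>
          rw [pow_succ] at hk ⊢
          omega
      have h2 : (q + 1) * 2 ^ l = q * 2 ^ l + 2 ^ l := by ring
      refine windowSum_mono G ?_ ?_
        (single_mem_windowSum h0 hG (q * 2 ^ l + 2 ^ l / 2) k (by omega)) <;> omega
    set U := windowSum G (2 * q * 2 ^ l) ((2 * q + 1) * 2 ^ l)
    set V := windowSum G ((2 * q + 1) * 2 ^ l) ((2 * q + 1 + 1) * 2 ^ l)
    have hUV : windowSum G (q * 2 ^ (l + 1)) ((q + 1) * 2 ^ (l + 1)) = U ⊔ V := by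
      rw [windowSum_sup G (by gcongr; omega) (by gcongr; omega)]
      congr 1 <;> ring
    have hinf : 2 ^ l - 2 ^ l / 2 ≤ Module.finrank ℂ (U ⊓ V : Submodule ℂ (ℕ → ℂ)) :=
      le_finrank_of_single_mem fun k hk => ⟨hmem (2 * q) k hk, hmem (2 * q + 1) k hk⟩
    have hdim := Submodule.finrank_sup_add_finrank_inf_eq U V
    have i1 : 4 * Module.finrank ℂ U + l * 2 ^ l ≤ 4 * m * 2 ^ l := ih (2 * q)
    have i2 : 4 * Module.finrank ℂ V + l * 2 ^ l ≤ 4 * m * 2 ^ l := ih (2 * q + 1)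
    rw [hUV]
    have h3 : (l + 1) * 2 ^ (l + 1) = 2 * (l * 2 ^ l) + 2 * 2 ^ l := by ring
    have h4 : 4 * m * 2 ^ (l + 1) = 2 * (4 * m * 2 ^ l) := by ring
    rw [h3, h4]
    generalize l * 2 ^ l = x at *
    generalize 4 * m * 2 ^ l = z at *
    generalize 2 ^ l = p at *
    omega

theorem not_shift_invariant_nat {G : ℕ → Submodule ℂ (ℕ → ℂ)} [∀ n, FiniteDimensional ℂ (G n)]
    {m : ℕ} (hm : ∀ n, Module.finrank ℂ (G n) ≤ m) (h0 : ∀ n, (Pi.single 0 1 : ℕ → ℂ) ∈ G n)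
    (hG : ∀ n, (G (n + 1)).map rightShift ≤ G n ⊔ G (n + 1) ⊔ G (n + 2)) : False := by
  have h1 := finrank_windowSum_le hm h0 hG (4 * m + 1) 0
  have h2 : 4 * m * 2 ^ (4 * m + 1) < (4 * m + 1) * 2 ^ (4 * m + 1) := by
    gcongr
    omega
  omega

/-- A family of spaces of sequences of uniformly bounded dimension that is indexed by the integers
cannot be shift-invariant in the local sense, once it contains the sequence `(1, 0, 0, …)`. -/
theorem not_shift_invariant_int {F : ℤ → Submodule ℂ (ℕ → ℂ)} [∀ n, FiniteDimensional ℂ (F n)]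
    {m : ℕ} (hm : ∀ n, Module.finrank ℂ (F n) ≤ m) {S : Set ℤ}
    (h0 : ∀ j ∈ S, (Pi.single 0 1 : ℕ → ℂ) ∈ F j) (h1 : ∀ j ∉ S, F j = ⊥) (hS : 0 ∈ S)
    (hF : ∀ j, (F j).map rightShift ≤ F (j - 1) ⊔ F j ⊔ F (j + 1) ⊔ Submodule.span ℂ {Pi.single 0 1}) :
    False := by
  have hspan : ∀ j ∈ S, Submodule.span ℂ {(Pi.single 0 1 : ℕ → ℂ)} ≤ F j := fun j hj => by
    rw [Submodule.span_singleton_le_iff_mem]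
    exact h0 j hj
  -- If S contains a half-line, the family restricted to it is excluded by
  -- `not_shift_invariant_nat`. Otherwise F vanishes at some a < 0 < b, nothing leaks out of [a, b],
  -- and the sum over [a, b] is finite-dimensional, shift-invariant and contains every unit
  -- sequence.
  by_cases hpos : ∀ j : ℤ, 0 < j → j ∈ S
  · refine not_shift_invariant_nat (G := fun n => F n) (fun n => hm n) (fun n => h0 n ?_)
      fun n => ?_
    · rcases Nat.eq_zero_or_pos n with rfl | hn
      · exact hS
      · exact hpos n (by exact_mod_cast hn)
    · have h2 := hF ((n + 1 : ℕ) : ℤ)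
      have e1 : ((n + 1 : ℕ) : ℤ) - 1 = (n : ℤ) := by push_cast; ring
      have e2 : ((n + 1 : ℕ) : ℤ) + 1 = ((n + 2 : ℕ) : ℤ) := by push_cast; ring
      rw [e1, e2] at h2
      refine h2.trans (sup_le le_rfl ((hspan ((n + 1 : ℕ) : ℤ) (hpos _ (by positivity))).trans ?_))
      exact le_sup_of_le_left le_sup_right
  by_cases hneg : ∀ j : ℤ, j < 0 → j ∈ S
  · refine not_shift_invariant_nat (G := fun n => F (-n)) (fun n => hm _) (fun n => h0 _ ?_)
      fun n => ?_
    · rcases Nat.eq_zero_or_pos n with rfl | hn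
      · exact hS
      · exact hneg _ (by omega)
    · have h2 := hF (-((n + 1 : ℕ) : ℤ))
      have e1 : -((n + 1 : ℕ) : ℤ) - 1 = -((n + 2 : ℕ) : ℤ) := by push_cast; ring
      have e2 : -((n + 1 : ℕ) : ℤ) + 1 = -(n : ℤ) := by push_cast; ring
      rw [e1, e2] at h2
      refine h2.trans (sup_le (sup_le (sup_le ?_ ?_) ?_)
        ((hspan _ (hneg (-((n + 1 : ℕ) : ℤ)) (by omega))).trans ?_))
      · exact le_sup_right
      · exact le_sup_of_le_left le_sup_right
      · exact le_sup_of_le_left le_sup_left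
      · exact le_sup_of_le_left le_sup_right
  push Not at hpos hneg
  obtain ⟨b, hb0, hb⟩ := hpos
  obtain ⟨a, ha0, ha⟩ := hneg
  set U := (Finset.Icc a b).sup F
  have hle : ∀ j, a ≤ j → j ≤ b → F j ≤ U := fun j h2 h3 =>
    Finset.le_sup (f := F) (Finset.mem_Icc.2 ⟨h2, h3⟩)
  have : FiniteDimensional ℂ U := Submodule.finiteDimensional_finset_sup _ _
  have hU0 : Submodule.span ℂ {(Pi.single 0 1 : ℕ → ℂ)} ≤ U :=
    (hspan 0 hS).trans (hle 0 ha0.le hb0.le)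
  have hUU : U.map rightShift ≤ U := by
    rw [Submodule.map_le_iff_le_comap]
    refine Finset.sup_le fun j hj => ?_
    rw [Finset.mem_Icc] at hj
    by_cases hja : j = a
    · rw [hja, h1 a ha]
      exact bot_le
    by_cases hjb : j = b
    · rw [hjb, h1 b hb]
      exact bot_le
    rw [← Submodule.map_le_iff_le_comap]
    exact (hF j).trans (sup_le (sup_le (sup_le (hle _ (by omega) (by omega))
      (hle _ (by omega) (by omega))) (hle _ (by omega) (by omega))) hU0)
  refine not_forall_single_mem U fun k => ?_
  induction k with
  | zero => exact hU0 (Submodule.mem_span_singleton_self _)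
  | succ k ih =>
    rw [← rightShift_single]
    exact hUU (Submodule.mem_map_of_mem ih)

end ShiftInvariance

/-! ### Choosing a dominating site -/

section Domination

theorem summable_half_pow_natAbs : Summable fun i : ℤ => (1 / 2 : ℝ) ^ i.natAbs := by
  have h : Summable fun n : ℕ => (1 / 2 : ℝ) ^ n := summable_geometric_two
  exact Summable.of_nat_of_neg (by simpa using h) (by simpa using h)

theorem HasSum.mul_of_nonneg_real {h w : ℤ → ℝ} (h0 : ∀ j, 0 ≤ h j) {H W : ℝ}
    (hw0 : ∀ i, 0 ≤ w i) (hh : HasSum h H) (hw : HasSum w W) :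
    HasSum (fun x : ℤ × ℤ => h x.1 * w x.2) (H * W) :=
  hh.mul hw (hh.summable.mul_of_nonneg hw.summable h0 hw0)

/-- Pigeonhole: summed over p, the correlations of h with w total HW, less than the total of u. -/
theorem exists_sum_translates_lt {u h w : ℤ → ℝ} (h0 : ∀ j, 0 ≤ h j) (hw0 : ∀ i, 0 ≤ w i)
    {S H W : ℝ} (hu : HasSum u S) (hh : HasSum h H) (hw : HasSum w W) (hlt : H * W < S) :
    ∃ p : ℤ, ∀ i : ℤ, h (p + i) * w i < u p := by
  have hprod := HasSum.mul_of_nonneg_real h0 hw0 hh hw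
  let e : ℤ × ℤ ≃ ℤ × ℤ :=
    { toFun := fun x => (x.1 + x.2, x.2)
      invFun := fun x => (x.1 - x.2, x.2)
      left_inv := fun x => by simp
      right_inv := fun x => by simp }
  have hprod' : HasSum (fun x : ℤ × ℤ => h (x.1 + x.2) * w x.2) (H * W) := by
    have h1 := e.hasSum_iff.2 hprod
    simpa only [Function.comp_def, e, Equiv.coe_fn_mk] using h1
  have hfib : ∀ p : ℤ, Summable fun i : ℤ => h (p + i) * w i := fun p =>
    hprod'.summable.prod_factor p
  have hV := hprod'.prod_fiberwise fun p => (hfib p).hasSum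
  obtain ⟨p, hp⟩ : ∃ p, ∑' i : ℤ, h (p + i) * w i < u p := by
    by_contra! hcon
    exact absurd (hasSum_le hcon hu hV) (not_le.2 hlt)
  exact ⟨p, fun i =>
    ((hfib p).le_tsum i fun j _ => mul_nonneg (h0 _) (hw0 j)).trans_lt hp⟩

theorem exists_dominating_index {u h : ℤ → ℝ} (h0 : ∀ j, 0 ≤ h j) {S H : ℝ} (hu : HasSum u S)
    (hh : HasSum h H) (hlt : H * (∑' i : ℤ, (1 / 2 : ℝ) ^ i.natAbs) < S) :
    ∃ p : ℤ, ∀ i : ℤ, h (p + i) < 2 ^ i.natAbs * u p := by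
  obtain ⟨p, hp⟩ := exists_sum_translates_lt (w := fun i : ℤ => (1 / 2 : ℝ) ^ i.natAbs) h0
    (fun i => pow_nonneg one_half_pos.le _) hu hh summable_half_pow_natAbs.hasSum hlt
  refine ⟨p, fun i => ?_⟩
  have h1 := hp i
  rw [one_div, inv_pow, ← div_eq_mul_inv, div_lt_iff₀ (by positivity)] at h1
  linarith

end Domination

/-! ### Nearly extremal orbits seen from a dominating site -/

section Extremal

variable {Y Z : Type*} [NormedAddCommGroup Y] [NormedSpace ℂ Y] [NormedAddCommGroup Z]
    [NormedSpace ℂ Z]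

/-- A normalised orbit `G 0, G 1, …` of the inverse of a tridiagonal operator, starting from an
approximately extremal vector. -/
structure IsNearExtremal (K C r ε : ℝ) (N : ℕ) (G : ℕ → ℤ → Z) (φ : ℤ → StrongDual ℂ Z)
    (p q s : ℤ → Z →L[ℂ] Z) : Prop where
  recurrence : ∀ k j, (r : ℂ) • G k j
    = p j (G (k + 1) (j - 1)) + q j (G (k + 1) j) + s j (G (k + 1) (j + 1))
  norm_p : ∀ j, ‖p j‖ ≤ K
  norm_q : ∀ j, ‖q j‖ ≤ K
  norm_s : ∀ j, ‖s j‖ ≤ K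
  norm_zero : ‖G 0 0‖ = 1
  norm_le : ∀ j, ‖G 0 j‖ ^ 2 ≤ C * 2 ^ j.natAbs
  norm_orbit : ∀ k < N, ∀ j, ‖G k j‖ ^ 2 ≤ ‖G 0 j‖ ^ 2 + ε * 2 ^ j.natAbs
  norm_dual : ∀ j, ‖φ j‖ ≤ 1
  dual_self : ∀ j, φ j (G 0 j) = ‖G 0 j‖
  dual_orbit : ∀ k, 1 ≤ k → k < N → ∀ j, ‖φ j (G k j)‖ ^ 2 ≤ ε * 2 ^ j.natAbs

/-- Scalar Parseval for φ of the polynomial. When φ norms a 0 and the mean square is close to ‖a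
0‖², it follows that φ nearly annihilates the other coefficients. -/
theorem sq_norm_add_sq_norm_le_rootMean {N : ℕ} (a : ℕ → Z) (φ : StrongDual ℂ Z) (hφ : ‖φ‖ ≤ 1)
    {k : ℕ} (hk : 1 ≤ k) (hkN : k < N) : ‖φ (a 0)‖ ^ 2 + ‖φ (a k)‖ ^ 2 ≤ rootMean N a := by
  have hN : (0 : ℝ) < N := by exact_mod_cast (by omega : 0 < N)
  have h1 := parseval_roots (by omega) (Complex.isPrimitiveRoot_exp N (by omega))
    (fun l => φ (a l))
  have h2 : ‖φ (a 0)‖ ^ 2 + ‖φ (a k)‖ ^ 2 ≤ ∑ l ∈ Finset.range N, ‖φ (a l)‖ ^ 2 := by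
    rw [← Finset.sum_pair (f := fun l => ‖φ (a l)‖ ^ 2) (by omega : (0 : ℕ) ≠ k)]
    refine Finset.sum_le_sum_of_subset_of_nonneg ?_ fun _ _ _ => by positivity
    intro l hl
    simp only [Finset.mem_insert, Finset.mem_singleton] at hl
    rw [Finset.mem_range]
    omega
  refine h2.trans ?_
  rw [← h1]
  unfold rootMean
  gcongr with i _
  simp_rw [← map_smul, ← map_sum]
  exact (φ.le_opNorm _).trans (mul_le_of_le_one_left (norm_nonneg _) hφ)

/-- The vector y may be spread thinly, so the orbit is recentred at a site where the component of y
is not negligible against its neighbours, with losses growing only like 2^|j|, and is normalised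
there. The δ obtained depends only on the constants, not on the operator. -/
theorem exists_isNearExtremal {T : ℤ → Y →L[ℂ] Z} (hT : IsL2Coord T) {σ r : ℝ} (hσ : 0 < σ)
    (hr : 0 < r) (hrσ : 2 * r ≤ σ) (K : ℝ) {ε : ℝ} (hε : 0 < ε) (N₀ : ℕ) :
    ∃ δ : ℝ, 0 < δ ∧ ∀ A B : Y →L[ℂ] Y, (∀ y, A (B y) = y) → ∀ p q s : ℤ → Z →L[ℂ] Z,
      (∀ j, ‖p j‖ ≤ K) → (∀ j, ‖q j‖ ≤ K) → (∀ j, ‖s j‖ ≤ K) →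
      (∀ j y, T j (A y) = p j (T (j - 1) y) + q j (T j y) + s j (T (j + 1) y)) →
      (∀ μ : ℂ, ‖μ‖ ≤ r → ∀ y, σ * ‖y‖ ≤ ‖A y - μ • y‖) →
      ∀ y, ‖A y‖ < (σ + δ) * ‖y‖ →
      ∃ (N : ℕ) (G : ℕ → ℤ → Z) (φ : ℤ → StrongDual ℂ Z) (p' q' s' : ℤ → Z →L[ℂ] Z), N₀ ≤ N ∧
        IsNearExtremal K (4 * ∑' i : ℤ, (1 / 2 : ℝ) ^ i.natAbs) r ε N G φ p' q' s' := by
  set W := ∑' i : ℤ, (1 / 2 : ℝ) ^ i.natAbs with hW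
  have hW1 : 0 < W := by
    have := summable_half_pow_natAbs.le_tsum (0 : ℤ) fun _ _ => by positivity
    simp only [Int.natAbs_zero, pow_zero] at this
    linarith
  obtain ⟨τ, hτ, hτ1, hτ2⟩ : ∃ τ : ℝ, 0 < τ ∧ τ ≤ 1 ∧ τ * W ≤ ε / 4 := by
    refine ⟨min 1 (ε / 4 / W), by positivity, min_le_left _ _, ?_⟩
    calc _ ≤ ε / 4 / W * W := by
          gcongr
          exact min_le_right _ _
      _ = ε / 4 := by field_simp
  obtain ⟨N₁, hN₁⟩ := exists_pow_lt_of_lt_one (by positivity : 0 < τ / 8)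
    (by norm_num : (1 / 2 : ℝ) < 1)
  set N := N₀ + N₁ + 2 with hN
  have hNτ : (1 / 2 : ℝ) ^ N ≤ τ / 8 :=
    (pow_le_pow_of_le_one (by norm_num) (by norm_num) (by omega)).trans hN₁.le
  refine ⟨σ * (τ / 8), by positivity, fun A B hAB p q s hp hq hs htri hlow y hy => ?_⟩
  have hy0 : y ≠ 0 := by
    rintro rfl
    simp at hy
  have hyn : 0 < ‖y‖ := norm_pos_iff.2 hy0
  set m := ‖y‖ ^ 2 with hm
  have hm0 : 0 < m := by positivity
  obtain ⟨S, hS, hsum⟩ := exists_hasSum_rootMean hT hAB hσ hr.le hrσ (κ := τ / 8)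
    hlow (y := y) (by rw [mul_one_add]; exact hy.le) (N := N) (by omega)
  set a : ℤ → ℕ → Z := fun j l => T j ((r : ℂ) ^ l • (B ^ l) y) with ha
  have hSτ : S - m ≤ τ * m := by
    have h1 : (1 + τ / 8 + (1 / 2) ^ N) ^ 2 ≤ (1 + τ / 4) ^ 2 := by
      refine pow_le_pow_left₀ (by positivity) ?_ 2
      linarith
    have h2 : (1 + τ / 4) ^ 2 ≤ 1 + τ := by nlinarith
    have h3 := mul_le_mul_of_nonneg_right (h1.trans h2) hm0.le
    linarith
  have hc : HasSum (fun j => ‖a j 0‖ ^ 2) m := by simpa [ha] using hT y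
  have he : HasSum (fun j => rootMean N (a j) - ‖a j 0‖ ^ 2) (S - m) := hsum.sub hc
  have he0 : ∀ j, 0 ≤ rootMean N (a j) - ‖a j 0‖ ^ 2 := fun j =>
    sub_nonneg.2 (sq_norm_le_rootMean (a j) (by omega))
  -- After multiplication by W the two parts total at most m/4 each, hence less than m. One site P
  -- therefore dominates the sizes (whence the constant 4W) and the excesses (whence ε) at once.
  have hh := (hc.div_const (4 * W)).add (he.div_const ε)
  obtain ⟨P, hP⟩ := exists_dominating_index (fun j => by have := he0 j; positivity) hc hh (by
    have h1 : (m / (4 * W) + (S - m) / ε) * W = m / 4 + (S - m) * W / ε := by field_simp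
    rw [← hW, h1]
    have h2 : (S - m) * W / ε ≤ m / 4 := by
      rw [div_le_iff₀ hε]
      calc (S - m) * W ≤ τ * m * W := by gcongr
        _ = (τ * W) * m := by ring
        _ ≤ ε / 4 * m := by gcongr
        _ = _ := by ring
    linarith)
  have hu0 : 0 < ‖a P 0‖ := by
    have h1 := hP 0
    simp only [add_zero, Int.natAbs_zero, pow_zero, one_mul] at h1
    have h2 : 0 ≤ ‖a P 0‖ ^ 2 / (4 * W) + (rootMean N (a P) - ‖a P 0‖ ^ 2) / ε := by
      have := he0 P
      positivity
    by_contra! h3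
    have h4 : ‖a P 0‖ = 0 := le_antisymm h3 (norm_nonneg _)
    rw [h4] at h1 h2
    norm_num at h1 h2
    linarith
  set c := ‖a P 0‖ with hcdef
  have hsm : ∀ x : Z, ‖(c⁻¹ : ℂ) • x‖ ^ 2 = ‖x‖ ^ 2 / c ^ 2 := fun x => by
    rw [norm_smul, norm_inv, Complex.norm_real, Real.norm_of_nonneg hu0.le, mul_pow, inv_pow]
    ring
  choose ψ hψ1 hψ using fun j => exists_dual_vector'' ℂ (a (P + j) 0)
  have hu : ∀ j, ‖a (P + j) 0‖ ^ 2 ≤ 4 * W * 2 ^ j.natAbs * c ^ 2 := fun j => by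
    have h1 := hP j
    have h2 : 0 ≤ (rootMean N (a (P + j)) - ‖a (P + j) 0‖ ^ 2) / ε := by
      have := he0 (P + j)
      positivity
    have h3 : ‖a (P + j) 0‖ ^ 2 / (4 * W) ≤ 2 ^ j.natAbs * c ^ 2 := by linarith
    rw [div_le_iff₀ (by positivity)] at h3
    linarith
  have heb : ∀ j, rootMean N (a (P + j)) - ‖a (P + j) 0‖ ^ 2 ≤ ε * 2 ^ j.natAbs * c ^ 2 :=
    fun j => by
      have h1 := hP j
      have h2 : 0 ≤ ‖a (P + j) 0‖ ^ 2 / (4 * W) := by positivity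
      have h3 : (rootMean N (a (P + j)) - ‖a (P + j) 0‖ ^ 2) / ε ≤ 2 ^ j.natAbs * c ^ 2 := by
        linarith
      rw [div_le_iff₀ hε] at h3
      linarith
  refine ⟨N, fun k j => (c⁻¹ : ℂ) • a (P + j) k, ψ, fun j => p (P + j), fun j => q (P + j),
    fun j => s (P + j), by omega, ⟨?_, fun j => hp _, fun j => hq _, fun j => hs _, ?_, ?_, ?_,
    hψ1, ?_, ?_⟩⟩
  · intro k j
    have h1 : (r : ℂ) • a (P + j) k = T (P + j) (A ((r : ℂ) ^ (k + 1) • (B ^ (k + 1)) y)) := by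
      rw [map_smul A, pow_succ' B, mul_apply_eq_comp, hAB, pow_succ', mul_smul, map_smul]
    rw [smul_comm, h1, htri]
    simp only [map_smul, smul_add, ha, ← add_sub_assoc, ← add_assoc]
  · have h1 := hsm (a (P + 0) 0)
    rw [add_zero, ← hcdef, div_self (by positivity)] at h1
    rw [add_zero]
    exact (pow_eq_one_iff_of_nonneg (norm_nonneg _) two_ne_zero).1 h1
  · intro j
    rw [hsm, div_le_iff₀ (by positivity)]
    exact hu j
  · intro k hk j
    rw [hsm, hsm, div_add' _ _ _ (by positivity)]
    gcongr
    have h1 := sq_norm_le_rootMean (a (P + j)) hk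
    have h2 := heb j
    linarith
  · intro j
    rw [map_smul, hψ, norm_smul, norm_inv, Complex.norm_real, Real.norm_of_nonneg hu0.le]
    simp
  · intro k hk hkN j
    have h0 : ‖ψ j ((c⁻¹ : ℂ) • a (P + j) k)‖ ^ 2 = ‖ψ j (a (P + j) k)‖ ^ 2 / c ^ 2 := by
      rw [map_smul, norm_smul, norm_inv, Complex.norm_real, Real.norm_of_nonneg hu0.le, mul_pow,
        inv_pow]
      ring
    rw [h0, div_le_iff₀ (by positivity)]
    have h1 := sq_norm_add_sq_norm_le_rootMean (a (P + j)) (ψ j) (hψ1 j) hk hkN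
    have h2 := heb j
    rw [hψ] at h1
    simp only [Complex.coe_algebraMap, Complex.norm_real, norm_norm] at h1
    linarith

end Extremal

/-! ### Exactly extremal orbits in finite dimensions -/

section FiniteDimensionalCoordinates

theorem exists_tendsto_hyperfilter {V : Type*} [NormedAddCommGroup V] [NormedSpace ℂ V]
    [FiniteDimensional ℂ V] {x : ℕ → V} {R : ℝ} (hx : ∀ᶠ n in atTop, ‖x n‖ ≤ R) :
    ∃ l, Tendsto x (hyperfilter ℕ : Filter ℕ) (𝓝 l) := by
  have : ProperSpace V := FiniteDimensional.proper ℂ V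
  have h1 : ∀ᶠ n in (hyperfilter ℕ : Filter ℕ), x n ∈ Metric.closedBall (0 : V) R :=
    (Eventually.filter_mono Nat.hyperfilter_le_atTop hx).mono fun n hn => by simpa using hn
  obtain ⟨l, -, hl⟩ := (isCompact_closedBall (0 : V) R).ultrafilter_le_nhds
    ((hyperfilter ℕ).map x) (le_principal_iff.2 h1)
  exact ⟨l, hl⟩

theorem tendsto_apply_of_tendsto {V W : Type*} [NormedAddCommGroup V] [NormedSpace ℂ V]
    [NormedAddCommGroup W] [NormedSpace ℂ W] {l : Filter ℕ} {f : ℕ → V →L[ℂ] W} {x : ℕ → V}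
    {f' : V →L[ℂ] W} {x' : V} (hf : Tendsto f l (𝓝 f')) (hx : Tendsto x l (𝓝 x')) :
    Tendsto (fun n => f n (x n)) l (𝓝 (f' x')) :=
  (isBoundedBilinearMap_apply.continuous.tendsto (f', x')).comp (hf.prodMk_nhds hx)

variable {Y Z : Type*} [NormedAddCommGroup Y] [NormedSpace ℂ Y] [NormedAddCommGroup Z]
    [NormedSpace ℂ Z]

/-- A normalised orbit of the inverse of a tridiagonal operator, starting from an extremal
vector. -/
structure IsExtremal (r : ℝ) (G : ℕ → ℤ → Z) (φ : ℤ → StrongDual ℂ Z)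
    (p q s : ℤ → Z →L[ℂ] Z) : Prop where
  recurrence : ∀ k j, (r : ℂ) • G k j
    = p j (G (k + 1) (j - 1)) + q j (G (k + 1) j) + s j (G (k + 1) (j + 1))
  norm_zero : ‖G 0 0‖ = 1
  norm_orbit : ∀ k j, ‖G k j‖ ≤ ‖G 0 j‖
  dual_self : ∀ j, φ j (G 0 j) = ‖G 0 j‖
  dual_orbit : ∀ k, 1 ≤ k → ∀ j, φ j (G k j) = 0

/-- At each site all data are bounded independently of n, so limits along one ultrafilter exist for
everything simultaneously and the errors disappear. -/
theorem exists_isExtremal [FiniteDimensional ℂ Z] {K C r : ℝ}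
    (h : ∀ n : ℕ, ∃ (N : ℕ) (G : ℕ → ℤ → Z) (φ : ℤ → StrongDual ℂ Z) (p q s : ℤ → Z →L[ℂ] Z),
      n ≤ N ∧ IsNearExtremal K C r (1 / (n + 1)) N G φ p q s) :
    ∃ (G : ℕ → ℤ → Z) (φ : ℤ → StrongDual ℂ Z) (p q s : ℤ → Z →L[ℂ] Z),
      IsExtremal r G φ p q s := by
  choose N G φ p q s hN hE using h
  have hlt : ∀ k : ℕ, ∀ᶠ n in atTop, k < N n := fun k =>
    (eventually_gt_atTop k).mono fun n hn => hn.trans_le (hN n)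
  have hε : ∀ n : ℕ, (1 / ((n : ℝ) + 1)) ≤ 1 := fun n => by
    rw [div_le_one (by positivity)]
    linarith [(Nat.cast_nonneg n : (0 : ℝ) ≤ n)]
  have hεlim : Tendsto (fun n : ℕ => (1 / ((n : ℝ) + 1))) (hyperfilter ℕ : Filter ℕ) (𝓝 0) :=
    tendsto_one_div_add_atTop_nhds_zero_nat.mono_left Nat.hyperfilter_le_atTop
  have hGb : ∀ k j, ∀ᶠ n in atTop, ‖G n k j‖ ≤ √((C + 1) * 2 ^ j.natAbs) := fun k j => by
    filter_upwards [hlt k] with n hn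
    refine Real.le_sqrt_of_sq_le (((hE n).norm_orbit k hn j).trans ?_)
    have h1 := (hE n).norm_le j
    have h2 : 1 / ((n : ℝ) + 1) * 2 ^ j.natAbs ≤ 1 * 2 ^ j.natAbs := by
      gcongr
      exact hε n
    linarith
  choose G' hG' using fun k j => exists_tendsto_hyperfilter (hGb k j)
  choose φ' hφ' using fun j => exists_tendsto_hyperfilter (x := fun n => φ n j)
    (Eventually.of_forall fun n => (hE n).norm_dual j)
  choose p' hp' using fun j => exists_tendsto_hyperfilter (x := fun n => p n j)
    (Eventually.of_forall fun n => (hE n).norm_p j)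
  choose q' hq' using fun j => exists_tendsto_hyperfilter (x := fun n => q n j)
    (Eventually.of_forall fun n => (hE n).norm_q j)
  choose s' hs' using fun j => exists_tendsto_hyperfilter (x := fun n => s n j)
    (Eventually.of_forall fun n => (hE n).norm_s j)
  have hεj : ∀ j : ℤ, Tendsto (fun n : ℕ => (1 / ((n : ℝ) + 1)) * 2 ^ j.natAbs)
      (hyperfilter ℕ : Filter ℕ) (𝓝 0) := fun j => by
    simpa using hεlim.mul_const ((2 : ℝ) ^ j.natAbs)
  refine ⟨G', φ', p', q', s', ⟨fun k j => ?_, ?_, fun k j => ?_, fun j => ?_, fun k hk j => ?_⟩⟩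
  · refine tendsto_nhds_unique ((hG' k j).const_smul (r : ℂ)) ?_
    refine Tendsto.congr (fun n => ((hE n).recurrence k j).symm) ?_
    exact ((tendsto_apply_of_tendsto (hp' j) (hG' _ _)).add (tendsto_apply_of_tendsto (hq' j) (hG' _ _))).add
      (tendsto_apply_of_tendsto (hs' j) (hG' _ _))
  · refine tendsto_nhds_unique (hG' 0 0).norm ?_
    exact Tendsto.congr (fun n => ((hE n).norm_zero).symm) tendsto_const_nhds
  · have h1 : ‖G' k j‖ ^ 2 ≤ ‖G' 0 j‖ ^ 2 + 0 := by
      refine le_of_tendsto_of_tendsto ((hG' k j).norm.pow 2) (((hG' 0 j).norm.pow 2).add (hεj j)) ?_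
      exact (Eventually.filter_mono Nat.hyperfilter_le_atTop (hlt k)).mono fun n hn => (hE n).norm_orbit k hn j
    rw [add_zero] at h1
    exact (sq_le_sq₀ (norm_nonneg _) (norm_nonneg _)).1 h1
  · refine tendsto_nhds_unique (tendsto_apply_of_tendsto (hφ' j) (hG' 0 j)) ?_
    refine Tendsto.congr (fun n => ((hE n).dual_self j).symm) ?_
    exact (Complex.continuous_ofReal.tendsto _).comp (hG' 0 j).norm
  · have h1 : ‖φ' j (G' k j)‖ ^ 2 ≤ 0 := by
      refine le_of_tendsto_of_tendsto ((tendsto_apply_of_tendsto (hφ' j) (hG' k j)).norm.pow 2) (hεj j) ?_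
      exact (Eventually.filter_mono Nat.hyperfilter_le_atTop (hlt k)).mono fun n hn => (hE n).dual_orbit k hk hn j
    have h2 : ‖φ' j (G' k j)‖ = 0 := by
      by_contra h3
      have : 0 < ‖φ' j (G' k j)‖ ^ 2 := by positivity
      linarith
    exact norm_eq_zero.1 h2

/-- The sequences `k ↦ ψ (G k j)` for functionals `ψ` on `Z`. -/
noncomputable def orbitFunctionals (G : ℕ → ℤ → Z) (j : ℤ) : StrongDual ℂ Z →ₗ[ℂ] (ℕ → ℂ) where
  toFun ψ k := ψ (G k j)
  map_add' _ _ := rfl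
  map_smul' _ _ := rfl

/-- The ranges of `orbitFunctionals` have dimension at most that of the dual of Z. A rescaled
norming functional yields the zeroth unit sequence wherever G 0 j ≠ 0, elsewhere the whole orbit
vanishes, and the recurrence expresses shifted sequences through neighbouring sites. -/
theorem not_isExtremal [FiniteDimensional ℂ Z] {r : ℝ} (hr : r ≠ 0) {G : ℕ → ℤ → Z}
    {φ : ℤ → StrongDual ℂ Z} {p q s : ℤ → Z →L[ℂ] Z} : ¬ IsExtremal r G φ p q s := by
  intro h
  have hr' : (r : ℂ) ≠ 0 := by exact_mod_cast hr
  refine not_shift_invariant_int (F := fun j => (orbitFunctionals G j).range)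
    (m := Module.finrank ℂ (StrongDual ℂ Z)) (fun j => LinearMap.finrank_range_le _)
    (S := {j | G 0 j ≠ 0}) (fun j hj => ?_) (fun j hj => ?_) ?_ fun j => ?_
  · have hj' : (‖G 0 j‖ : ℂ) ≠ 0 := by
      have : G 0 j ≠ 0 := hj
      simpa using this
    refine ⟨(‖G 0 j‖ : ℂ)⁻¹ • φ j, ?_⟩
    ext k
    cases k with
    | zero => simp [orbitFunctionals, h.dual_self, hj']
    | succ k => simp [orbitFunctionals, h.dual_orbit (k + 1) (by omega) j]
  · have h0 : G 0 j = 0 := by simpa using hj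
    have h1 : ∀ k, G k j = 0 := fun k => by
      have := h.norm_orbit k j
      rw [h0, norm_zero] at this
      exact norm_le_zero_iff.1 this
    rw [LinearMap.range_eq_bot]
    ext ψ k
    simp [orbitFunctionals, h1]
  · have := h.norm_zero
    intro h0
    rw [h0, norm_zero] at this
    exact zero_ne_one this
  · rintro _ ⟨_, ⟨ψ, rfl⟩, rfl⟩
    have key : rightShift (orbitFunctionals G j ψ)
        = orbitFunctionals G (j - 1) ((r : ℂ)⁻¹ • ψ.comp (p j))
          + orbitFunctionals G j ((r : ℂ)⁻¹ • ψ.comp (q j))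
          + orbitFunctionals G (j + 1) ((r : ℂ)⁻¹ • ψ.comp (s j))
          + (-((r : ℂ)⁻¹ * ψ (p j (G 0 (j - 1)) + q j (G 0 j) + s j (G 0 (j + 1)))))
            • (Pi.single 0 1 : ℕ → ℂ) := by
      ext k
      cases k with
      | zero => simp [orbitFunctionals, mul_add]
      | succ k =>
        have h1 := congrArg ψ (h.recurrence k j)
        simp only [map_smul, map_add, smul_eq_mul] at h1
        simp only [rightShift_succ, orbitFunctionals, LinearMap.coe_mk, AddHom.coe_mk,
          Pi.add_apply, Pi.smul_apply, smul_eq_mul, _root_.smul_apply,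
          ContinuousLinearMap.comp_apply]
        rw [← mul_add, ← mul_add, ← h1]
        simp [hr']
    rw [key]
    refine Submodule.add_mem_sup (Submodule.add_mem_sup (Submodule.add_mem_sup ?_ ?_) ?_) ?_
    · exact ⟨_, rfl⟩
    · exact ⟨_, rfl⟩
    · exact ⟨_, rfl⟩
    · exact Submodule.smul_mem _ _ (Submodule.mem_span_singleton_self _)

/-- The analogue of `ComplexUniformlyConvex.exists_improved_lower_bound` for tridiagonal operators
on an `ℓ²`-sum of copies of a finite-dimensional space. -/
theorem exists_improved_lower_bound_of_finiteDimensional [FiniteDimensional ℂ Z]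
    {T : ℤ → Y →L[ℂ] Z} (hT : IsL2Coord T) {σ r : ℝ} (hσ : 0 < σ) (hr : 0 < r) (K : ℝ) :
    ∃ δ : ℝ, 0 < δ ∧ ∀ A B : Y →L[ℂ] Y, (∀ y, A (B y) = y) → ∀ p q s : ℤ → Z →L[ℂ] Z,
      (∀ j, ‖p j‖ ≤ K) → (∀ j, ‖q j‖ ≤ K) → (∀ j, ‖s j‖ ≤ K) →
      (∀ j y, T j (A y) = p j (T (j - 1) y) + q j (T j y) + s j (T (j + 1) y)) →
      (∀ μ : ℂ, ‖μ‖ ≤ r → ∀ y, σ * ‖y‖ ≤ ‖A y - μ • y‖) → ∀ y, (σ + δ) * ‖y‖ ≤ ‖A y‖ := by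
  wlog hrσ : 2 * r ≤ σ generalizing r
  · obtain ⟨δ, hδ, h⟩ := this (r := σ / 2) (by positivity) (by linarith)
    exact ⟨δ, hδ, fun A B hAB p q s hp hq hs htri hlow =>
      h A B hAB p q s hp hq hs htri fun μ hμ => hlow μ (by linarith)⟩
  by_contra! hcon
  obtain ⟨G, φ, p, q, s, h⟩ := exists_isExtremal (Z := Z) (K := K)
    (C := 4 * ∑' i : ℤ, (1 / 2 : ℝ) ^ i.natAbs) (r := r) fun n => by
      obtain ⟨δ, hδ, h⟩ := exists_isNearExtremal hT hσ hr hrσ K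
        (by positivity : 0 < 1 / ((n : ℝ) + 1)) n
      obtain ⟨A, B, hAB, p, q, s, hp, hq, hs, htri, hlow, y, hy⟩ := hcon δ hδ
      exact h A B hAB p q s hp hq hs htri hlow y hy
  exact not_isExtremal hr.ne' h

end FiniteDimensionalCoordinates

/-! ### Globevnik's theorem for tridiagonal operators and for operators on X^n -/

section Globevnik

variable {J Y Z : Type*} [NormedAddCommGroup Y] [NormedSpace ℂ Y] [NormedAddCommGroup Z]
    [NormedSpace ℂ Z]

theorem sub_smul_id_apply (A : Y →L[ℂ] Y) (μ : ℂ) (y : Y) :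
    (A - μ • ContinuousLinearMap.id ℂ Y) y = A y - μ • y := by
  simp

/-- When only the dual of Z is convex, the improvement is carried out for the transposes of A and
A⁻¹ on the dual of Y, an ℓ²-sum of copies of the dual of Z. -/
theorem le_recipNormInv_of_complexUniformlyConvex [Nontrivial Y]
    (hZ : ComplexUniformlyConvex Z ∨ ComplexUniformlyConvex (StrongDual ℂ Z))
    {T : J → Y →L[ℂ] Z} {ι : J → Z →L[ℂ] Y} (hT : IsL2Decomposition T ι) {σ r : ℝ} (hσ : 0 < σ)
    (hr : 0 < r) (K : ℝ) :
    ∃ δ : ℝ, 0 < δ ∧ ∀ A : Y →L[ℂ] Y, ‖A‖ ≤ K →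
      (∀ μ : ℂ, ‖μ‖ ≤ r → σ ≤ recipNormInv (A - μ • ContinuousLinearMap.id ℂ Y)) →
      σ + δ ≤ recipNormInv A := by
  rcases hZ with hZ | hZ
  · obtain ⟨δ, hδ, h⟩ := hZ.exists_improved_lower_bound hT.coord hσ hr K
    refine ⟨δ, hδ, fun A hA hlow => ?_⟩
    have hu : IsUnit A := by
      have := hlow 0 (by simpa using hr.le)
      rw [zero_smul, sub_zero] at this
      exact isUnit_of_recipNormInv_pos (hσ.trans_le this)
    refine (le_recipNormInv_iff (by positivity) A).2 ⟨hu, ?_⟩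
    refine h A (Ring.inverse A) (apply_inverse_self hu) hA fun μ hμ y => ?_
    rw [← sub_smul_id_apply]
    exact ((le_recipNormInv_iff hσ _).1 (hlow μ hμ)).2 y
  · obtain ⟨δ, hδ, h⟩ := hZ.exists_improved_lower_bound hT.dual_coord hσ hr K
    refine ⟨δ, hδ, fun A hA hlow => ?_⟩
    have hu : IsUnit A := by
      have := hlow 0 (by simpa using hr.le)
      rw [zero_smul, sub_zero] at this
      exact isUnit_of_recipNormInv_pos (hσ.trans_le this)
    by_contra! hcon
    obtain ⟨φ, hφ⟩ := exists_dual_lt_of_isUnit hu hcon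
    have h1 := h ((ContinuousLinearMap.compL ℂ Y Y ℂ).flip A)
      ((ContinuousLinearMap.compL ℂ Y Y ℂ).flip (Ring.inverse A)) (fun ψ => ?_) ?_
      (fun μ hμ ψ => ?_) φ
    · exact absurd h1 (not_le.2 hφ)
    · ext y
      simp [inverse_apply_self hu]
    · refine le_trans (ContinuousLinearMap.opNorm_le_bound _ (norm_nonneg A) fun ψ => ?_) hA
      rw [mul_comm]
      exact ψ.opNorm_comp_le A
    · have h2 := mul_norm_le_norm_comp hσ (hlow μ hμ) ψ
      have h3 : ψ.comp (A - μ • ContinuousLinearMap.id ℂ Y)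
          = (ContinuousLinearMap.compL ℂ Y Y ℂ).flip A ψ - μ • ψ := by
        ext y
        simp
      rwa [h3] at h2

theorem le_recipNormInv_of_finiteDimensional [Nontrivial Y] [FiniteDimensional ℂ Z]
    {T : ℤ → Y →L[ℂ] Z} (hT : IsL2Coord T) {σ r : ℝ} (hσ : 0 < σ) (hr : 0 < r) (K : ℝ) :
    ∃ δ : ℝ, 0 < δ ∧ ∀ A : Y →L[ℂ] Y, ∀ p q s : ℤ → Z →L[ℂ] Z,
      (∀ j, ‖p j‖ ≤ K) → (∀ j, ‖q j‖ ≤ K) → (∀ j, ‖s j‖ ≤ K) →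
      (∀ j y, T j (A y) = p j (T (j - 1) y) + q j (T j y) + s j (T (j + 1) y)) →
      (∀ μ : ℂ, ‖μ‖ ≤ r → σ ≤ recipNormInv (A - μ • ContinuousLinearMap.id ℂ Y)) →
      σ + δ ≤ recipNormInv A := by
  obtain ⟨δ, hδ, h⟩ := exists_improved_lower_bound_of_finiteDimensional hT hσ hr K
  refine ⟨δ, hδ, fun A p q s hp hq hs htri hlow => ?_⟩
  have hu : IsUnit A := by
    have := hlow 0 (by simpa using hr.le)
    rw [zero_smul, sub_zero] at this
    exact isUnit_of_recipNormInv_pos (hσ.trans_le this)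
  refine (le_recipNormInv_iff (by positivity) A).2 ⟨hu, ?_⟩
  refine h A (Ring.inverse A) (apply_inverse_self hu) p q s hp hq hs htri fun μ hμ y => ?_
  rw [← sub_smul_id_apply]
  exact ((le_recipNormInv_iff hσ _).1 (hlow μ hμ)).2 y

variable {X : Type*} [NormedAddCommGroup X] [NormedSpace ℂ X]

theorem IsTridiagonal.apply_eq {A : EllTwo X →L[ℂ] EllTwo X} (hA : IsTridiagonal A) (x : EllTwo X)
    (j : ℤ) : A x j = matrixEntry A j (j - 1) (x (j - 1)) + matrixEntry A j j (x j)
      + matrixEntry A j (j + 1) (x (j + 1)) := by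
  have h1 : HasSum (fun i => matrixEntry A j i (x i)) (A x j) :=
    (isL2Decomposition_ellTwo.hasSum x).mapL ((lp.evalCLM ℂ (fun _ : ℤ => X) 2 j).comp A)
  have h2 : HasSum (fun i => matrixEntry A j i (x i))
      (∑ i ∈ {j - 1, j, j + 1}, matrixEntry A j i (x i)) := by
    refine hasSum_sum_of_ne_finset_zero fun i hi => ?_
    simp only [Finset.mem_insert, Finset.mem_singleton, not_or] at hi
    rw [hA j i (by rw [lt_abs]; omega)]
    rfl
  rw [h1.unique h2, Finset.sum_insert (by simp; omega), Finset.sum_insert (by simp),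
    Finset.sum_singleton, add_assoc]

theorem IsTridiagonal.dual_apply_eq {A : EllTwo X →L[ℂ] EllTwo X} (hA : IsTridiagonal A)
    (φ : StrongDual ℂ (EllTwo X)) (j : ℤ) :
    (φ.comp A).comp (lp.singleContinuousLinearMap ℂ (fun _ : ℤ => X) 2 j)
      = (φ.comp (lp.singleContinuousLinearMap ℂ (fun _ : ℤ => X) 2 (j - 1))).comp
          (matrixEntry A (j - 1) j)
        + (φ.comp (lp.singleContinuousLinearMap ℂ (fun _ : ℤ => X) 2 j)).comp (matrixEntry A j j)
        + (φ.comp (lp.singleContinuousLinearMap ℂ (fun _ : ℤ => X) 2 (j + 1))).comp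
          (matrixEntry A (j + 1) j) := by
  ext z
  set ι := fun j : ℤ => lp.singleContinuousLinearMap ℂ (fun _ : ℤ => X) 2 j
  have h1 : HasSum (fun i => φ (ι i (matrixEntry A i j z))) (φ (A (ι j z))) :=
    (isL2Decomposition_ellTwo.hasSum (A (ι j z))).mapL φ
  have h2 : HasSum (fun i => φ (ι i (matrixEntry A i j z)))
      (∑ i ∈ {j - 1, j, j + 1}, φ (ι i (matrixEntry A i j z))) := by
    refine hasSum_sum_of_ne_finset_zero fun i hi => ?_
    simp only [Finset.mem_insert, Finset.mem_singleton, not_or] at hi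
    rw [hA i j (by rw [lt_abs]; omega)]
    simp
  have h3 := h1.unique h2
  rw [Finset.sum_insert (by simp; omega), Finset.sum_insert (by simp), Finset.sum_singleton,
    ← add_assoc] at h3
  exact h3

instance [Nontrivial X] : Nontrivial (EllTwo X) := by
  obtain ⟨x, hx⟩ := exists_ne (0 : X)
  refine ⟨⟨lp.single 2 0 x, 0, fun h => hx ?_⟩⟩
  have := congrArg (fun y : EllTwo X => y 0) h
  simpa using this

theorem nontrivial_piLp [Nontrivial X] {n : ℕ} (hn : 1 ≤ n) :
    Nontrivial (PiLp 2 (fun _ : Fin n => X)) := by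
  obtain ⟨x, hx⟩ := exists_ne (0 : X)
  refine ⟨⟨piLpSingle X ⟨0, hn⟩ x, 0, fun h => hx ?_⟩⟩
  have := congrArg (fun y : PiLp 2 (fun _ : Fin n => X) => y ⟨0, hn⟩) h
  simpa [piLpSingle_apply] using this

/-- If `X` has Globevnik's property, then the resolvent norm of a tridiagonal operator on
`ℓ²(ℤ, X)` has no local minimum. -/
theorem GlobevnikProperty.lt_recipNormInv [Nontrivial X] (hX : GlobevnikProperty X)
    {A : EllTwo X →L[ℂ] EllTwo X} (hA : IsTridiagonal A) {σ r : ℝ} (hσ : 0 < σ) (hr : 0 < r) (lam : ℂ)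
    (h : ∀ μ : ℂ, ‖μ - lam‖ ≤ r → σ ≤ recipNormInv (A - μ • ContinuousLinearMap.id ℂ _)) :
    σ < recipNormInv (A - lam • ContinuousLinearMap.id ℂ _) := by
  have h' : ∀ μ : ℂ, ‖μ‖ ≤ r → σ ≤ recipNormInv (A - lam • ContinuousLinearMap.id ℂ (EllTwo X)
      - μ • ContinuousLinearMap.id ℂ (EllTwo X)) := fun μ hμ => by
    have h1 := h (lam + μ) (by simpa using hμ)
    rwa [add_smul, ← sub_sub] at h1
  rcases hX with hX | hX
  · obtain ⟨δ, hδ, h1⟩ := le_recipNormInv_of_finiteDimensional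
      (isL2Decomposition_ellTwo (X := X)).coord hσ hr (‖A‖ + ‖lam‖)
    have hK : ∀ i j, ‖matrixEntry A i j‖ ≤ ‖A‖ + ‖lam‖ := fun i j =>
      (norm_matrixEntry_le A i j).trans (by linarith [norm_nonneg lam])
    have h2 := h1 (A - lam • ContinuousLinearMap.id ℂ (EllTwo X))
      (fun j => matrixEntry A j (j - 1))
      (fun j => matrixEntry A j j - lam • ContinuousLinearMap.id ℂ X)
      (fun j => matrixEntry A j (j + 1)) (fun j => hK _ _) (fun j => ?_) (fun j => hK _ _)
      (fun j y => ?_) h'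
    · linarith
    · refine (norm_sub_le _ _).trans (add_le_add (norm_matrixEntry_le A j j) ?_)
      rw [norm_smul]
      exact mul_le_of_le_one_right (norm_nonneg _) ContinuousLinearMap.norm_id_le
    · have h3 := hA.apply_eq y j
      have h4 : (A - lam • ContinuousLinearMap.id ℂ (EllTwo X)) y j = A y j - lam • y j := by
        rw [sub_smul_id_apply]
        rfl
      change (A - lam • ContinuousLinearMap.id ℂ (EllTwo X)) y j = _
      rw [h4, h3, sub_smul_id_apply]
      change _ = matrixEntry A j (j - 1) (y (j - 1)) + (matrixEntry A j j (y j) - lam • y j)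
        + matrixEntry A j (j + 1) (y (j + 1))
      abel
  · obtain ⟨δ, hδ, h1⟩ := le_recipNormInv_of_complexUniformlyConvex hX
      (isL2Decomposition_ellTwo (X := X)) hσ hr ‖A - lam • ContinuousLinearMap.id ℂ (EllTwo X)‖
    have := h1 _ le_rfl h'
    linarith

/-- A uniform version of Globevnik's theorem for operators on `X^n`. -/
theorem GlobevnikProperty.exists_le_recipNormInv [Nontrivial X] (hX : GlobevnikProperty X) {n : ℕ}
    (hn : 1 ≤ n) {σ r : ℝ} (hσ : 0 < σ) (hr : 0 < r) (K : ℝ) :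
    ∃ δ : ℝ, 0 < δ ∧ ∀ C : PiLp 2 (fun _ : Fin n => X) →L[ℂ] PiLp 2 (fun _ : Fin n => X), ‖C‖ ≤ K →
      (∀ μ : ℂ, ‖μ‖ ≤ r → σ ≤ recipNormInv (C - μ • ContinuousLinearMap.id ℂ _)) →
      σ + δ ≤ recipNormInv C := by
  have := nontrivial_piLp (X := X) hn
  rcases hX with hX | hX
  -- For finite-dimensional X the whole space X^n is treated as a single coordinate at site 0, which
  -- makes every C tridiagonal with zero off-diagonals.
  · have hT : IsL2Coord (fun j : ℤ => if j = 0 then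
        ContinuousLinearMap.id ℂ (PiLp 2 (fun _ : Fin n => X)) else 0) := fun y => by
      have h1 := hasSum_single (0 : ℤ) (f := fun j : ℤ => ‖(if j = 0 then
        ContinuousLinearMap.id ℂ (PiLp 2 (fun _ : Fin n => X)) else 0) y‖ ^ 2)
        fun j hj => by rw [if_neg hj]; simp
      rwa [if_pos rfl] at h1
    obtain ⟨δ, hδ, h1⟩ := le_recipNormInv_of_finiteDimensional hT hσ hr (max K 0)
    refine ⟨δ, hδ, fun C hC h => h1 C 0 (fun j => if j = 0 then C else 0) 0 (by simp) (fun j => ?_)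
      (by simp) (fun j y => ?_) h⟩
    · split_ifs
      · exact hC.trans (le_max_left _ _)
      · simp
    · by_cases hj : j = 0 <;> simp [hj]
  · exact le_recipNormInv_of_complexUniformlyConvex hX isL2Decomposition_piLp hσ hr K

end Globevnik

/-! ### The discrete half sine wave -/

section SineWeights

/-- The weights `sin (π i / n)`. -/
noncomputable def sineWeight (n i : ℕ) : ℝ := Real.sin (i * (Real.pi / n))

@[simp]
theorem sineWeight_zero (n : ℕ) : sineWeight n 0 = 0 := by simp [sineWeight]

theorem sineWeight_self {n : ℕ} (hn : 0 < n) : sineWeight n n = 0 := by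
  have : (n : ℝ) * (Real.pi / n) = Real.pi := by field_simp
  rw [sineWeight, this, Real.sin_pi]

theorem sineWeight_one_pos {n : ℕ} (hn : 2 ≤ n) : 0 < sineWeight n 1 := by
  have hn' : (2 : ℝ) ≤ n := by exact_mod_cast hn
  refine Real.sin_pos_of_pos_of_lt_pi (by positivity) ?_
  rw [Nat.cast_one, one_mul]
  exact div_lt_self Real.pi_pos (by linarith)

theorem sineWeight_self_succ {n : ℕ} (hn : 0 < n) : sineWeight n (n + 1) = -sineWeight n 1 := by
  have : ((n + 1 : ℕ) : ℝ) * (Real.pi / n) = Real.pi / n + Real.pi := by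
    push_cast
    field_simp
    ring
  rw [sineWeight, this, Real.sin_add_pi, sineWeight, Nat.cast_one, one_mul]

theorem sineWeight_recurrence (n i : ℕ) :
    sineWeight n (i + 2) + sineWeight n i = 2 * Real.cos (Real.pi / n) * sineWeight n (i + 1) := by
  have h1 : ((i + 2 : ℕ) : ℝ) * (Real.pi / n)
      = ((i + 1 : ℕ) : ℝ) * (Real.pi / n) + Real.pi / n := by
    push_cast
    ring
  have h2 : (i : ℝ) * (Real.pi / n) = ((i + 1 : ℕ) : ℝ) * (Real.pi / n) - Real.pi / n := by
    push_cast
    ring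
  unfold sineWeight
  rw [h1, h2, Real.sin_add, Real.sin_sub]
  ring

theorem sum_sq_sineWeight_eq {n : ℕ} (hn : 0 < n) :
    ∑ i ∈ Finset.range n, sineWeight n i ^ 2
      = ∑ i ∈ Finset.range n, sineWeight n (i + 1) ^ 2 := by
  have h := Finset.sum_range_sub (fun i => sineWeight n i ^ 2) n
  rw [Finset.sum_sub_distrib, sineWeight_self hn, sineWeight_zero] at h
  linarith

theorem sum_sq_sineWeight_succ_eq {n : ℕ} (hn : 0 < n) :
    ∑ i ∈ Finset.range n, sineWeight n (i + 2) ^ 2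
      = ∑ i ∈ Finset.range n, sineWeight n (i + 1) ^ 2 := by
  have h := Finset.sum_range_sub (fun i => sineWeight n (i + 1) ^ 2) n
  rw [Finset.sum_sub_distrib, sineWeight_self_succ hn] at h
  simp only [zero_add, neg_sq, sub_self] at h
  linarith

theorem two_mul_sin_sq (n : ℕ) :
    (2 * Real.sin (Real.pi / (2 * n))) ^ 2 = 2 - 2 * Real.cos (Real.pi / n) := by
  have : Real.pi / n = 2 * (Real.pi / (2 * n)) := by
    rcases Nat.eq_zero_or_pos n with rfl | hn
    · simp
    · field_simp
  rw [this, Real.cos_two_mul, Real.cos_sq']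
  ring

/-- The two sums agree by telescoping, since the weights vanish at 0 and n; the three-term
recurrence determines their total. -/
theorem sum_mul_sineWeight {n : ℕ} (hn : 0 < n) :
    ∑ i ∈ Finset.range n, sineWeight n (i + 1) * sineWeight n (i + 2)
        = Real.cos (Real.pi / n) * ∑ i ∈ Finset.range n, sineWeight n (i + 1) ^ 2 ∧
      ∑ i ∈ Finset.range n, sineWeight n i * sineWeight n (i + 1)
        = Real.cos (Real.pi / n) * ∑ i ∈ Finset.range n, sineWeight n (i + 1) ^ 2 := by
  have h := Finset.sum_range_sub (fun i => sineWeight n i * sineWeight n (i + 1)) n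
  rw [Finset.sum_sub_distrib, sineWeight_self hn, sineWeight_zero] at h
  have h2 : ∑ i ∈ Finset.range n, sineWeight n (i + 1) * sineWeight n (i + 2)
      + ∑ i ∈ Finset.range n, sineWeight n i * sineWeight n (i + 1)
      = 2 * (Real.cos (Real.pi / n) * ∑ i ∈ Finset.range n, sineWeight n (i + 1) ^ 2) := by
    rw [← Finset.sum_add_distrib, Finset.mul_sum, Finset.mul_sum]
    refine Finset.sum_congr rfl fun i _ => ?_
    linear_combination sineWeight n (i + 1) * sineWeight_recurrence n i
  constructor <;> linarith

/-- The Dirichlet energy of the half wave: 2 − 2cos(π/n) is its eigenvalue. This is the origin of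
the sine in the penalty term. -/
theorem sum_sq_sub_sineWeight {n : ℕ} (hn : 0 < n) :
    ∑ i ∈ Finset.range n, (sineWeight n i - sineWeight n (i + 1)) ^ 2
      = (2 * Real.sin (Real.pi / (2 * n))) ^ 2
        * ∑ i ∈ Finset.range n, sineWeight n (i + 1) ^ 2 := by
  simp_rw [sub_sq, Finset.sum_add_distrib, Finset.sum_sub_distrib, mul_assoc, ← Finset.mul_sum]
  rw [sum_sq_sineWeight_eq hn, (sum_mul_sineWeight hn).2, two_mul_sin_sq]
  ring

theorem sum_sq_sub_sineWeight_succ {n : ℕ} (hn : 0 < n) :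
    ∑ i ∈ Finset.range n, (sineWeight n (i + 2) - sineWeight n (i + 1)) ^ 2
      = (2 * Real.sin (Real.pi / (2 * n))) ^ 2
        * ∑ i ∈ Finset.range n, sineWeight n (i + 1) ^ 2 := by
  have h : ∀ i, (sineWeight n (i + 2) - sineWeight n (i + 1)) ^ 2 = sineWeight n (i + 2) ^ 2
      - 2 * (sineWeight n (i + 1) * sineWeight n (i + 2)) + sineWeight n (i + 1) ^ 2 := fun i => by
    ring
  simp_rw [h, Finset.sum_add_distrib, Finset.sum_sub_distrib, ← Finset.mul_sum]
  rw [sum_sq_sineWeight_succ_eq hn, (sum_mul_sineWeight hn).1, two_mul_sin_sq]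
  ring

end SineWeights

/-! ### Cutting out weighted windows -/

section WeightedWindows

variable {Z : Type*} [NormedAddCommGroup Z] [NormedSpace ℂ Z]

theorem hasSum_translate {f : ℤ → ℝ} {S : ℝ} (h : HasSum f S) (i : ℤ) :
    HasSum (fun k => f (k + i)) S :=
  (Equiv.addRight i).hasSum_iff.2 h

/-- The `i`-th component of the periodised tridiagonal operator with lower, middle and upper
diagonals `al`, `be`, `ga` and corner `co`, applied to a window of `z` with sine weights. -/
noncomputable def weightedWindow (n : ℕ) (al be ga co : ℤ → Z →L[ℂ] Z) (z : ℤ → Z) (k : ℤ)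
    (i : ℕ) : Z :=
  (sineWeight n i : ℂ) • al (k + 1 + i) (z (k + i))
    + (sineWeight n (i + 1) : ℂ) • be (k + 1 + i) (z (k + 1 + i))
    + if i + 1 = n then (sineWeight n 1 : ℂ) • co k (z (k + 1))
      else (sineWeight n (i + 2) : ℂ) • ga (k + 1 + i) (z (k + 2 + i))

/-- Give all entries of a row the weight of its diagonal entry; what remains are weight differences.
In the last row that weight is zero, and the corner appears with weight sin(π/n), equal in modulus
to the difference for the missing neighbour, so periodising costs nothing extra. -/
theorem norm_weightedWindow_le {n : ℕ} {al be ga co : ℤ → Z →L[ℂ] Z} {z d : ℤ → Z}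
    {a g : ℝ} (ha : ∀ j, ‖al j‖ ≤ a) (hg : ∀ j, ‖ga j‖ ≤ g) (hco : ∀ j, ‖co j‖ ≤ g)
    (hd : ∀ j, d j = al j (z (j - 1)) + be j (z j) + ga j (z (j + 1))) (k : ℤ) {i : ℕ} :
    ‖weightedWindow n al be ga co z k i‖ ≤ |sineWeight n (i + 1)| * ‖d (k + (1 + i))‖
      + a * |sineWeight n i - sineWeight n (i + 1)| * ‖z (k + i)‖
      + g * |sineWeight n (i + 2) - sineWeight n (i + 1)|
        * ‖z (k + if i + 1 = n then (1 : ℤ) else 2 + i)‖ := by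
  have hnorm : ∀ (x : ℝ) (w : Z), ‖(x : ℂ) • w‖ = |x| * ‖w‖ := fun x w => by
    rw [norm_smul, Complex.norm_real, Real.norm_eq_abs]
  have h1 : weightedWindow n al be ga co z k i = (sineWeight n (i + 1) : ℂ) • d (k + (1 + i))
      + ((sineWeight n i - sineWeight n (i + 1) : ℝ) : ℂ) • al (k + 1 + i) (z (k + i))
      + if i + 1 = n then (sineWeight n 1 : ℂ) • co k (z (k + 1))
        else ((sineWeight n (i + 2) - sineWeight n (i + 1) : ℝ) : ℂ) •
          ga (k + 1 + i) (z (k + 2 + i)) := by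
    have e1 : k + (1 + i) - 1 = k + (i : ℤ) := by ring
    have e2 : k + (1 + i) + 1 = k + 2 + (i : ℤ) := by ring
    have e3 : k + (1 + i) = k + 1 + (i : ℤ) := by ring
    unfold weightedWindow
    rw [hd, e1, e2, e3]
    push_cast
    split_ifs with hi
    · have h0 : sineWeight n (i + 1) = 0 := by
        rw [hi]
        exact sineWeight_self (by omega)
      rw [h0]
      simp
    · simp only [smul_add, sub_smul]
      abel
  rw [h1]
  refine (norm_add₃_le).trans (add_le_add (add_le_add (hnorm _ _).le ?_) ?_)
  · rw [hnorm, mul_comm a, mul_assoc]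
    gcongr
    exact ((al _).le_opNorm _).trans (by gcongr; exact ha _)
  · split_ifs with hi
    · have hi' : i + 2 = n + 1 := by omega
      rw [hnorm, hi', hi, sineWeight_self_succ (by omega), sineWeight_self (by omega), sub_zero,
        abs_neg, mul_comm g, mul_assoc]
      gcongr
      exact ((co _).le_opNorm _).trans (by gcongr; exact hco _)
    · rw [hnorm, mul_comm g, mul_assoc, ← add_assoc]
      gcongr
      exact ((ga _).le_opNorm _).trans (by gcongr; exact hg _)

/-- Cauchy–Schwarz with free weights. With P, Q, R close to the sizes of the three summands it is as
sharp as the triangle inequality, yet can be summed over windows. -/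
theorem sq_add_add_le {P Q R : ℝ} (hP : 0 < P) (hQ : 0 < Q) (hR : 0 < R) (x y w : ℝ) :
    (x + y + w) ^ 2 ≤ (P + Q + R) * (x ^ 2 / P + y ^ 2 / Q + w ^ 2 / R) := by
  have h1 : (P + Q + R) * (x ^ 2 / P + y ^ 2 / Q + w ^ 2 / R) - (x + y + w) ^ 2
      = (Q * x - P * y) ^ 2 / (P * Q) + (R * x - P * w) ^ 2 / (P * R)
        + (R * y - Q * w) ^ 2 / (Q * R) := by
    field_simp
    ring
  have h2 : 0 ≤ (Q * x - P * y) ^ 2 / (P * Q) + (R * x - P * w) ^ 2 / (P * R)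
        + (R * y - Q * w) ^ 2 / (Q * R) := by positivity
  linarith

/-- Sum both sides over all k. Each site passes through every position of the window, so the totals
factor into sums of squared weights times Ds or Zs, and the strict inequality of the totals holds
for some k. -/
theorem exists_weightedWindow_lt {n : ℕ} (hn : 2 ≤ n) {al be ga co : ℤ → Z →L[ℂ] Z} {z d : ℤ → Z}
    {a g : ℝ} (ha : ∀ j, ‖al j‖ ≤ a) (hg : ∀ j, ‖ga j‖ ≤ g) (hco : ∀ j, ‖co j‖ ≤ g)
    (hd : ∀ j, d j = al j (z (j - 1)) + be j (z j) + ga j (z (j + 1)))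
    {Zs Ds : ℝ} (hz : HasSum (fun j => ‖z j‖ ^ 2) Zs) (hds : HasSum (fun j => ‖d j‖ ^ 2) Ds)
    (hZs : 0 < Zs) {ε₀ ε : ℝ} (hε₀ : 0 ≤ ε₀) (hDs : Ds ≤ ε₀ ^ 2 * Zs)
    (hε : ε₀ + 2 * (a + g) * Real.sin (Real.pi / (2 * n)) < ε) :
    ∃ k : ℤ, ∑ i ∈ Finset.range n, ‖weightedWindow n al be ga co z k i‖ ^ 2
      < ε ^ 2 * ∑ i ∈ Finset.range n, ‖(sineWeight n (i + 1) : ℂ) • z (k + 1 + i)‖ ^ 2 := by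
  have hn0 : 0 < n := by omega
  have ha0 : 0 ≤ a := (norm_nonneg _).trans (ha 0)
  have hg0 : 0 ≤ g := (norm_nonneg _).trans (hg 0)
  have hnR : (2 : ℝ) ≤ n := by exact_mod_cast hn
  set c := 2 * Real.sin (Real.pi / (2 * n)) with hc
  have hc0 : 0 < c := by
    have : 0 < Real.sin (Real.pi / (2 * n)) := by
      refine Real.sin_pos_of_pos_of_lt_pi (by positivity) ?_
      exact div_lt_self Real.pi_pos (by linarith)
    positivity
  -- Half of the available slack is spent on making P, Q and R positive even when ε₀, a or g
  -- vanishes.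
  obtain ⟨η, hη, hηε⟩ : ∃ η : ℝ, 0 < η ∧ (ε₀ + η) + (a + η) * c + (g + η) * c < ε := by
    refine ⟨(ε - (ε₀ + (a + g) * c)) / (2 * (1 + 2 * c)), ?_, ?_⟩
    · refine div_pos ?_ (by positivity)
      rw [hc]
      linarith
    · have h1 : (ε - (ε₀ + (a + g) * c)) / (2 * (1 + 2 * c)) * (1 + 2 * c)
          = (ε - (ε₀ + (a + g) * c)) / 2 := by
        field_simp
      have h2 : 0 < ε - (ε₀ + (a + g) * c) := by
        rw [hc]
        linarith
      nlinarith
  set P := ε₀ + η with hP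
  set Q := (a + η) * c with hQ
  set R := (g + η) * c with hR
  have hP0 : 0 < P := by positivity
  have hQ0 : 0 < Q := by positivity
  have hR0 : 0 < R := by positivity
  set S := ∑ i ∈ Finset.range n, sineWeight n (i + 1) ^ 2 with hS
  have hS0 : 0 < S := by
    refine Finset.sum_pos' (fun i _ => by positivity) ⟨0, Finset.mem_range.2 hn0, ?_⟩
    have := sineWeight_one_pos hn
    positivity
  set m : ℕ → ℤ := fun i => if i + 1 = n then (1 : ℤ) else 2 + i with hm
  set b : ℤ → ℝ := fun k => ∑ i ∈ Finset.range n, (P + Q + R) *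
    (sineWeight n (i + 1) ^ 2 * ‖d (k + (1 + i))‖ ^ 2 / P
      + a ^ 2 * (sineWeight n i - sineWeight n (i + 1)) ^ 2 * ‖z (k + i)‖ ^ 2 / Q
      + g ^ 2 * (sineWeight n (i + 2) - sineWeight n (i + 1)) ^ 2 * ‖z (k + m i)‖ ^ 2 / R) with hb
  have hle : ∀ k, ∑ i ∈ Finset.range n, ‖weightedWindow n al be ga co z k i‖ ^ 2 ≤ b k := fun k => by
    refine Finset.sum_le_sum fun i _ => ?_
    have h1 := norm_weightedWindow_le (n := n) ha hg hco hd k (i := i)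
    have h2 := pow_le_pow_left₀ (norm_nonneg _) h1 2
    refine (h2.trans (sq_add_add_le hP0 hQ0 hR0 _ _ _)).trans_eq ?_
    simp only [mul_pow, sq_abs, hm]
  have hbsum : HasSum b (∑ i ∈ Finset.range n, (P + Q + R) *
    (sineWeight n (i + 1) ^ 2 * Ds / P
      + a ^ 2 * (sineWeight n i - sineWeight n (i + 1)) ^ 2 * Zs / Q
      + g ^ 2 * (sineWeight n (i + 2) - sineWeight n (i + 1)) ^ 2 * Zs / R)) := by
    refine hasSum_sum fun i _ => HasSum.mul_left _ (HasSum.add (HasSum.add ?_ ?_) ?_)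
    · exact ((hasSum_translate hds _).mul_left _).div_const _
    · exact ((hasSum_translate hz _).mul_left _).div_const _
    · exact ((hasSum_translate hz _).mul_left _).div_const _
  have htot : ∑ i ∈ Finset.range n, (P + Q + R) *
    (sineWeight n (i + 1) ^ 2 * Ds / P
      + a ^ 2 * (sineWeight n i - sineWeight n (i + 1)) ^ 2 * Zs / Q
      + g ^ 2 * (sineWeight n (i + 2) - sineWeight n (i + 1)) ^ 2 * Zs / R)
      = (P + Q + R) * (S * Ds / P + a ^ 2 * (c ^ 2 * S) * Zs / Q + g ^ 2 * (c ^ 2 * S) * Zs / R) := by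
    rw [← Finset.mul_sum, Finset.sum_add_distrib, Finset.sum_add_distrib, ← Finset.sum_div,
      ← Finset.sum_div, ← Finset.sum_div, ← Finset.sum_mul, ← Finset.sum_mul, ← Finset.sum_mul,
      ← Finset.mul_sum, ← Finset.mul_sum, sum_sq_sub_sineWeight hn0, sum_sq_sub_sineWeight_succ hn0]
  have hbound : (P + Q + R) * (S * Ds / P + a ^ 2 * (c ^ 2 * S) * Zs / Q
      + g ^ 2 * (c ^ 2 * S) * Zs / R) ≤ (P + Q + R) ^ 2 * (S * Zs) := by
    have h1 : S * Ds / P ≤ P * (S * Zs) := by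
      rw [div_le_iff₀ hP0]
      calc S * Ds ≤ S * (ε₀ ^ 2 * Zs) := by gcongr
        _ ≤ S * (P ^ 2 * Zs) := by
          gcongr
          linarith
        _ = _ := by ring
    have h2 : ∀ x : ℝ, 0 ≤ x → x ^ 2 * (c ^ 2 * S) * Zs / ((x + η) * c)
        ≤ ((x + η) * c) * (S * Zs) := fun x hx => by
      rw [div_le_iff₀ (by positivity)]
      calc x ^ 2 * (c ^ 2 * S) * Zs ≤ (x + η) ^ 2 * (c ^ 2 * S) * Zs := by
            gcongr
            linarith
        _ = _ := by ring
    calc _ ≤ (P + Q + R) * (P * (S * Zs) + Q * (S * Zs) + R * (S * Zs)) := by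
          refine mul_le_mul_of_nonneg_left ?_ (by positivity)
          exact add_le_add (add_le_add h1 (h2 a ha0)) (h2 g hg0)
      _ = _ := by ring
  have hy : HasSum (fun k => ε ^ 2 * ∑ i ∈ Finset.range n,
      ‖(sineWeight n (i + 1) : ℂ) • z (k + 1 + i)‖ ^ 2) (ε ^ 2 * (S * Zs)) := by
    refine HasSum.mul_left _ ?_
    rw [hS, Finset.sum_mul]
    refine hasSum_sum fun i _ => ?_
    have h1 := (hasSum_translate hz (1 + i)).mul_left (sineWeight n (i + 1) ^ 2)
    have h2 : (fun k : ℤ => ‖(sineWeight n (i + 1) : ℂ) • z (k + 1 + i)‖ ^ 2)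
        = fun k => sineWeight n (i + 1) ^ 2 * ‖z (k + (1 + i))‖ ^ 2 := funext fun k => by
      rw [norm_smul, Complex.norm_real, Real.norm_eq_abs, mul_pow, sq_abs, add_assoc]
    rwa [h2]
  by_contra! hcon
  have h1 := hasSum_le (fun k => (hcon k).trans (hle k)) hy hbsum
  rw [htot] at h1
  have h2 : (P + Q + R) ^ 2 * (S * Zs) < ε ^ 2 * (S * Zs) := by
    gcongr
  linarith

theorem sum_three_terms {V : Type*} [AddCommGroup V] {n i : ℕ} (hi : i < n) (f : ℕ → V)
    (h0 : f 0 = 0) (hf : ∀ j, j ≠ i → j ≠ i + 1 → j ≠ i + 2 → f j = 0) :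
    ∑ j : Fin n, f (j + 1) = f i + f (i + 1) + if i + 1 = n then 0 else f (i + 2) := by
  have h1 : ∑ j : Fin n, f (j + 1) = ∑ j ∈ Finset.range (n + 1), f j := by
    rw [Finset.sum_range_succ', h0, add_zero, Finset.sum_range]
  have h2 : ∑ j ∈ Finset.range (n + 2), f j = f i + f (i + 1) + f (i + 2) := by
    have : ∑ j ∈ {i, i + 1, i + 2}, f j = ∑ j ∈ Finset.range (n + 2), f j := by
      refine Finset.sum_subset (fun j hj => ?_) fun j _ hj => ?_
      · simp only [Finset.mem_insert, Finset.mem_singleton] at hj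
        rw [Finset.mem_range]
        omega
      · simp only [Finset.mem_insert, Finset.mem_singleton, not_or] at hj
        exact hf j hj.1 hj.2.1 hj.2.2
    rw [← this, Finset.sum_insert (by simp), Finset.sum_insert (by simp), Finset.sum_singleton,
      add_assoc]
  rw [Finset.sum_range_succ] at h2
  rw [h1]
  split_ifs with h
  · have : n + 1 = i + 2 := by omega
    rw [this] at h2
    rw [add_zero]
    rw [this]
    exact add_right_cancel h2
  · rw [hf (n + 1) (by omega) (by omega) (by omega), add_zero] at h2
    exact h2

end WeightedWindows

/-! ### From the operator to its periodised sections -/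

section Inclusion

variable {X : Type*} [NormedAddCommGroup X] [NormedSpace ℂ X]

theorem supNorm_subdiag_nonneg (A : EllTwo X →L[ℂ] EllTwo X) : 0 ≤ supNorm (subdiag A) :=
  (norm_nonneg _).trans (le_ciSup (bddAbove_subdiag A) 0)

theorem supNorm_superdiag_nonneg (A : EllTwo X →L[ℂ] EllTwo X) : 0 ≤ supNorm (superdiag A) :=
  (norm_nonneg _).trans (le_ciSup (bddAbove_superdiag A) 0)

theorem norm_matrixEntry_sub_one_le (A : EllTwo X →L[ℂ] EllTwo X) (j : ℤ) :
    ‖matrixEntry A j (j - 1)‖ ≤ supNorm (subdiag A) := by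
  have h : ‖matrixEntry A (j - 1 + 1) (j - 1)‖ ≤ supNorm (subdiag A) :=
    le_ciSup (bddAbove_subdiag A) (j - 1)
  rwa [sub_add_cancel] at h

theorem norm_matrixEntry_add_one_le (A : EllTwo X →L[ℂ] EllTwo X) (j : ℤ) :
    ‖matrixEntry A j (j + 1)‖ ≤ supNorm (superdiag A) := by
  have h : ‖matrixEntry A (j + 1 - 1) (j + 1)‖ ≤ supNorm (superdiag A) :=
    le_ciSup (bddAbove_superdiag A) (j + 1)
  rwa [add_sub_cancel_right] at h

theorem piPenalty_nonneg (A : EllTwo X →L[ℂ] EllTwo X) {n : ℕ} (hn : 1 ≤ n) : 0 ≤ piPenalty A n := by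
  unfold piPenalty
  have h2 := supNorm_subdiag_nonneg A
  have h3 := supNorm_superdiag_nonneg A
  have hnR : (1 : ℝ) ≤ n := by exact_mod_cast hn
  have h4 : 0 ≤ Real.sin (Real.pi / (2 * n)) :=
    Real.sin_nonneg_of_nonneg_of_le_pi (by positivity)
      (div_le_self Real.pi_pos.le (by linarith))
  positivity

/-- The top right corner acts on the last entry of the window, whose weight is zero; only the bottom
left corner survives. -/
theorem periodisedSection_window {A : EllTwo X →L[ℂ] EllTwo X} (hA : IsTridiagonal A) (t lam : ℂ)
    {n : ℕ} (k : ℤ) (x : ℤ → X) (i : Fin n) :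
    (periodisedSection A t n k - lam • ContinuousLinearMap.id ℂ (PiLp 2 fun _ : Fin n => X))
        (WithLp.toLp 2 fun j : Fin n => (sineWeight n (j + 1) : ℂ) • x (k + 1 + (j : ℕ))) i
      = weightedWindow n (fun j => matrixEntry A j (j - 1))
          (fun j => matrixEntry A j j - lam • ContinuousLinearMap.id ℂ X)
          (fun j => matrixEntry A j (j + 1)) (fun k => star t • superdiag A (k + n + 1)) x k i := by
  have hi := i.2
  have e1 : k + 1 + (i : ℤ) - 1 = k + i := by ring
  have e2 : k + 1 + (i : ℤ) + 1 = k + 2 + i := by ring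
  set y : PiLp 2 (fun _ : Fin n => X) :=
    WithLp.toLp 2 fun j : Fin n => (sineWeight n (j + 1) : ℂ) • x (k + 1 + (j : ℕ)) with hy
  have hyj : ∀ j : Fin n, y j = (sineWeight n (j + 1) : ℂ) • x (k + 1 + (j : ℕ)) := fun j => rfl
  have hsub : (periodisedSection A t n k - lam • ContinuousLinearMap.id ℂ (PiLp 2 fun _ : Fin n => X)) y i
      = periodisedSection A t n k y i - lam • y i := by
    rw [sub_smul_id_apply]
    rfl
  have hmain := sum_three_terms hi
    (fun j => (sineWeight n j : ℂ) • matrixEntry A (k + 1 + i) (k + j) (x (k + j))) (by simp)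
    fun j h1 h2 h3 => by
      rw [hA _ _ (by rw [lt_abs]; omega)]
      simp
  have hsum1 : ∑ j : Fin n, matrixEntry A (k + 1 + i) (k + 1 + (j : ℕ)) (y j)
      = ∑ j : Fin n, (sineWeight n ((j : ℕ) + 1) : ℂ) •
        matrixEntry A (k + 1 + i) (k + ((j + 1 : ℕ) : ℤ)) (x (k + ((j + 1 : ℕ) : ℤ))) := by
    refine Finset.sum_congr rfl fun j _ => ?_
    have e3 : k + ((j + 1 : ℕ) : ℤ) = k + 1 + (j : ℕ) := by
      push_cast
      ring
    rw [hyj, map_smul, e3]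
  have hsum2 : ∑ j : Fin n, (if (i : ℕ) = 0 ∧ (j : ℕ) + 1 = n then t • subdiag A k else 0) (y j)
      = 0 := by
    refine Finset.sum_eq_zero fun j _ => ?_
    split_ifs with h
    · rw [hyj, h.2, sineWeight_self (by omega)]
      simp
    · rfl
  have hsum3 : ∑ j : Fin n,
      (if (i : ℕ) + 1 = n ∧ (j : ℕ) = 0 then star t • superdiag A (k + n + 1) else 0) (y j)
      = if (i : ℕ) + 1 = n then (sineWeight n 1 : ℂ) • (star t • superdiag A (k + n + 1)) (x (k + 1))
        else 0 := by
    rw [Finset.sum_eq_single_of_mem (⟨0, by omega⟩ : Fin n) (Finset.mem_univ _)]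
    · by_cases h : (i : ℕ) + 1 = n
      · rw [if_pos ⟨h, rfl⟩, if_pos h, hyj, map_smul]
        simp
      · simp [h]
    · intro j _ hj
      rw [if_neg fun h => hj (Fin.ext h.2)]
      rfl
  rw [hsub, periodisedSection, blockOperator_apply]
  simp only [_root_.add_apply]
  rw [Finset.sum_add_distrib, Finset.sum_add_distrib, hsum1, hsum2, hsum3, hmain, hyj]
  simp only [weightedWindow]
  have e4 : k + ((i : ℕ) + 1 : ℕ) = k + 1 + (i : ℤ) := by
    push_cast
    ring
  have e5 : k + ((i : ℕ) + 2 : ℕ) = k + 2 + (i : ℤ) := by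
    push_cast
    ring
  rw [e1, e2, e4, e5]
  simp only [_root_.sub_apply, _root_.smul_apply, ContinuousLinearMap.id_apply, smul_sub]
  rw [smul_comm lam]
  split_ifs <;> abel

theorem exists_recipNormInv_periodisedSection_lt_of_apply [Nontrivial X]
    {A : EllTwo X →L[ℂ] EllTwo X} (hA : IsTridiagonal A) {t : ℂ} (ht : ‖t‖ = 1) {lam : ℂ} {ε : ℝ}
    {x : EllTwo X} (hx : ‖(A - lam • ContinuousLinearMap.id ℂ (EllTwo X)) x‖ < ε * ‖x‖) {n : ℕ} (hn : 2 ≤ n) :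
    ∃ k : ℤ, recipNormInv (periodisedSection A t n k - lam • ContinuousLinearMap.id ℂ (PiLp 2 fun _ : Fin n => X))
      < ε + piPenalty A n := by
  have := nontrivial_piLp (X := X) (by omega : 1 ≤ n)
  have hx0 : x ≠ 0 := by
    rintro rfl
    simp at hx
  have hxn : 0 < ‖x‖ := norm_pos_iff.2 hx0
  set w := (A - lam • ContinuousLinearMap.id ℂ (EllTwo X)) x with hw
  have hε₀ : ‖w‖ / ‖x‖ < ε := by rwa [div_lt_iff₀ hxn]
  obtain ⟨k, hk⟩ := exists_weightedWindow_lt hn (al := fun j => matrixEntry A j (j - 1))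
    (be := fun j => matrixEntry A j j - lam • ContinuousLinearMap.id ℂ X)
    (ga := fun j => matrixEntry A j (j + 1)) (co := fun k => star t • superdiag A (k + n + 1))
    (z := fun j => x j) (d := fun j => w j)
    (norm_matrixEntry_sub_one_le A) (norm_matrixEntry_add_one_le A)
    (fun k => by
      rw [norm_smul, norm_star, ht, one_mul]
      exact le_ciSup (bddAbove_superdiag A) _)
    (fun j => by
      have h1 : w j = A x j - lam • x j := by
        rw [hw, sub_smul_id_apply]
        rfl
      rw [h1, hA.apply_eq x j]
      simp only [_root_.sub_apply, _root_.smul_apply, ContinuousLinearMap.id_apply]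
      abel)
    (isL2Decomposition_ellTwo.coord x) (isL2Decomposition_ellTwo.coord w) (by positivity)
    (ε₀ := ‖w‖ / ‖x‖) (ε := ε + piPenalty A n) (by positivity)
    (by rw [div_pow, div_mul_cancel₀ _ (by positivity)])
    (by
      unfold piPenalty
      linarith)
  refine ⟨k, ?_⟩
  set y : PiLp 2 (fun _ : Fin n => X) :=
    WithLp.toLp 2 fun j : Fin n => (sineWeight n (j + 1) : ℂ) • x (k + 1 + (j : ℕ)) with hy
  have hpos : 0 < ε + piPenalty A n := by
    have h1 := piPenalty_nonneg A (by omega : 1 ≤ n)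
    have h2 : 0 ≤ ‖w‖ / ‖x‖ := by positivity
    linarith
  refine recipNormInv_lt_of_apply hpos _ (y := y) ?_
  have h1 : ‖(periodisedSection A t n k - lam • ContinuousLinearMap.id ℂ (PiLp 2 fun _ : Fin n => X)) y‖ ^ 2
      < ((ε + piPenalty A n) * ‖y‖) ^ 2 := by
    rw [mul_pow, PiLp.norm_sq_eq_of_L2, PiLp.norm_sq_eq_of_L2]
    rw [Finset.sum_range, Finset.sum_range] at hk
    refine lt_of_eq_of_lt (Finset.sum_congr rfl fun i _ => ?_) hk
    rw [hy, periodisedSection_window hA]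
  exact lt_of_pow_lt_pow_left₀ 2 (by positivity) h1

/-- The transpose `ψ ↦ ψ ∘ a` of an operator. -/
noncomputable def precompCLM (a : X →L[ℂ] X) : StrongDual ℂ X →L[ℂ] StrongDual ℂ X :=
  (ContinuousLinearMap.compL ℂ X X ℂ).flip a

@[simp]
theorem precompCLM_apply (a : X →L[ℂ] X) (ψ : StrongDual ℂ X) : precompCLM a ψ = ψ.comp a := rfl

theorem norm_precompCLM_le (a : X →L[ℂ] X) : ‖precompCLM a‖ ≤ ‖a‖ :=
  ContinuousLinearMap.opNorm_le_bound _ (norm_nonneg a) fun ψ => by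
    rw [mul_comm]
    exact ψ.opNorm_comp_le a

/-- The transposed computation: sub- and superdiagonal exchange roles, and now the corner t α_k is
the one that survives. -/
theorem periodisedSection_dual_window {A : EllTwo X →L[ℂ] EllTwo X} (hA : IsTridiagonal A)
    (t lam : ℂ) {n : ℕ} (k : ℤ) (ψ : ℤ → StrongDual ℂ X) (i : Fin n) :
    ((∑ j : Fin n, ((sineWeight n (j + 1) : ℂ) • ψ (k + 1 + (j : ℕ))).comp
        (PiLp.proj (𝕜 := ℂ) 2 (fun _ : Fin n => X) j)).comp
      (periodisedSection A t n k - lam • ContinuousLinearMap.id ℂ (PiLp 2 fun _ : Fin n => X))).comp (piLpSingle X i)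
      = weightedWindow n (fun j => precompCLM (matrixEntry A (j - 1) j))
          (fun j => precompCLM (matrixEntry A j j - lam • ContinuousLinearMap.id ℂ X))
          (fun j => precompCLM (matrixEntry A (j + 1) j)) (fun k => precompCLM (t • subdiag A k))
          ψ k i := by
  have hi := i.2
  have e1 : k + 1 + (i : ℤ) - 1 = k + i := by ring
  have e2 : k + 1 + (i : ℤ) + 1 = k + 2 + i := by ring
  ext z
  have hC : ∀ j : Fin n, (periodisedSection A t n k - lam • ContinuousLinearMap.id ℂ (PiLp 2 fun _ : Fin n => X))
      (piLpSingle X i z) j = matrixEntry A (k + 1 + (j : ℕ)) (k + 1 + (i : ℕ)) z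
        + (if (j : ℕ) = 0 ∧ (i : ℕ) + 1 = n then t • subdiag A k else 0) z
        + (if (j : ℕ) + 1 = n ∧ (i : ℕ) = 0 then star t • superdiag A (k + n + 1) else 0) z
        - if j = i then lam • z else 0 := fun j => by
    have hsub : (periodisedSection A t n k - lam • ContinuousLinearMap.id ℂ (PiLp 2 fun _ : Fin n => X)) (piLpSingle X i z) j
        = periodisedSection A t n k (piLpSingle X i z) j - lam • piLpSingle X i z j := by
      rw [sub_smul_id_apply]
      rfl
    rw [hsub, periodisedSection, blockOperator_apply, Finset.sum_eq_single_of_mem i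
      (Finset.mem_univ _)]
    · simp [piLpSingle_apply]
    · intro l _ hl
      rw [piLpSingle_apply, if_neg hl, map_zero]
  have hmain := sum_three_terms hi
    (fun j => (sineWeight n j : ℂ) • ψ (k + j) (matrixEntry A (k + j) (k + 1 + i) z)) (by simp)
    fun j h1 h2 h3 => by
      rw [hA _ _ (by rw [lt_abs]; omega)]
      simp
  have hsum1 : ∑ j : Fin n, (sineWeight n (j + 1) : ℂ) •
        ψ (k + 1 + (j : ℕ)) (matrixEntry A (k + 1 + (j : ℕ)) (k + 1 + (i : ℕ)) z)
      = ∑ j : Fin n, (sineWeight n ((j : ℕ) + 1) : ℂ) •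
        ψ (k + ((j + 1 : ℕ) : ℤ)) (matrixEntry A (k + ((j + 1 : ℕ) : ℤ)) (k + 1 + i) z) := by
    refine Finset.sum_congr rfl fun j _ => ?_
    have e3 : k + ((j + 1 : ℕ) : ℤ) = k + 1 + (j : ℕ) := by
      push_cast
      ring
    rw [e3]
  have hsum3 : ∑ j : Fin n, (sineWeight n (j + 1) : ℂ) • ψ (k + 1 + (j : ℕ))
      ((if (j : ℕ) + 1 = n ∧ (i : ℕ) = 0 then star t • superdiag A (k + n + 1) else 0) z) = 0 := by
    refine Finset.sum_eq_zero fun j _ => ?_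
    split_ifs with h
    · rw [h.1, sineWeight_self (by omega)]
      simp
    · simp
  have hsum2 : ∑ j : Fin n, (sineWeight n (j + 1) : ℂ) • ψ (k + 1 + (j : ℕ))
      ((if (j : ℕ) = 0 ∧ (i : ℕ) + 1 = n then t • subdiag A k else 0) z)
      = if (i : ℕ) + 1 = n then (sineWeight n 1 : ℂ) • ψ (k + 1) ((t • subdiag A k) z) else 0 := by
    rw [Finset.sum_eq_single_of_mem (⟨0, by omega⟩ : Fin n) (Finset.mem_univ _)]
    · by_cases h : (i : ℕ) + 1 = n
      · simp [h]
      · simp [h]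
    · intro j _ hj
      rw [if_neg fun h => hj (Fin.ext h.1)]
      simp
  have hsum4 : ∑ j : Fin n, (sineWeight n (j + 1) : ℂ) • ψ (k + 1 + (j : ℕ))
      (if j = i then lam • z else 0) = (sineWeight n (i + 1) : ℂ) • ψ (k + 1 + (i : ℕ)) (lam • z) := by
    rw [Finset.sum_eq_single_of_mem i (Finset.mem_univ _)]
    · simp
    · intro j _ hj
      rw [if_neg hj]
      simp
  simp only [ContinuousLinearMap.comp_apply, _root_.sum_apply, PiLp.proj_apply, hC,
    map_add, map_sub, _root_.smul_apply]
  rw [Finset.sum_sub_distrib, Finset.sum_add_distrib, Finset.sum_add_distrib, hsum1, hsum2, hsum3,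
    hsum4, hmain]
  simp only [weightedWindow]
  have e4 : k + ((i : ℕ) + 1 : ℕ) = k + 1 + (i : ℤ) := by
    push_cast
    ring
  have e5 : k + ((i : ℕ) + 2 : ℕ) = k + 2 + (i : ℤ) := by
    push_cast
    ring
  rw [e1, e2, e4, e5]
  split_ifs
  · simp only [_root_.add_apply, _root_.smul_apply, precompCLM_apply,
      ContinuousLinearMap.comp_apply, _root_.sub_apply, ContinuousLinearMap.id_apply, map_sub,
      smul_sub]
    abel
  · simp only [_root_.add_apply, _root_.smul_apply, precompCLM_apply,
      ContinuousLinearMap.comp_apply, _root_.sub_apply, ContinuousLinearMap.id_apply, map_sub,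
      smul_sub]
    abel

/-- The components of φ are an exact null sequence of the transposed recursion, so
`exists_weightedWindow_lt` applies with residual zero. The penalty is symmetric in the two diagonals
and does not change. -/
theorem exists_recipNormInv_periodisedSection_lt_of_dual [Nontrivial X]
    {A : EllTwo X →L[ℂ] EllTwo X} (hA : IsTridiagonal A) {t : ℂ} (ht : ‖t‖ = 1) {lam : ℂ} {ε : ℝ}
    (hε : 0 < ε) {φ : StrongDual ℂ (EllTwo X)} (hφ0 : φ ≠ 0)
    (hφ : φ.comp (A - lam • ContinuousLinearMap.id ℂ (EllTwo X)) = 0) {n : ℕ} (hn : 2 ≤ n) :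
    ∃ k : ℤ, recipNormInv (periodisedSection A t n k - lam • ContinuousLinearMap.id ℂ (PiLp 2 fun _ : Fin n => X))
      < ε + piPenalty A n := by
  have := nontrivial_piLp (X := X) (by omega : 1 ≤ n)
  have hφn : 0 < ‖φ‖ := norm_pos_iff.2 hφ0
  set ψ : ℤ → StrongDual ℂ X :=
    fun j => φ.comp (lp.singleContinuousLinearMap ℂ (fun _ : ℤ => X) 2 j) with hψ
  obtain ⟨k, hk⟩ := exists_weightedWindow_lt hn
    (al := fun j => precompCLM (matrixEntry A (j - 1) j))
    (be := fun j => precompCLM (matrixEntry A j j - lam • ContinuousLinearMap.id ℂ X))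
    (ga := fun j => precompCLM (matrixEntry A (j + 1) j)) (co := fun k => precompCLM (t • subdiag A k))
    (z := ψ) (d := fun _ => 0) (a := supNorm (superdiag A)) (g := supNorm (subdiag A))
    (fun j => (norm_precompCLM_le _).trans (le_ciSup (bddAbove_superdiag A) j))
    (fun j => (norm_precompCLM_le _).trans (le_ciSup (bddAbove_subdiag A) j))
    (fun k => (norm_precompCLM_le _).trans (by
      rw [norm_smul, ht, one_mul]
      exact le_ciSup (bddAbove_subdiag A) k))
    (fun j => by
      have h1 := hA.dual_apply_eq φ j
      have h2 : φ.comp A = lam • φ := by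
        ext y
        have h3 := congrArg (fun θ : StrongDual ℂ (EllTwo X) => θ y) hφ
        simp only [ContinuousLinearMap.comp_apply, sub_smul_id_apply, map_sub, map_smul,
          _root_.zero_apply] at h3
        exact sub_eq_zero.1 h3
      rw [h2] at h1
      have h4 : ψ j ∘L (matrixEntry A j j - lam • ContinuousLinearMap.id ℂ X)
          = ψ j ∘L matrixEntry A j j - lam • ψ j := by
        ext z
        simp
      have h5 : (lam • φ).comp (lp.singleContinuousLinearMap ℂ (fun _ : ℤ => X) 2 j)
          = lam • ψ j := rfl
      simp only [precompCLM_apply]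
      rw [h4, ← h5, h1]
      simp only [hψ]
      abel)
    (isL2Decomposition_ellTwo.dual_coord φ) (Ds := 0) (by simp) (by positivity)
    (ε₀ := 0) (ε := ε + piPenalty A n) le_rfl (by simp)
    (by
      unfold piPenalty
      linarith)
  refine ⟨k, ?_⟩
  have hpos : 0 < ε + piPenalty A n := by
    have := piPenalty_nonneg A (by omega : 1 ≤ n)
    linarith
  set Φ : StrongDual ℂ (PiLp 2 (fun _ : Fin n => X)) :=
    ∑ j : Fin n, ((sineWeight n (j + 1) : ℂ) • ψ (k + 1 + (j : ℕ))).comp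
      (PiLp.proj (𝕜 := ℂ) 2 (fun _ : Fin n => X) j) with hΦ
  have hnorm : ∀ θ : StrongDual ℂ (PiLp 2 (fun _ : Fin n => X)),
      ‖θ‖ ^ 2 = ∑ i : Fin n, ‖θ.comp (piLpSingle X i)‖ ^ 2 := fun θ =>
    (isL2Decomposition_piLp.dual_coord θ).unique (hasSum_fintype _)
  have hΦi : ∀ i : Fin n, Φ.comp (piLpSingle X i)
      = (sineWeight n (i + 1) : ℂ) • ψ (k + 1 + (i : ℕ)) := fun i => by
    ext z
    simp only [hΦ, ContinuousLinearMap.comp_apply, _root_.sum_apply, PiLp.proj_apply,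
      piLpSingle_apply]
    rw [Finset.sum_eq_single_of_mem i (Finset.mem_univ _)]
    · rw [if_pos rfl]
    · intro j _ hj
      rw [if_neg hj, map_zero]
  refine recipNormInv_lt_of_dual hpos _ (φ := Φ) ?_
  have h1 : ‖Φ.comp (periodisedSection A t n k - lam • ContinuousLinearMap.id ℂ (PiLp 2 fun _ : Fin n => X))‖ ^ 2
      < ((ε + piPenalty A n) * ‖Φ‖) ^ 2 := by
    rw [mul_pow, hnorm, hnorm]
    rw [Finset.sum_range, Finset.sum_range] at hk
    simp_rw [hΦi]
    refine lt_of_eq_of_lt (Finset.sum_congr rfl fun i _ => ?_) hk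
    rw [hΦ, periodisedSection_dual_window hA]
  exact lt_of_pow_lt_pow_left₀ 2 (by positivity) h1

theorem exists_recipNormInv_periodisedSection_lt [CompleteSpace X] [Nontrivial X]
    {A : EllTwo X →L[ℂ] EllTwo X} (hA : IsTridiagonal A) {t : ℂ} (ht : ‖t‖ = 1) {lam : ℂ} {ε : ℝ}
    (h : recipNormInv (A - lam • ContinuousLinearMap.id ℂ (EllTwo X)) < ε) {n : ℕ} (hn : 2 ≤ n) :
    ∃ k : ℤ, recipNormInv (periodisedSection A t n k - lam • ContinuousLinearMap.id ℂ (PiLp 2 fun _ : Fin n => X))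
      < ε + piPenalty A n := by
  rcases exists_apply_lt_or_dual h with ⟨x, hx⟩ | ⟨φ, hφ0, hφ⟩
  · exact exists_recipNormInv_periodisedSection_lt_of_apply hA ht hx hn
  · exact exists_recipNormInv_periodisedSection_lt_of_dual hA ht
      ((recipNormInv_nonneg _).trans_lt h) hφ0 hφ hn

end Inclusion

/-! ### Uniform invertibility in finite dimensions -/

section UniformInvertibility

theorem pow_card_le_norm_prod {r : ℝ} (hr : 0 ≤ r) (s : Multiset ℂ) (h : ∀ x ∈ s, r ≤ ‖x‖) :
    r ^ s.card ≤ ‖s.prod‖ := by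
  induction s using Multiset.induction with
  | empty => simp
  | cons a s ih =>
    rw [Multiset.card_cons, Multiset.prod_cons, norm_mul, pow_succ']
    exact mul_le_mul (h a (Multiset.mem_cons_self _ _))
      (ih fun x hx => h x (Multiset.mem_cons_of_mem hx)) (by positivity) (norm_nonneg _)

variable {W : Type*} [NormedAddCommGroup W] [NormedSpace ℂ W] [FiniteDimensional ℂ W]

/-- The determinant is the product of the eigenvalues, none of which lies in the disc. -/
theorem pow_finrank_le_norm_det {C : W →L[ℂ] W} {r : ℝ} (hr : 0 ≤ r)
    (h : ∀ μ : ℂ, ‖μ‖ < r → IsUnit (C - μ • ContinuousLinearMap.id ℂ W)) :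
    r ^ Module.finrank ℂ W ≤ ‖C.det‖ := by
  have hs : (C : W →ₗ[ℂ] W).charpoly.Splits := IsAlgClosed.splits _
  have h1 : C.det = (C : W →ₗ[ℂ] W).charpoly.roots.prod :=
    Module.End.det_eq_prod_roots_charpoly_of_splits hs
  have h2 : (C : W →ₗ[ℂ] W).charpoly.roots.card = Module.finrank ℂ W := by
    rw [← hs.natDegree_eq_card_roots, LinearMap.charpoly_natDegree]
  rw [h1, ← h2]
  refine pow_card_le_norm_prod hr _ fun μ hμ => ?_
  by_contra! hlt
  have h3 : Module.End.HasEigenvalue (C : W →ₗ[ℂ] W) μ := by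
    rw [Module.End.hasEigenvalue_iff_isRoot_charpoly]
    exact Polynomial.isRoot_of_mem_roots hμ
  obtain ⟨v, hv⟩ := h3.exists_hasEigenvector
  refine hv.2 ?_
  have h4 : (C - μ • ContinuousLinearMap.id ℂ W) v = 0 := by
    rw [sub_smul_id_apply, sub_eq_zero]
    exact hv.apply_eq_smul
  have h5 := inverse_apply_self (h μ hlt) v
  rw [h4, map_zero] at h5
  exact h5.symm

/-- The admissible C lie in the compact set given by the norm bound and the determinant bound; it
consists of invertible operators, and ν attains a positive minimum there. This is the substitute for
Globevnik's theorem at level zero. -/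
theorem exists_le_recipNormInv_of_isUnit [Nontrivial W] {r : ℝ} (hr : 0 < r) (K : ℝ) :
    ∃ δ : ℝ, 0 < δ ∧ ∀ C : W →L[ℂ] W, ‖C‖ ≤ K →
      (∀ μ : ℂ, ‖μ‖ < r → IsUnit (C - μ • ContinuousLinearMap.id ℂ W)) → δ ≤ recipNormInv C := by
  have : ProperSpace (W →L[ℂ] W) := FiniteDimensional.proper ℂ _
  have : CompleteSpace W := FiniteDimensional.complete ℂ W
  set S : Set (W →L[ℂ] W) :=
    Metric.closedBall 0 K ∩ {C | r ^ Module.finrank ℂ W ≤ ‖C.det‖} with hS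
  have hcomp : IsCompact S := (isCompact_closedBall 0 K).inter_right
    (isClosed_le continuous_const ContinuousLinearMap.continuous_det.norm)
  have hmem : ∀ C : W →L[ℂ] W, ‖C‖ ≤ K →
      (∀ μ : ℂ, ‖μ‖ < r → IsUnit (C - μ • ContinuousLinearMap.id ℂ W)) → C ∈ S := fun C hC h =>
    ⟨by simpa using hC, pow_finrank_le_norm_det hr.le h⟩
  rcases S.eq_empty_or_nonempty with h0 | hne
  · refine ⟨1, one_pos, fun C hC h => ?_⟩
    have := hmem C hC h
    rw [h0] at this
    exact this.elim
  · obtain ⟨C₀, hC₀, hmin⟩ := hcomp.exists_isMinOn hne continuous_recipNormInv.continuousOn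
    refine ⟨recipNormInv C₀, ?_, fun C hC h => hmin (hmem C hC h)⟩
    by_contra! hle
    rw [recipNormInv_le_zero_iff] at hle
    refine hle ?_
    have h1 : (0 : ℝ) < ‖C₀.det‖ := lt_of_lt_of_le (by positivity) hC₀.2
    rw [ContinuousLinearMap.isUnit_iff_bijective]
    have h2 : IsUnit (C₀ : W →ₗ[ℂ] W) := by
      rw [LinearMap.isUnit_iff_isUnit_det, isUnit_iff_ne_zero]
      exact norm_pos_iff.1 h1
    exact (Module.End.isUnit_iff _).1 h2

end UniformInvertibility

/-! ### Inclusions between pseudospectra and the approximating sets -/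

section PiMethod

variable {X : Type*} [NormedAddCommGroup X] [NormedSpace ℂ X]

theorem norm_blockOperator_le {n : ℕ} (M : Fin n → Fin n → X →L[ℂ] X) {c : ℝ} (hc : 0 ≤ c)
    (hM : ∀ i j, ‖M i j‖ ≤ c) : ‖blockOperator M‖ ≤ n * (n * c) := by
  refine ContinuousLinearMap.opNorm_le_bound _ (by positivity) fun x => ?_
  have h1 : ∀ i, ‖blockOperator M x i‖ ≤ n * c * ‖x‖ := fun i => by
    rw [blockOperator_apply]
    calc ‖∑ j, M i j (x j)‖ ≤ ∑ j, ‖M i j (x j)‖ := norm_sum_le _ _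
      _ ≤ ∑ _j : Fin n, c * ‖x‖ := Finset.sum_le_sum fun j _ =>
        ((M i j).le_opNorm _).trans
          (mul_le_mul (hM i j) (PiLp.norm_apply_le x j) (norm_nonneg _) hc)
      _ = _ := by
        simp
        ring
  have h2 : blockOperator M x = ∑ i, piLpSingle X i (blockOperator M x i) := by
    ext i
    simp [piLpSingle_apply]
  have h3 : ∀ (i : Fin n) (z : X), ‖piLpSingle X i z‖ = ‖z‖ := fun i z => by
    have := (isL2Decomposition_piLp (X := X) (n := n)).norm_sum_sq {i} fun _ => z
    simp only [Finset.sum_singleton] at this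
    exact (sq_eq_sq₀ (norm_nonneg _) (norm_nonneg _)).1 this
  rw [h2]
  calc _ ≤ ∑ i, ‖piLpSingle X i (blockOperator M x i)‖ := norm_sum_le _ _
    _ ≤ ∑ _i : Fin n, n * c * ‖x‖ := Finset.sum_le_sum fun i _ => by
      rw [h3]
      exact h1 i
    _ = _ := by
      simp
      ring

theorem exists_norm_periodisedSection_le (A : EllTwo X →L[ℂ] EllTwo X) {t : ℂ} (ht : ‖t‖ = 1)
    (n : ℕ) : ∃ K : ℝ, ∀ k : ℤ, ‖periodisedSection A t n k‖ ≤ K := by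
  refine ⟨n * (n * (‖A‖ + ‖A‖ + ‖A‖)), fun k => norm_blockOperator_le _ (by positivity)
    fun i j => norm_add₃_le.trans (add_le_add (add_le_add (norm_matrixEntry_le A _ _) ?_) ?_)⟩
  · split_ifs
    · rw [norm_smul, ht, one_mul]
      exact norm_matrixEntry_le A _ _
    · simp
  · split_ifs
    · rw [norm_smul, norm_star, ht, one_mul]
      exact norm_matrixEntry_le A _ _
    · simp

theorem tendsto_piPenalty (A : EllTwo X →L[ℂ] EllTwo X) : Tendsto (piPenalty A) atTop (𝓝 0) := by
  have h1 : Tendsto (fun n : ℕ => Real.pi / (2 * (n : ℝ))) atTop (𝓝 0) :=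
    tendsto_const_nhds.div_atTop (tendsto_natCast_atTop_atTop.const_mul_atTop two_pos)
  have h2 := ((Real.continuous_sin.tendsto 0).comp h1).const_mul
    (2 * (supNorm (subdiag A) + supNorm (superdiag A)))
  rw [Real.sin_zero, mul_zero] at h2
  exact h2

theorem eq_zero_of_piPenalty_eq_zero {A : EllTwo X →L[ℂ] EllTwo X} {n : ℕ} (hn : 1 ≤ n)
    (h : piPenalty A n = 0) (j : ℤ) : subdiag A j = 0 ∧ superdiag A j = 0 := by
  have hnR : (1 : ℝ) ≤ n := by exact_mod_cast hn
  have hs : 0 < Real.sin (Real.pi / (2 * n)) :=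
    Real.sin_pos_of_pos_of_lt_pi (by positivity) (div_lt_self Real.pi_pos (by linarith))
  have h1 := supNorm_subdiag_nonneg A
  have h2 := supNorm_superdiag_nonneg A
  have h3 : supNorm (subdiag A) + supNorm (superdiag A) = 0 := by
    unfold piPenalty at h
    have := (mul_eq_zero.1 h).resolve_right hs.ne'
    linarith
  have h4 : ‖subdiag A j‖ ≤ supNorm (subdiag A) := le_ciSup (bddAbove_subdiag A) j
  have h5 : ‖superdiag A j‖ ≤ supNorm (superdiag A) := le_ciSup (bddAbove_superdiag A) j
  exact ⟨norm_le_zero_iff.1 (by linarith), norm_le_zero_iff.1 (by linarith)⟩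

theorem piOpen_subset_piClosed (A : EllTwo X →L[ℂ] EllTwo X) (t : ℂ) (n : ℕ) (ε : ℝ) :
    piOpen A t n ε ⊆ piClosed A t n ε :=
  (Set.iUnion_mono fun _ => openPseudospectrum_subset_closed _ _).trans subset_closure

variable [Nontrivial X]

/-- A disc around lam missing the open pseudospectrum would give ν ≥ ε on it, hence ν > ε at the
centre. -/
theorem closedPseudospectrum_subset_closure {A : EllTwo X →L[ℂ] EllTwo X}
    (hX : GlobevnikProperty X) (hA : IsTridiagonal A) {ε : ℝ} (hε : 0 < ε) :
    closedPseudospectrum ε A ⊆ closure (openPseudospectrum ε A) := by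
  intro lam hlam
  have hlam' : recipNormInv (A - lam • ContinuousLinearMap.id ℂ (EllTwo X)) ≤ ε := hlam
  rw [Metric.mem_closure_iff]
  intro r hr
  by_contra! hcon
  refine absurd (hX.lt_recipNormInv hA hε (half_pos hr) lam fun μ hμ => ?_) (not_lt.2 hlam')
  by_contra! hlt
  have := hcon μ hlt
  rw [dist_comm, dist_eq_norm] at this
  linarith

variable [CompleteSpace X]

theorem openPseudospectrum_subset_piOpen {A : EllTwo X →L[ℂ] EllTwo X} (hA : IsTridiagonal A)
    {t : ℂ} (ht : ‖t‖ = 1) (ε : ℝ) {n : ℕ} (hn : 2 ≤ n) :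
    openPseudospectrum ε A ⊆ piOpen A t n (ε + piPenalty A n) := fun _ h =>
  Set.mem_iUnion.2 (exists_recipNormInv_periodisedSection_lt hA ht h hn)

/-- If a disc around lam misses the closed σ-pseudospectra of all sections, σ being the penalty,
then ν exceeds σ at lam by a δ independent of k. But lam lies in the open δ-pseudospectrum of A, so
some section has ν below δ + σ there. -/
theorem spectrum_subset_piClosed {A : EllTwo X →L[ℂ] EllTwo X} (hX : GlobevnikProperty X)
    (hA : IsTridiagonal A) {t : ℂ} (ht : ‖t‖ = 1)
    (h0 : FiniteDimensional ℂ X ∨ ∃ j : ℤ, subdiag A j ≠ 0 ∨ superdiag A j ≠ 0) {n : ℕ}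
    (hn : 2 ≤ n) : closedPseudospectrum 0 A ⊆ piClosed A t n (piPenalty A n) := by
  intro lam hlam
  have hlam' : recipNormInv (A - lam • ContinuousLinearMap.id ℂ (EllTwo X)) ≤ 0 := hlam
  have := nontrivial_piLp (X := X) (by omega : 1 ≤ n)
  have hpen := piPenalty_nonneg A (by omega : 1 ≤ n)
  obtain ⟨K, hK⟩ := exists_norm_periodisedSection_le A ht n
  set σ := piPenalty A n with hσ
  have hK' : ∀ k, ‖periodisedSection A t n k - lam • ContinuousLinearMap.id ℂ
      (PiLp 2 fun _ : Fin n => X)‖ ≤ K + ‖lam‖ := fun k =>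
    (norm_sub_le _ _).trans (add_le_add (hK k) (by rw [norm_smul, ContinuousLinearMap.norm_id, mul_one]))
  unfold piClosed
  rw [Metric.mem_closure_iff]
  intro r hr
  by_contra! hcon
  have hgt : ∀ (k : ℤ) (μ : ℂ), ‖μ‖ < r → σ < recipNormInv (periodisedSection A t n k
      - lam • ContinuousLinearMap.id ℂ (PiLp 2 fun _ : Fin n => X)
      - μ • ContinuousLinearMap.id ℂ (PiLp 2 fun _ : Fin n => X)) := fun k μ hμ => by
    by_contra! hle
    have h1 := hcon (lam + μ) (Set.mem_iUnion.2 ⟨k, by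
      change recipNormInv _ ≤ _
      rwa [add_smul, ← sub_sub]⟩)
    rw [dist_self_add_right] at h1
    linarith
  obtain ⟨δ, hδ, hδk⟩ : ∃ δ : ℝ, 0 < δ ∧ ∀ k : ℤ, δ + σ ≤ recipNormInv (periodisedSection A t n k
      - lam • ContinuousLinearMap.id ℂ (PiLp 2 fun _ : Fin n => X)) := by
    -- Globevnik's theorem needs a positive level. Zero penalty forces both off-diagonals to vanish,
    -- and this is where the extra hypothesis for ε = 0 supplies finite dimension.
    rcases hpen.eq_or_lt with hz | hpos
    · have hfin : FiniteDimensional ℂ X := by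
        refine h0.resolve_right ?_
        rintro ⟨j, hj⟩
        have := eq_zero_of_piPenalty_eq_zero (by omega : 1 ≤ n) hz.symm j
        tauto
      obtain ⟨δ, hδ, h⟩ := exists_le_recipNormInv_of_isUnit
        (W := PiLp 2 (fun _ : Fin n => X)) hr (K + ‖lam‖)
      refine ⟨δ, hδ, fun k => ?_⟩
      rw [← hz, add_zero]
      exact h _ (hK' k) fun μ hμ => isUnit_of_recipNormInv_pos (hpen.trans_lt (hgt k μ hμ))
    · obtain ⟨δ, hδ, h⟩ := hX.exists_le_recipNormInv (by omega : 1 ≤ n) hpos (half_pos hr)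
        (K + ‖lam‖)
      refine ⟨δ, hδ, fun k => ?_⟩
      rw [add_comm]
      exact h _ (hK' k) fun μ hμ => (hgt k μ (by linarith)).le
  obtain ⟨k, hk⟩ := exists_recipNormInv_periodisedSection_lt hA ht (hlam'.trans_lt hδ) hn
  exact absurd (hδk k) (not_le.2 hk)

theorem closedPseudospectrum_subset_piClosed {A : EllTwo X →L[ℂ] EllTwo X}
    (hX : GlobevnikProperty X) (hA : IsTridiagonal A) {t : ℂ} (ht : ‖t‖ = 1) {ε : ℝ} (hε : 0 ≤ ε)
    (h0 : 0 < ε ∨ FiniteDimensional ℂ X ∨ ∃ j : ℤ, subdiag A j ≠ 0 ∨ superdiag A j ≠ 0) {n : ℕ}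
    (hn : 2 ≤ n) : closedPseudospectrum ε A ⊆ piClosed A t n (ε + piPenalty A n) := by
  rcases hε.eq_or_lt with rfl | hpos
  · rw [zero_add]
    exact spectrum_subset_piClosed hX hA ht (h0.resolve_left (lt_irrefl _)) hn
  · refine (closedPseudospectrum_subset_closure hX hA hpos).trans
      (closure_minimal ?_ isClosed_closure)
    exact (openPseudospectrum_subset_piOpen hA ht ε hn).trans (piOpen_subset_piClosed A t n _)

/-- The margin θ turns closed pseudospectra into open ones, to which the no-pollution hypothesis
applies; the closure is absorbed because the right-hand side is closed. -/
theorem piClosed_subset {A : EllTwo X →L[ℂ] EllTwo X} {t : ℂ} {n : ℕ} {η : ℝ}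
    (h : ∀ ε : ℝ, 0 < ε → ∀ k : ℤ,
      openPseudospectrum ε (periodisedSection A t n k) ⊆ openPseudospectrum (ε + η) A)
    {ε θ : ℝ} (hε : 0 ≤ ε) (hθ : 0 < θ) :
    piClosed A t n ε ⊆ closedPseudospectrum (ε + θ + η) A := by
  refine closure_minimal (Set.iUnion_subset fun k lam hlam => ?_)
    (isClosed_closedPseudospectrum _ A)
  have hlam' : recipNormInv (periodisedSection A t n k
    - lam • ContinuousLinearMap.id ℂ (PiLp 2 fun _ : Fin n => X)) ≤ ε := hlam
  exact openPseudospectrum_subset_closed _ _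
    (h (ε + θ) (by positivity) k (hlam'.trans_lt (lt_add_of_pos_right ε hθ)))

/-- On the compact part of the (ε + 1)-pseudospectrum at distance at least δ from the
ε-pseudospectrum, ν has a minimum greater than ε; θ is taken to be at most half that gap. -/
theorem exists_closedPseudospectrum_near {Y : Type*} [NormedAddCommGroup Y] [NormedSpace ℂ Y]
    [CompleteSpace Y] [Nontrivial Y] (A : Y →L[ℂ] Y) (ε : ℝ) {δ : ℝ} (hδ : 0 < δ) :
    ∃ θ : ℝ, 0 < θ ∧ ∀ lam ∈ closedPseudospectrum (ε + θ) A, ∃ μ ∈ closedPseudospectrum ε A,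
      dist lam μ < δ := by
  set S := closedPseudospectrum (ε + 1) A \ Metric.thickening δ (closedPseudospectrum ε A)
  have hS : IsCompact S :=
    (Metric.isCompact_of_isClosed_isBounded (isClosed_closedPseudospectrum _ A)
      (isBounded_closedPseudospectrum _ A)).diff Metric.isOpen_thickening
  rcases S.eq_empty_or_nonempty with h0 | hne
  · refine ⟨1, one_pos, fun lam hlam => ?_⟩
    by_contra hcon
    have : lam ∈ S := ⟨hlam, fun h => hcon (Metric.mem_thickening_iff.1 h)⟩
    rw [h0] at this
    exact this
  · obtain ⟨μ₀, hμ₀, hmin⟩ :=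
      hS.exists_isMinOn hne (continuous_recipNormInv_sub_smul A).continuousOn
    set m := recipNormInv (A - μ₀ • ContinuousLinearMap.id ℂ Y) with hm
    have hεm : ε < m := by
      by_contra! hle
      exact hμ₀.2 (Metric.self_subset_thickening hδ _ hle)
    refine ⟨min 1 ((m - ε) / 2), lt_min one_pos (by linarith), fun lam hlam => ?_⟩
    have hlam' : recipNormInv (A - lam • ContinuousLinearMap.id ℂ Y)
      ≤ ε + min 1 ((m - ε) / 2) := hlam
    by_contra hcon
    have hmem : lam ∈ S := by
      refine ⟨hlam'.trans ?_, fun h => hcon (Metric.mem_thickening_iff.1 h)⟩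
      linarith [min_le_left 1 ((m - ε) / 2)]
    have h1 : m ≤ recipNormInv (A - lam • ContinuousLinearMap.id ℂ Y) := hmin hmem
    linarith [min_le_right 1 ((m - ε) / 2)]

theorem tendsto_hausdorffDist_zero {S : ℕ → Set ℂ} {T : Set ℂ}
    (h1 : ∀ δ : ℝ, 0 < δ → ∀ᶠ n in atTop, ∀ x ∈ S n, ∃ y ∈ T, dist x y ≤ δ)
    (h2 : ∀ᶠ n in atTop, T ⊆ S n) :
    Tendsto (fun n => Metric.hausdorffDist (S n) T) atTop (𝓝 0) := by
  rw [Metric.tendsto_nhds]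
  intro δ hδ
  filter_upwards [h1 (δ / 2) (half_pos hδ), h2] with n hn1 hn2
  rw [Real.dist_eq, sub_zero, abs_of_nonneg Metric.hausdorffDist_nonneg]
  have := Metric.hausdorffDist_le_of_mem_dist (half_pos hδ).le hn1
    fun x hx => ⟨x, hn2 hx, by simpa using (half_pos hδ).le⟩
  linarith

end PiMethod

/-! ### Convergence of both versions of the method -/

theorem theorem1p4 {X : Type*} [NormedAddCommGroup X] [NormedSpace ℂ X] [CompleteSpace X]
    [Nontrivial X] (hX : GlobevnikProperty X)
    (A : EllTwo X →L[ℂ] EllTwo X) (hA : IsTridiagonal A)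
    (t : ℂ) (ht : ‖t‖ = 1) (hpol : PiNoSpectralPollution A t) :
    (∀ ε : ℝ, 0 ≤ ε →
      (0 < ε ∨ FiniteDimensional ℂ X ∨ ∃ j : ℤ, subdiag A j ≠ 0 ∨ superdiag A j ≠ 0) →
      HausdorffConverges (fun n => piClosed A t n (ε + piPenalty A n))
        (closedPseudospectrum ε A)) ∧
    (∀ ε : ℝ, 0 < ε →
      HausdorffConverges (fun n => piOpen A t n (ε + piPenalty A n))
        (openPseudospectrum ε A)) := by
  obtain ⟨η, hη, hηlim, hpol⟩ := hpol
  have hsub : ∀ ε : ℝ, 0 ≤ ε → ∀ θ : ℝ, 0 < θ → ∀ n : ℕ, 1 ≤ n →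
      piClosed A t n (ε + piPenalty A n) ⊆ closedPseudospectrum (ε + piPenalty A n + θ + η n) A :=
    fun ε hε θ hθ n hn => piClosed_subset (fun ε hε k => hpol ε hε n hn k)
      (add_nonneg hε (piPenalty_nonneg A hn)) hθ
  have hbdd : ∀ ε : ℝ, 0 ≤ ε → ∀ n : ℕ, 1 ≤ n →
      Bornology.IsBounded (piClosed A t n (ε + piPenalty A n)) := fun ε hε n hn =>
    (isBounded_closedPseudospectrum _ A).subset (hsub ε hε 1 one_pos n hn)
  have hnear : ∀ ε : ℝ, 0 ≤ ε → ∀ δ : ℝ, 0 < δ → ∀ᶠ n in atTop,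
      ∀ x ∈ piClosed A t n (ε + piPenalty A n), ∃ y ∈ closedPseudospectrum ε A, dist x y < δ := by
    intro ε hε δ hδ
    obtain ⟨θ, hθ, h⟩ := exists_closedPseudospectrum_near A ε hδ
    have hlim := (tendsto_piPenalty A).add hηlim
    rw [add_zero] at hlim
    filter_upwards [hlim.eventually_lt_const (half_pos hθ), eventually_ge_atTop 1] with n hn hn1 x hx
    refine h x ?_
    have h1 : recipNormInv (A - x • ContinuousLinearMap.id ℂ (EllTwo X))
      ≤ ε + piPenalty A n + θ / 2 + η n := hsub ε hε (θ / 2) (half_pos hθ) n hn1 hx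
    exact h1.trans (by linarith)
  refine ⟨fun ε hε h0 => ⟨fun n hn => ⟨?_, hbdd ε hε n hn⟩, ?_, isBounded_closedPseudospectrum ε A,
    tendsto_hausdorffDist_zero (fun δ hδ => ?_) ?_⟩, fun ε hε => ⟨fun n hn => ⟨?_, ?_⟩, ?_, ?_,
    tendsto_hausdorffDist_zero (fun δ hδ => ?_) ?_⟩⟩
  · have := nontrivial_piLp (X := X) hn
    obtain ⟨lam, hlam⟩ := exists_recipNormInv_eq_zero (periodisedSection A t n 0)
    refine ⟨lam, subset_closure (Set.mem_iUnion.2 ⟨0, hlam.le.trans ?_⟩)⟩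
    exact add_nonneg hε (piPenalty_nonneg A hn)
  · obtain ⟨lam, hlam⟩ := exists_recipNormInv_eq_zero A
    exact ⟨lam, hlam.le.trans hε⟩
  · exact (hnear ε hε δ hδ).mono fun n hn x hx => (hn x hx).imp fun y hy => ⟨hy.1, hy.2.le⟩
  · exact (eventually_ge_atTop 2).mono fun n hn =>
      closedPseudospectrum_subset_piClosed hX hA ht hε h0 hn
  · have := nontrivial_piLp (X := X) hn
    obtain ⟨lam, hlam⟩ := exists_recipNormInv_eq_zero (periodisedSection A t n 0)
    refine ⟨lam, Set.mem_iUnion.2 ⟨0, hlam.trans_lt ?_⟩⟩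
    exact add_pos_of_pos_of_nonneg hε (piPenalty_nonneg A hn)
  · exact (hbdd ε hε.le n hn).subset (piOpen_subset_piClosed A t n _)
  · obtain ⟨lam, hlam⟩ := exists_recipNormInv_eq_zero A
    exact ⟨lam, hlam.trans_lt hε⟩
  · exact (isBounded_closedPseudospectrum ε A).subset (openPseudospectrum_subset_closed ε A)
  -- Only closeness to the closed pseudospectrum is known; the other δ/2 moves the point into the
  -- open one, which is dense in it by Globevnik's theorem.
  · refine (hnear ε hε.le (δ / 2) (half_pos hδ)).mono fun n hn x hx => ?_
    obtain ⟨y, hy, hxy⟩ := hn x (piOpen_subset_piClosed A t n _ hx)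
    obtain ⟨z, hz, hyz⟩ := Metric.mem_closure_iff.1
      (closedPseudospectrum_subset_closure hX hA hε hy) (δ / 2) (half_pos hδ)
    exact ⟨z, hz, (dist_triangle x y z).trans (by linarith)⟩
  · exact (eventually_ge_atTop 2).mono fun n hn => openPseudospectrum_subset_piOpen hA ht ε hn
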